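/- Let $(M,\omega)$ be a symplectic manifold of dimension $2n\ge 4$ with a Riemannian metric compatible with $\omega$. Let $P\to M$ be a smooth principal $G$-bundle for a Lie group $G$ whose Lie algebra carries an $\mathrm{Ad}$-invariant inner product, and let $A$ be a smooth connection on $P$ with curvature $F\in\Omega^2(M,\mathrm{Ad}\,P)$. Write the Lefschetz decomposition of the curvature as $F=F_p+\Phi\,\omega$, with $F_p\in\Omega^2(M,\mathrm{Ad}\,P)$ primitive (that is, $\Lambda F_p=0$, where $\Lambda$ is the adjoint of $\omega\wedge\cdot$) and $\Phi\in\Omega^0(M,\mathrm{Ad}\,P)$. Consider the functionals $\|F\|^2$, $\|F_p\|^2$ and $\|\Phi\,\omega\|^2$ of the connection, where $\|\cdot\|$ is the $L^2$-norm induced by the metric on $M$ and the inner product on the Lie algebra. The connection $A$ is called a critical point of one of them if for every compact $K\subseteq M$ and every $\eta\in\Omega^1(M,\mathrm{Ad}\,P)$ that vanishes outside $K$, the functional with the integral taken over $K$ has derivative $0$ at $t=0$ along $A+t\eta$ (for compact $M$ this is the usual notion, with $K=M$). Let $d_A$ be the covariant derivative and $d_A^*$ its formal adjoint. Then: 1.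 $A$ is a critical point of $\|F\|^2$ if and only if $d_A^*F=0$; 2. $A$ is a critical point of $\|F_p\|^2$ if and only if $d_A^*F_p=0$; 3. $A$ is a critical point of $\|\Phi\,\omega\|^2$ if and only if $d_A\Phi=0$; 4. if $A$ is a critical point of two of the functionals $\|F\|^2$, $\|F_p\|^2$ and $\|\Phi\,\omega\|^2$, then it is also a critical point of the third. -/

import Mathlib

open Bundle Set MeasureTheory
open scoped Manifold ContDiff RightActions

noncomputable section

namespace YangMills

/-! ### Coordinate vector fields and the exterior derivative of one-forms -/

section Forms

variable {E : Type*} [NormedAddCommGroup E] [NormedSpace ℝ E]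
  {X : Type*} [TopologicalSpace X] [ChartedSpace E X] [IsManifold 𝓘(ℝ, E) ∞ X]
  {V : Type*} [NormedAddCommGroup V] [NormedSpace ℝ V]

/-- The vector field, defined on the domain of the preferred chart at `x₀`, whose coordinate
expression in that chart is the constant vector `v`. At `x₀` itself its value is `v`, seen as an
element of `T_{x₀} X`. -/
def coordField (x₀ : X) (v : TangentSpace 𝓘(ℝ, E) x₀) (x : X) : TangentSpace 𝓘(ℝ, E) x :=
  (trivializationAt E (TangentSpace 𝓘(ℝ, E)) x₀).symmL ℝ x v

/-- Smoothness of a `V`-valued one-form on `X`. -/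
def SmoothOneForm (θ : (x : X) → TangentSpace 𝓘(ℝ, E) x →L[ℝ] V) : Prop :=
  ContMDiff 𝓘(ℝ, E) (𝓘(ℝ, E).prod 𝓘(ℝ, E →L[ℝ] V)) ∞
    (fun x => TotalSpace.mk' (E →L[ℝ] V)
      (E := fun x : X => TangentSpace 𝓘(ℝ, E) x →L[ℝ] V) x (θ x))

/-- The derivative `u(f)` of a `V`-valued function `f` in the direction `u`. -/
def dirDeriv (f : X → V) (x : X) (u : TangentSpace 𝓘(ℝ, E) x) : V :=
  mfderiv 𝓘(ℝ, E) 𝓘(ℝ, V) f x u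

/-- The exterior derivative of a `V`-valued one-form: `dθ(u, w) = u(θ(W)) - w(θ(U))`, where
`U`, `W` are the (commuting) coordinate vector fields that extend `u` and `w`. -/
def extDerivOne (θ : (x : X) → TangentSpace 𝓘(ℝ, E) x →L[ℝ] V) (x : X)
    (u w : TangentSpace 𝓘(ℝ, E) x) : V :=
  dirDeriv (fun y => θ y (coordField x w y)) x u - dirDeriv (fun y => θ y (coordField x u y)) x w

end Forms

/-! ### Lie groups

The Lie algebra of `G` is its tangent space at the identity, whose underlying vector space in
Mathlib is the model space `EG`. Forms with values in the Lie algebra take values in `EG`. -/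

section LieGroups

variable {EG : Type*} [NormedAddCommGroup EG] [NormedSpace ℝ EG]
  {G : Type*} [TopologicalSpace G] [ChartedSpace EG G] [Group G]

/-- The adjoint representation: `Ad g` is the derivative at `1` of `h ↦ g h g⁻¹`. -/
def Ad (g : G) : EG →L[ℝ] EG :=
  mfderiv 𝓘(ℝ, EG) 𝓘(ℝ, EG) (fun h : G => g * h * g⁻¹) (1 : G)

variable (G) in
/-- The bracket of the Lie algebra of `G`. -/
def lieBr (a b : EG) : EG :=
  @Bracket.bracket (GroupLieAlgebra 𝓘(ℝ, EG) G) (GroupLieAlgebra 𝓘(ℝ, EG) G) _ a b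

variable (EG G) in
/-- An inner product on the Lie algebra of `G`, invariant under the adjoint representation. -/
structure AdInvariantInner where
  /-- the bilinear form -/
  inner : EG →L[ℝ] EG →L[ℝ] ℝ
  symm : ∀ a b, inner a b = inner b a
  pos : ∀ a, a ≠ 0 → 0 < inner a a
  ad_inv : ∀ (g : G) (a b : EG), inner (Ad g a) (Ad g b) = inner a b

end LieGroups

/-! ### Symplectic manifolds with a compatible metric -/

section Symplectic

/-- The model space `ℝ^{2n}`. -/
abbrev Euc (n : ℕ) := EuclideanSpace ℝ (Fin (2 * n))

variable (n : ℕ) (M : Type*) [TopologicalSpace M] [ChartedSpace (Euc n) M]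
  [IsManifold 𝓘(ℝ, Euc n) ∞ M]

/-- A symplectic form: a smooth, closed, nondegenerate 2-form. -/
structure SymplecticForm where
  /-- the bilinear form on each tangent space -/
  form : (x : M) → TangentSpace 𝓘(ℝ, Euc n) x →L[ℝ] TangentSpace 𝓘(ℝ, Euc n) x →L[ℝ] ℝ
  smooth : ContMDiff 𝓘(ℝ, Euc n) (𝓘(ℝ, Euc n).prod 𝓘(ℝ, Euc n →L[ℝ] Euc n →L[ℝ] ℝ)) ∞
    (fun x => TotalSpace.mk' (Euc n →L[ℝ] Euc n →L[ℝ] ℝ)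
      (E := fun x : M => TangentSpace 𝓘(ℝ, Euc n) x →L[ℝ] TangentSpace 𝓘(ℝ, Euc n) x →L[ℝ] ℝ)
      x (form x))
  alt : ∀ x v, form x v v = 0
  nondeg : ∀ x v, (∀ w, form x v w = 0) → v = 0
  /-- `dω = 0`: for coordinate vector fields `U`, `V`, `W`,
  `U(ω(V, W)) + V(ω(W, U)) + W(ω(U, V)) = 0`. -/
  closed : ∀ (x : M) (u v w : TangentSpace 𝓘(ℝ, Euc n) x),
    dirDeriv (fun y => form y (coordField x v y) (coordField x w y)) x u +
      dirDeriv (fun y => form y (coordField x w y) (coordField x u y)) x v +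
      dirDeriv (fun y => form y (coordField x u y) (coordField x v y)) x w = 0

/-- Smooth Riemannian metrics on `M`. -/
abbrev RiemMetric := ContMDiffRiemannianMetric 𝓘(ℝ, Euc n) ∞ (Euc n)
  (fun x : M => TangentSpace 𝓘(ℝ, Euc n) x)

variable {n M}

/-- `g` is compatible with the symplectic form `ω` (here `Ω`): `g(u, v) = ω(u, J v)` for an almost complex structure `J`. -/
def Compatible (Ω : SymplecticForm n M) (g : RiemMetric n M) : Prop :=
  ∀ x : M, ∃ J : TangentSpace 𝓘(ℝ, Euc n) x →ₗ[ℝ] TangentSpace 𝓘(ℝ, Euc n) x,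
    (∀ v, J (J v) = -v) ∧ ∀ u v, g.inner x u v = Ω.form x u (J v)

/-- The coordinate frame `∂_i` of the chart at `x₀`. -/
def frame (x₀ : M) (i : Fin (2 * n)) (x : M) : TangentSpace 𝓘(ℝ, Euc n) x :=
  coordField x₀ (EuclideanSpace.single i (1 : ℝ) : Euc n) x

/-- The matrix `g_{ij}` of the metric in the coordinates of the chart at `x₀`. -/
def gram (g : RiemMetric n M) (x₀ x : M) : Matrix (Fin (2 * n)) (Fin (2 * n)) ℝ :=
  Matrix.of fun i j => g.inner x (frame x₀ i x) (frame x₀ j x)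

/-- The Riemannian density `√(det g_{ij})` in the coordinates of the chart at `x₀`. -/
def density (g : RiemMetric n M) (x₀ x : M) : ℝ := Real.sqrt (gram g x₀ x).det

variable (n M) in
/-- A smooth partition of unity subordinate to the chart domains. -/
def chartPartition [T2Space M] [SigmaCompactSpace M] :
    SmoothPartitionOfUnity M 𝓘(ℝ, Euc n) M univ :=
  Classical.choose (SmoothPartitionOfUnity.exists_isSubordinate_chartAt_source 𝓘(ℝ, Euc n) M)

/-- The Riemannian volume measure, which for a compatible metric is that of `ω^n / n!`:
`∫ f dvol = ∑_c ∫ (ρ_c f √(det g_{ij})) dx^1 ⋯ dx^{2n}`, the sum being over the charts, with the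
integrals taken in coordinates, for a partition of unity `ρ` subordinate to the chart domains. -/
def vol [T2Space M] [SigmaCompactSpace M] [MeasurableSpace M] (g : RiemMetric n M) : Measure M :=
  Measure.sum fun c : M =>
    Measure.map (extChartAt 𝓘(ℝ, Euc n) c).symm
      ((volume.restrict (extChartAt 𝓘(ℝ, Euc n) c).target).withDensity fun y =>
        ENNReal.ofReal (chartPartition n M c ((extChartAt 𝓘(ℝ, Euc n) c).symm y) *
          density g c ((extChartAt 𝓘(ℝ, Euc n) c).symm y)))

end Symplectic

/-! ### Principal bundles and connections -/

section Principal

variable {EM : Type*} [NormedAddCommGroup EM] [NormedSpace ℝ EM]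
  {M : Type*} [TopologicalSpace M] [ChartedSpace EM M]
  {EG : Type*} [NormedAddCommGroup EG] [NormedSpace ℝ EG]
  {G : Type*} [TopologicalSpace G] [ChartedSpace EG G] [Group G]
  {EP : Type*} [NormedAddCommGroup EP] [NormedSpace ℝ EP]
  {P : Type*} [TopologicalSpace P] [ChartedSpace EP P] [MulAction Gᵐᵒᵖ P]

variable (EM EG EP G) in
/-- `pr : P → M` is a smooth principal `G`-bundle: `G` acts smoothly on `P` from the right, preserving
the fibres of the smooth map `pr`, and around every point of `M` there are an open set `U` and a
smooth section `σ` over `U` such that `(y, a) ↦ σ(y) a` is a diffeomorphism from `U × G` onto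
`pr⁻¹(U)` (with inverse `p ↦ (pr(p), τ(p))`). -/
structure IsPrincipalBundle (pr : P → M) : Prop where
  smooth_proj : ContMDiff 𝓘(ℝ, EP) 𝓘(ℝ, EM) ∞ pr
  smooth_action : ContMDiff (𝓘(ℝ, EP).prod 𝓘(ℝ, EG)) 𝓘(ℝ, EP) ∞ (fun q : P × G => q.1 <• q.2)
  proj_action : ∀ (p : P) (a : G), pr (p <• a) = pr p
  locally_trivial : ∀ x : M, ∃ U : Set M, IsOpen U ∧ x ∈ U ∧ ∃ (σ : M → P) (τ : P → G),
    ContMDiffOn 𝓘(ℝ, EM) 𝓘(ℝ, EP) ∞ σ U ∧ ContMDiffOn 𝓘(ℝ, EP) 𝓘(ℝ, EG) ∞ τ (pr ⁻¹' U) ∧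
    (∀ y ∈ U, pr (σ y) = y) ∧ (∀ p ∈ pr ⁻¹' U, σ (pr p) <• τ p = p) ∧
    ∀ y ∈ U, ∀ a : G, τ (σ y <• a) = a

variable [IsManifold 𝓘(ℝ, EP) ∞ P]

variable (EG G EP P) in
/-- A connection one-form on `P`. -/
structure Connection where
  /-- the Lie algebra valued one-form on `P` -/
  form : (p : P) → TangentSpace 𝓘(ℝ, EP) p →L[ℝ] EG
  smooth : SmoothOneForm form
  /-- `A` maps the fundamental vector field of `v` to `v`. -/
  fundamental : ∀ (p : P) (v : EG),
    form (p <• (1 : G)) (mfderiv 𝓘(ℝ, EG) 𝓘(ℝ, EP) (fun a : G => p <• a) (1 : G) v) = v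
  /-- `R_a^* A = Ad(a⁻¹) A`. -/
  equivariant : ∀ (p : P) (a : G) (w : TangentSpace 𝓘(ℝ, EP) p),
    form (p <• a) (mfderiv 𝓘(ℝ, EP) 𝓘(ℝ, EP) (fun q : P => q <• a) p w) = Ad a⁻¹ (form p w)

variable (EG G EP P) in
/-- An element of `Ω¹(M, Ad P)`, seen as a horizontal and equivariant one-form on `P`. -/
structure AdOneForm where
  /-- the Lie algebra valued one-form on `P` -/
  form : (p : P) → TangentSpace 𝓘(ℝ, EP) p →L[ℝ] EG
  smooth : SmoothOneForm form
  horizontal : ∀ (p : P) (v : EG),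
    form (p <• (1 : G)) (mfderiv 𝓘(ℝ, EG) 𝓘(ℝ, EP) (fun a : G => p <• a) (1 : G) v) = 0
  equivariant : ∀ (p : P) (a : G) (w : TangentSpace 𝓘(ℝ, EP) p),
    form (p <• a) (mfderiv 𝓘(ℝ, EP) 𝓘(ℝ, EP) (fun q : P => q <• a) p w) = Ad a⁻¹ (form p w)

variable (G) in
/-- The curvature `F = dA + ½ [A, A]`, i.e. `F(u, w) = dA(u, w) + [A(u), A(w)]`. -/
def curvature (A : (p : P) → TangentSpace 𝓘(ℝ, EP) p →L[ℝ] EG) (p : P)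
    (u w : TangentSpace 𝓘(ℝ, EP) p) : EG :=
  extDerivOne A p u w + lieBr G (A p u) (A p w)

variable (G) in
/-- The covariant derivative `d_A s = ds + [A, s]` of a section `s` of `Ad P`, seen as an
equivariant function on `P`. -/
def covDeriv (A : (p : P) → TangentSpace 𝓘(ℝ, EP) p →L[ℝ] EG) (s : P → EG) (p : P)
    (u : TangentSpace 𝓘(ℝ, EP) p) : EG :=
  dirDeriv s p u + lieBr G (A p u) (s p)

variable (EM) in
/-- The horizontal lift to `T_p P` of a vector `u ∈ T_{pr(p)} M`: the vector `w` with `dπ(w) = u`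
and `A(w) = 0`. -/
def horLift (pr : P → M) (A : (p : P) → TangentSpace 𝓘(ℝ, EP) p →L[ℝ] EG) (p : P)
    (u : TangentSpace 𝓘(ℝ, EM) (pr p)) : TangentSpace 𝓘(ℝ, EP) p :=
  ((mfderiv 𝓘(ℝ, EP) 𝓘(ℝ, EM) pr p).prod (A p)).inverse (u, 0)

end Principal

/-! ### The three functionals -/

section Functionals

variable {n : ℕ} {M : Type*} [TopologicalSpace M] [ChartedSpace (Euc n) M]
  [IsManifold 𝓘(ℝ, Euc n) ∞ M]
  {EG : Type*} [NormedAddCommGroup EG] [NormedSpace ℝ EG]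
  {G : Type*} [TopologicalSpace G] [ChartedSpace EG G] [Group G]
  {EP : Type*} [NormedAddCommGroup EP] [NormedSpace ℝ EP]
  {P : Type*} [TopologicalSpace P] [ChartedSpace EP P] [MulAction Gᵐᵒᵖ P]
  [IsManifold 𝓘(ℝ, EP) ∞ P]

/-- The components `α_{ij}` at `p` of a horizontal 2-form `α` on `P`, in the coordinates of `M` given
by the chart at `x₀`: the values of `α` on the horizontal lifts of the `∂_i`. -/
def formComp (pr : P → M) (A : (p : P) → TangentSpace 𝓘(ℝ, EP) p →L[ℝ] EG) (x₀ : M)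
    (α : (p : P) → TangentSpace 𝓘(ℝ, EP) p → TangentSpace 𝓘(ℝ, EP) p → EG) (p : P)
    (i j : Fin (2 * n)) : EG :=
  α p (horLift (Euc n) pr A p (frame x₀ i (pr p))) (horLift (Euc n) pr A p (frame x₀ j (pr p)))

/-- The components with raised indices, `α^{ij} = g^{ik} g^{jl} α_{kl}`. -/
def compUp (pr : P → M) (g : RiemMetric n M) (A : (p : P) → TangentSpace 𝓘(ℝ, EP) p →L[ℝ] EG) (x₀ : M)
    (α : (p : P) → TangentSpace 𝓘(ℝ, EP) p → TangentSpace 𝓘(ℝ, EP) p → EG) (p : P)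
    (i j : Fin (2 * n)) : EG :=
  ∑ k, ∑ l, ((gram g x₀ (pr p))⁻¹ i k * (gram g x₀ (pr p))⁻¹ j l) • formComp pr A x₀ α p k l

/-- The pointwise squared norm `|α|² = ½ ⟨α_{ij}, α^{ij}⟩` of a 2-form with values in `Ad P`, as a
(`G`-invariant) function on `P`. -/
def normSq (pr : P → M) (g : RiemMetric n M) (B : AdInvariantInner EG G)
    (A : (p : P) → TangentSpace 𝓘(ℝ, EP) p →L[ℝ] EG)
    (α : (p : P) → TangentSpace 𝓘(ℝ, EP) p → TangentSpace 𝓘(ℝ, EP) p → EG) (p : P) : ℝ :=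
  (1 / 2) * ∑ i, ∑ j, B.inner (formComp pr A (pr p) α p i j) (compUp pr g A (pr p) α p i j)

/-- The integral over `K ⊆ M` of the function on `M` induced by a `G`-invariant function on `P`
(whose value at `x` is the value of that function at any point of the fibre over `x`). -/
def integralOver [T2Space M] [SigmaCompactSpace M] [MeasurableSpace M] (pr : P → M) (g : RiemMetric n M)
    (K : Set M) (f : P → ℝ) : ℝ :=
  ∫ x in K, Function.extend pr f 0 x ∂(vol g)

variable (G) in
/-- The coefficient `Φ = (1/n) Λ F` of the Lefschetz decomposition `F = F_p + Φ ω`. Here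
`Λ α = ⟨ω, α⟩ = ½ ω_{ij} α^{ij}` is the dual Lefschetz operator on 2-forms, for which `Λ ω = n`. -/
def PhiOf (pr : P → M) (Ω : SymplecticForm n M) (g : RiemMetric n M)
    (A : (p : P) → TangentSpace 𝓘(ℝ, EP) p →L[ℝ] EG) (p : P) : EG :=
  (1 / (n : ℝ)) • (1 / 2 : ℝ) • ∑ i, ∑ j,
    Ω.form (pr p) (frame (pr p) i (pr p)) (frame (pr p) j (pr p)) •
      compUp pr g A (pr p) (curvature G A) p i j

variable (G) in
/-- The component `Φ ω` of the curvature. -/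
def PhiOmega (pr : P → M) (Ω : SymplecticForm n M) (g : RiemMetric n M)
    (A : (p : P) → TangentSpace 𝓘(ℝ, EP) p →L[ℝ] EG) (p : P)
    (u w : TangentSpace 𝓘(ℝ, EP) p) : EG :=
  Ω.form (pr p) (mfderiv 𝓘(ℝ, EP) 𝓘(ℝ, Euc n) pr p u) (mfderiv 𝓘(ℝ, EP) 𝓘(ℝ, Euc n) pr p w) •
    PhiOf G pr Ω g A p

variable (G) in
/-- The primitive component `F_p = F - Φ ω` of the curvature. -/
def primitivePart (pr : P → M) (Ω : SymplecticForm n M) (g : RiemMetric n M)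
    (A : (p : P) → TangentSpace 𝓘(ℝ, EP) p →L[ℝ] EG) (p : P)
    (u w : TangentSpace 𝓘(ℝ, EP) p) : EG :=
  curvature G A p u w - PhiOmega G pr Ω g A p u w

/-- `‖F‖²`, over `K ⊆ M`. -/
def energyF [T2Space M] [SigmaCompactSpace M] [MeasurableSpace M] (pr : P → M) (g : RiemMetric n M)
    (B : AdInvariantInner EG G) (K : Set M)
    (A : (p : P) → TangentSpace 𝓘(ℝ, EP) p →L[ℝ] EG) : ℝ :=
  integralOver pr g K (normSq pr g B A (curvature G A))

/-- `‖F_p‖²`, over `K ⊆ M`. -/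
def energyPrimitive [T2Space M] [SigmaCompactSpace M] [MeasurableSpace M] (pr : P → M)
    (Ω : SymplecticForm n M) (g : RiemMetric n M) (B : AdInvariantInner EG G) (K : Set M)
    (A : (p : P) → TangentSpace 𝓘(ℝ, EP) p →L[ℝ] EG) : ℝ :=
  integralOver pr g K (normSq pr g B A (primitivePart G pr Ω g A))

/-- `‖Φ ω‖²`, over `K ⊆ M`. -/
def energyPhiOmega [T2Space M] [SigmaCompactSpace M] [MeasurableSpace M] (pr : P → M)
    (Ω : SymplecticForm n M) (g : RiemMetric n M) (B : AdInvariantInner EG G) (K : Set M)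
    (A : (p : P) → TangentSpace 𝓘(ℝ, EP) p →L[ℝ] EG) : ℝ :=
  integralOver pr g K (normSq pr g B A (PhiOmega G pr Ω g A))

/-- `A` is a critical point of the functional `S`: for every variation `A + t η` with
`η ∈ Ω¹(M, Ad P)` supported in a compact set `K`, the derivative at `t = 0` of the functional over
`K` vanishes. (Outside `K` the variation does not change the curvature. If `M` is compact, this is
the same as `d/dt S(M, A + t η) = 0` at `t = 0` for all `η ∈ Ω¹(M, Ad P)`.) -/
def IsCriticalPoint (pr : P → M)
    (S : Set M → ((p : P) → TangentSpace 𝓘(ℝ, EP) p →L[ℝ] EG) → ℝ)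
    (A : Connection EG G EP P) : Prop :=
  ∀ (K : Set M), IsCompact K → ∀ η : AdOneForm EG G EP P, (∀ p, pr p ∉ K → η.form p = 0) →
    HasDerivAt (fun t : ℝ => S K (fun p => A.form p + t • η.form p)) 0 0

/-- The formal adjoint `d_A^* : Ω²(M, Ad P) → Ω¹(M, Ad P)` of `d_A`, evaluated at `p` on
`u ∈ T_{pr(p)} M`. In local coordinates on `M`,
`(d_A^* α)^j = - (det g)^{-1/2} D_i ((det g)^{1/2} α^{ij})`, where `D_i` is the covariant derivative
of sections of `Ad P` in the direction `∂_i`, i.e. the derivative along the horizontal lift of `∂_i`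
of equivariant functions on `P`. This is `- * d_A *`, with the Hodge star of the metric. -/
def codiff (pr : P → M) (g : RiemMetric n M) (A : (p : P) → TangentSpace 𝓘(ℝ, EP) p →L[ℝ] EG)
    (α : (p : P) → TangentSpace 𝓘(ℝ, EP) p → TangentSpace 𝓘(ℝ, EP) p → EG) (p : P)
    (u : TangentSpace 𝓘(ℝ, Euc n) (pr p)) : EG :=
  -∑ i, ∑ j, (g.inner (pr p) (frame (pr p) j (pr p)) u * (density g (pr p) (pr p))⁻¹) •
    dirDeriv (fun q : P => density g (pr p) (pr q) • compUp pr g A (pr p) α q i j) p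
      (horLift (Euc n) pr A p (frame (pr p) i (pr p)))

end Functionals

end YangMills

end

open YangMills

/-!
Over a chart of the base, with a local section of the bundle (a `Gauge`), a connection becomes a
Lie-algebra-valued one-form `a`, and its curvature has the components
`F_{ij} = ∂_i a_j - ∂_j a_i + [a_i, a_j]`. That this expression agrees with the curvature evaluated on
horizontal lifts rests on three facts: the derivative of `Ad` at the identity is the Lie bracket
(`lieBr_eq_adL`), the curvature is horizontal (`IsPrincipalBundle.curvatureL_fund`), and the
horizontal lift of `u` in a gauge is `ds(u)` minus the fundamental vector of `a(u)`
(`Gauge.horLift_eq`).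

In these terms the density of each of the three functionals is `½ N^{ijkl} ⟨F_{ij}, F_{kl}⟩ √(det g)`
(`HasCoeff`). For `‖F‖²` the coefficients are `g^{ik} g^{jl}`. For `‖Φ ω‖²` they are
`(1 / 2n) W^{ij} W^{kl}`, where `W` is the inverse of the matrix of `ω`: compatibility of the metric
means that raising the indices of `ω` gives `-W` (`gram_inv_mul_omegaMat_mul`). The Lefschetz
decomposition is orthogonal, so the coefficients for `‖F_p‖²` are the difference of these two
(`normSq_primitivePart`).

The curvature of `A + t η` is `F + t d_A η + t² [η, η] / 2`, so the density at `A + t η` is a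
polynomial of degree four in `t`, and the functional may be differentiated under the integral sign
(`HasCoeff.hasDerivAt`). When `η` is supported in the domain of a gauge, covariant integration by parts
(`integral_covariant_by_parts`, where the `Ad`-invariance of the inner product enters) turns the first
variation into the pairing of `η` with the Euler-Lagrange expression
`∂_i (√(det g) N^{ijkl} F_{kl}) + [a_i, √(det g) N^{ijkl} F_{kl}]` (`HasCoeff.integral_firstVar`). Test
forms and the fundamental lemma of the calculus of variations give one direction of the
Euler-Lagrange equations, a partition of unity the other (`HasCoeff.isCriticalPoint_iff`). It suffices
to have the equations at the centres of the charts, because the pairing is the same in every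
gauge and every chart: all these pairings are continuous and represent the same first variation, so
the transformation law of the divergence is not needed (`HasCoeff.pairing_eq`).

For `F` and `F_p` the Euler-Lagrange expression is `-√(det g)` times `d_A^* F` or `d_A^* F_p` with its
index raised (`codiff_eq`). For `Φ ω` it is the covariant divergence of `-√(det g) W^{ij} Φ`. Here
`√(det g) = √|det ω|`, and since `ω` is closed the bivector `√|det ω| W^{ij}` has divergence zero by
Jacobi's formula (`sum_fderiv_sqrt_det_mul_inv`); what remains is the contraction of `d_A Φ` with
an invertible matrix (`Gauge.eulerLagrange_phi`). Finally, the Euler-Lagrange expression is linear in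
the coefficients `N` (`Gauge.eulerLagrange_sub`), so that any two of the three systems of
Euler-Lagrange equations imply the third.
-/

set_option linter.unusedSectionVars false
set_option linter.unusedSimpArgs false
open Bundle Set MeasureTheory
open scoped Manifold ContDiff RightActions
noncomputable section
namespace YangMills

/-! ### One-forms on manifolds, read in charts and pulled back -/

section ChartCalculus
open Filter Topology

variable {E : Type*} [NormedAddCommGroup E] [NormedSpace ℝ E]
  {X : Type*} [TopologicalSpace X] [ChartedSpace E X]
  {V : Type*} [NormedAddCommGroup V] [NormedSpace ℝ V]
  {E' : Type*} [NormedAddCommGroup E'] [NormedSpace ℝ E']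

/-- The pull-back of a one-form to a normed space. -/
def pullForm (θ : (x : X) → TangentSpace 𝓘(ℝ, E) x →L[ℝ] V) (f : E' → X) (y : E') : E' →L[ℝ] V :=
  (θ (f y)).comp (mfderiv 𝓘(ℝ, E') 𝓘(ℝ, E) f y)

/-- The value of a one-form as a linear form on the model space, to which every tangent space is
definitionally equal. -/
def formAt (θ : (x : X) → TangentSpace 𝓘(ℝ, E) x →L[ℝ] V) (x : X) : E →L[ℝ] V := θ x

variable (E E') in
/-- The derivative of a map between manifolds as a map between the model spaces, to which the
tangent spaces are definitionally equal; its type does not depend on the base point. -/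
def mder {Y : Type*} [TopologicalSpace Y] [ChartedSpace E' Y] (f : X → Y) (x : X) : E →L[ℝ] E' :=
  mfderiv 𝓘(ℝ, E) 𝓘(ℝ, E') f x

lemma mder_comp {Y : Type*} [TopologicalSpace Y] [ChartedSpace E' Y]
    {E'' : Type*} [NormedAddCommGroup E''] [NormedSpace ℝ E'']
    {Z : Type*} [TopologicalSpace Z] [ChartedSpace E'' Z] {f : X → Y} {h : Y → Z} {x : X}
    (hh : MDifferentiableAt 𝓘(ℝ, E') 𝓘(ℝ, E'') h (f x))
    (hf : MDifferentiableAt 𝓘(ℝ, E) 𝓘(ℝ, E') f x) :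
    mder E E'' (h ∘ f) x = (mder E' E'' h (f x)).comp (mder E E' f x) :=
  mfderiv_comp x hh hf

lemma mder_congr {Y : Type*} [TopologicalSpace Y] [ChartedSpace E' Y] {f h : X → Y} {x : X}
    (hfh : f =ᶠ[𝓝 x] h) : mder E E' f x = mder E E' h x :=
  hfh.mfderiv_eq

lemma mder_eq_fderiv {f : E' → V} {x : E'} : mder E' V f x = fderiv ℝ f x := mfderiv_eq_fderiv

variable [IsManifold 𝓘(ℝ, E) ∞ X]

lemma coordField_eq_mfderiv {x₀ x : X} (hx : x ∈ (chartAt E x₀).source) (v : E) :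
    coordField x₀ v x =
      mfderiv 𝓘(ℝ, E) 𝓘(ℝ, E) (extChartAt 𝓘(ℝ, E) x₀).symm (extChartAt 𝓘(ℝ, E) x₀ x) v := by
  unfold coordField
  rw [TangentBundle.symmL_trivializationAt hx]
  rw [show range 𝓘(ℝ, E) = univ by simp, mfderivWithin_univ]
  rfl

/-- A one-form read in the chart at `x₀`, in the trivialization of the tangent bundle given by this
chart. -/
def chartForm (θ : (x : X) → TangentSpace 𝓘(ℝ, E) x →L[ℝ] V) (x₀ : X) (z : E) : E →L[ℝ] V :=
  (θ ((extChartAt 𝓘(ℝ, E) x₀).symm z)).comp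
    ((trivializationAt E (TangentSpace 𝓘(ℝ, E)) x₀).symmL ℝ ((extChartAt 𝓘(ℝ, E) x₀).symm z))

lemma contMDiffAt_iff_chartForm (θ : (x : X) → TangentSpace 𝓘(ℝ, E) x →L[ℝ] V) (x₀ : X) :
    ContMDiffAt 𝓘(ℝ, E) (𝓘(ℝ, E).prod 𝓘(ℝ, E →L[ℝ] V)) ∞
    (fun x => TotalSpace.mk' (E →L[ℝ] V)
      (E := fun x : X => TangentSpace 𝓘(ℝ, E) x →L[ℝ] V) x (θ x)) x₀ ↔
    ContDiffAt ℝ ∞ (chartForm θ x₀) (extChartAt 𝓘(ℝ, E) x₀ x₀) := by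
  have h0 := contMDiffAt_hom_bundle (n := ∞) (IM := 𝓘(ℝ, E)) (IB := 𝓘(ℝ, E)) (F₁ := E) (F₂ := V)
      (E₁ := fun x : X => TangentSpace 𝓘(ℝ, E) x) (E₂ := Bundle.Trivial X V)
      (f := fun x => TotalSpace.mk' (E →L[ℝ] V)
      (E := fun x : X => TangentSpace 𝓘(ℝ, E) x →L[ℝ] V) x (θ x)) (x₀ := x₀)
  have h1 : ContMDiffAt 𝓘(ℝ, E) 𝓘(ℝ, E) ∞ (fun x : X => x) x₀ := contMDiffAt_id
  refine h0.trans ?_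
  refine (and_iff_right h1).trans ?_
  rw [contMDiffAt_iff_source,
    show range 𝓘(ℝ, E) = univ by simp, contMDiffWithinAt_univ, contMDiffAt_iff_contDiffAt]
  refine iff_of_eq (congrArg (fun F => ContDiffAt ℝ ∞ F _) ?_)
  funext z
  ext v
  have h2 := Trivial.continuousLinearMapAt_trivialization ℝ X V
    ((extChartAt 𝓘(ℝ, E) x₀).symm z)
  exact congrArg (fun L : V →L[ℝ] V => L (chartForm θ x₀ z v)) h2

/-- The derivative of the chart at its centre is the identity, so a directional derivative at `q` is
that of the coordinate expression in the chart at `q`, in the same direction. -/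
lemma mfderiv_comp_extChartAt {q : X} {f : X → V}
    (hf : ContDiffAt ℝ 1 (f ∘ (extChartAt 𝓘(ℝ, E) q).symm) (extChartAt 𝓘(ℝ, E) q q)) (u : E) :
    dirDeriv f q u =
      fderiv ℝ (f ∘ (extChartAt 𝓘(ℝ, E) q).symm) (extChartAt 𝓘(ℝ, E) q q) u := by
  set φ := extChartAt 𝓘(ℝ, E) q
  have h1 : f =ᶠ[𝓝 q] (f ∘ φ.symm) ∘ φ := by
    filter_upwards [extChartAt_source_mem_nhds (I := 𝓘(ℝ, E)) q] with x hx
    simp only [Function.comp]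
    rw [φ.left_inv hx]
  have h2 : MDifferentiableAt 𝓘(ℝ, E) 𝓘(ℝ, V) (f ∘ φ.symm) (φ q) :=
    (hf.differentiableAt (by simp)).mdifferentiableAt
  have h3 : MDifferentiableAt 𝓘(ℝ, E) 𝓘(ℝ, E) φ q := mdifferentiableAt_extChartAt (by simp)
  unfold dirDeriv
  rw [h1.mfderiv_eq, mfderiv_comp q h2 h3]
  rw [mfderiv_extChartAt_self, mfderiv_eq_fderiv]
  rfl

lemma extDerivOne_eq {θ : (x : X) → TangentSpace 𝓘(ℝ, E) x →L[ℝ] V} {q : X}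
    (hθ : ContDiffAt ℝ ∞ (chartForm θ q) (extChartAt 𝓘(ℝ, E) q q)) (u w : E) :
    extDerivOne θ q u w = fderiv ℝ (chartForm θ q) (extChartAt 𝓘(ℝ, E) q q) u w -
      fderiv ℝ (chartForm θ q) (extChartAt 𝓘(ℝ, E) q q) w u := by
  have key : ∀ u w : E, dirDeriv (fun y => θ y (coordField q w y)) q u =
      fderiv ℝ (chartForm θ q) (extChartAt 𝓘(ℝ, E) q q) u w := by
    intro u w
    have h : (fun y => θ y (coordField q w y)) ∘ (extChartAt 𝓘(ℝ, E) q).symm =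
      fun z => chartForm θ q z w := rfl
    rw [mfderiv_comp_extChartAt, h]
    · rw [fderiv_clm_apply (hθ.differentiableAt (by simp)) (by fun_prop)]
      simp
    · rw [h]
      exact ((hθ.of_le (by simp)).clm_apply contDiffAt_const)
  unfold extDerivOne
  rw [key, key]

/-- The pull-back of a one-form, expressed through the chart at the image of `y₀`: this reduces the
calculus of pull-backs to calculus in normed spaces. -/
lemma pullForm_eventuallyEq {θ : (x : X) → TangentSpace 𝓘(ℝ, E) x →L[ℝ] V} {f : E' → X} {y₀ : E'}
    (hf : ContMDiffAt 𝓘(ℝ, E') 𝓘(ℝ, E) ∞ f y₀) :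
    pullForm θ f =ᶠ[𝓝 y₀] fun y => (chartForm θ (f y₀) (extChartAt 𝓘(ℝ, E) (f y₀) (f y))).comp
      (fderiv ℝ (extChartAt 𝓘(ℝ, E) (f y₀) ∘ f) y) := by
  set φ := extChartAt 𝓘(ℝ, E) (f y₀)
  have h1 : ∀ᶠ y in 𝓝 y₀, f y ∈ φ.source :=
    hf.continuousAt.eventually (extChartAt_source_mem_nhds (I := 𝓘(ℝ, E)) (f y₀))
  have h2 : ∀ᶠ y in 𝓝 y₀, ContMDiffAt 𝓘(ℝ, E') 𝓘(ℝ, E) 1 f y := by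
    have := (hf.of_le (show (1 : WithTop ℕ∞) ≤ ∞ by simp))
    exact (contMDiffAt_iff_contMDiffAt_nhds (by simp)).1 this
  filter_upwards [h1, h2, h1.eventually_nhds] with y hy hfy hye
  have h3 : f =ᶠ[𝓝 y] φ.symm ∘ (φ ∘ f) := by
    filter_upwards [hye] with z hz
    exact (φ.left_inv hz).symm
  have hys : f y ∈ (chartAt E (f y₀)).source := by simpa [φ] using hy
  have h4 : MDifferentiableAt 𝓘(ℝ, E) 𝓘(ℝ, E) φ (f y) := mdifferentiableAt_extChartAt hys
  have h5 : MDifferentiableAt 𝓘(ℝ, E') 𝓘(ℝ, E) (φ ∘ f) y :=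
    h4.comp y (hfy.mdifferentiableAt (by simp))
  have h6 : MDifferentiableAt 𝓘(ℝ, E) 𝓘(ℝ, E) φ.symm ((φ ∘ f) y) :=
    (contMDiffOn_extChartAt_symm (n := 1) (f y₀)).contMDiffAt
      (extChartAt_target_mem_nhds' (φ.map_source hy)) |>.mdifferentiableAt (by simp)
  ext v
  have h7 : mfderiv 𝓘(ℝ, E') 𝓘(ℝ, E) f y v =
      mfderiv 𝓘(ℝ, E) 𝓘(ℝ, E) φ.symm (φ (f y)) (fderiv ℝ (φ ∘ f) y v) := by
    rw [h3.mfderiv_eq, mfderiv_comp y h6 h5, mfderiv_eq_fderiv]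
    rfl
  have h8 := coordField_eq_mfderiv hys (fderiv ℝ (φ ∘ f) y v)
  unfold coordField at h8
  have hl : φ.symm (φ (f y)) = f y := φ.left_inv hy
  have h9 : ∀ p : X, p = f y → chartForm θ (f y₀) (φ (f y)) (fderiv ℝ (φ ∘ f) y v) =
     θ (f y) ((trivializationAt E (TangentSpace 𝓘(ℝ, E)) (f y₀)).symmL ℝ (f y) (fderiv ℝ (φ ∘ f) y v)) := by
    intro p hp
    unfold chartForm
    change θ (φ.symm (φ (f y))) ((trivializationAt E (TangentSpace 𝓘(ℝ, E)) (f y₀)).symmL ℝ (φ.symm (φ (f y))) _) = _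
    rw [hl]
  refine Eq.trans ?_ (h9 _ rfl).symm
  change θ (f y) (mfderiv 𝓘(ℝ, E') 𝓘(ℝ, E) f y v) = _
  rw [h7]
  exact congrArg (θ (f y)) h8.symm

lemma contDiffAt_extChartAt_comp {f : E' → X} {y₀ : E'}
    (hf : ContMDiffAt 𝓘(ℝ, E') 𝓘(ℝ, E) ∞ f y₀) :
    ContDiffAt ℝ ∞ (extChartAt 𝓘(ℝ, E) (f y₀) ∘ f) y₀ := by
  have : ContMDiffAt 𝓘(ℝ, E') 𝓘(ℝ, E) ∞ (extChartAt 𝓘(ℝ, E) (f y₀) ∘ f) y₀ :=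
    ContMDiffAt.comp y₀ contMDiffAt_extChartAt hf
  exact this.contDiffAt

lemma contDiffAt_pullForm {θ : (x : X) → TangentSpace 𝓘(ℝ, E) x →L[ℝ] V} {f : E' → X} {y₀ : E'}
    (hf : ContMDiffAt 𝓘(ℝ, E') 𝓘(ℝ, E) ∞ f y₀)
    (hθ : ContDiffAt ℝ ∞ (chartForm θ (f y₀)) (extChartAt 𝓘(ℝ, E) (f y₀) (f y₀))) :
    ContDiffAt ℝ ∞ (pullForm θ f) y₀ := by
  refine ContDiffAt.congr_of_eventuallyEq ?_ (pullForm_eventuallyEq hf)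
  have h := contDiffAt_extChartAt_comp hf
  exact (ContDiffAt.comp y₀ hθ h).clm_comp (h.fderiv_right (m := ∞) (by simp))

lemma mfderiv_eq_fderiv_extChartAt_comp {f : E' → X} {y₀ : E'}
    (hf : ContMDiffAt 𝓘(ℝ, E') 𝓘(ℝ, E) ∞ f y₀) (u : E') :
    mfderiv 𝓘(ℝ, E') 𝓘(ℝ, E) f y₀ u = fderiv ℝ (extChartAt 𝓘(ℝ, E) (f y₀) ∘ f) y₀ u := by
  have h3 : MDifferentiableAt 𝓘(ℝ, E) 𝓘(ℝ, E) (extChartAt 𝓘(ℝ, E) (f y₀)) (f y₀) :=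
    mdifferentiableAt_extChartAt (by simp)
  rw [← mfderiv_eq_fderiv, mfderiv_comp y₀ h3 (hf.mdifferentiableAt (by simp)),
    mfderiv_extChartAt_self]
  rfl

/-- The exterior derivative commutes with pull-back along smooth maps from a normed space. -/
lemma extDerivOne_pullForm {θ : (x : X) → TangentSpace 𝓘(ℝ, E) x →L[ℝ] V} {f : E' → X} {y₀ : E'}
    (hf : ContMDiffAt 𝓘(ℝ, E') 𝓘(ℝ, E) ∞ f y₀)
    (hθ : ContDiffAt ℝ ∞ (chartForm θ (f y₀)) (extChartAt 𝓘(ℝ, E) (f y₀) (f y₀))) (u w : E') :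
    extDerivOne θ (f y₀) (mfderiv 𝓘(ℝ, E') 𝓘(ℝ, E) f y₀ u) (mfderiv 𝓘(ℝ, E') 𝓘(ℝ, E) f y₀ w) =
      fderiv ℝ (pullForm θ f) y₀ u w - fderiv ℝ (pullForm θ f) y₀ w u := by
  have h := contDiffAt_extChartAt_comp hf
  have h1 : DifferentiableAt ℝ (chartForm θ (f y₀)) ((extChartAt 𝓘(ℝ, E) (f y₀) ∘ f) y₀) :=
    hθ.differentiableAt (by simp)
  have h2 : DifferentiableAt ℝ (fderiv ℝ (extChartAt 𝓘(ℝ, E) (f y₀) ∘ f)) y₀ :=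
    (h.fderiv_right (m := ∞) (by simp)).differentiableAt (by simp)
  have hs : IsSymmSndFDerivAt ℝ (extChartAt 𝓘(ℝ, E) (f y₀) ∘ f) y₀ :=
    h.isSymmSndFDerivAt (by simpa using (WithTop.coe_le_coe.2 le_top : ((2 : ℕ∞) : WithTop ℕ∞) ≤ ∞))
  have h3 : ∀ u w : E', fderiv ℝ (pullForm θ f) y₀ u w =
      chartForm θ (f y₀) (extChartAt 𝓘(ℝ, E) (f y₀) (f y₀))
        (fderiv ℝ (fderiv ℝ (extChartAt 𝓘(ℝ, E) (f y₀) ∘ f)) y₀ u w) +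
      fderiv ℝ (chartForm θ (f y₀)) (extChartAt 𝓘(ℝ, E) (f y₀) (f y₀))
        (fderiv ℝ (extChartAt 𝓘(ℝ, E) (f y₀) ∘ f) y₀ u)
        (fderiv ℝ (extChartAt 𝓘(ℝ, E) (f y₀) ∘ f) y₀ w) := by
    intro u w
    have h4 : DifferentiableAt ℝ
        (chartForm θ (f y₀) ∘ (extChartAt 𝓘(ℝ, E) (f y₀) ∘ f)) y₀ :=
      h1.comp y₀ (h.differentiableAt (by simp))
    rw [(pullForm_eventuallyEq hf).fderiv_eq]
    have h5 := fderiv_clm_comp h4 h2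
    simp only [Function.comp] at h5 ⊢
    rw [h5]
    have h6 := fderiv_comp y₀ h1 (h.differentiableAt (by simp))
    simp only [Function.comp] at h6
    simp only [Function.comp_def] at h6 ⊢
    simp only [h6, add_apply, ContinuousLinearMap.comp_apply,
      ContinuousLinearMap.compL_apply, ContinuousLinearMap.flip_apply]
  refine (extDerivOne_eq hθ _ _).trans ?_
  rw [h3, h3, hs u w, mfderiv_eq_fderiv_extChartAt_comp hf,
    mfderiv_eq_fderiv_extChartAt_comp hf]
  abel

lemma SmoothOneForm.contDiffAt_chartForm {θ : (x : X) → TangentSpace 𝓘(ℝ, E) x →L[ℝ] V}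
    (hθ : SmoothOneForm θ) (x : X) :
    ContDiffAt ℝ ∞ (chartForm θ x) (extChartAt 𝓘(ℝ, E) x x) :=
  (contMDiffAt_iff_chartForm θ x).1 (hθ x)

end ChartCalculus

/-! ### The adjoint representation and the Lie bracket -/

section LieCalculus
open Filter Topology

variable {EG : Type*} [NormedAddCommGroup EG] [NormedSpace ℝ EG]
  {G : Type*} [TopologicalSpace G] [ChartedSpace EG G] [Group G] [LieGroup 𝓘(ℝ, EG) ∞ G]

lemma mdifferentiable_conj (g h : G) :
    MDifferentiableAt 𝓘(ℝ, EG) 𝓘(ℝ, EG) (fun h : G => g * h * g⁻¹) h := by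
  have h1 : ContMDiff 𝓘(ℝ, EG) 𝓘(ℝ, EG) ∞ (fun h : G => g * h * g⁻¹) :=
    (contMDiff_const.mul contMDiff_id).mul contMDiff_const
  exact h1.mdifferentiable (by simp) h

lemma Ad_one : Ad (1 : G) = ContinuousLinearMap.id ℝ EG := by
  change mder EG EG (fun h : G => 1 * h * 1⁻¹) (1 : G) = _
  simp only [one_mul, inv_one, mul_one]
  exact mfderiv_id

lemma Ad_mul (g h : G) : Ad (g * h) = (Ad g).comp (Ad h : EG →L[ℝ] EG) := by
  have h1 : (fun k : G => g * h * k * (g * h)⁻¹) = (fun k => g * k * g⁻¹) ∘ (fun k => h * k * h⁻¹) := by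
    funext k; simp [mul_assoc]
  change mder EG EG (fun k : G => g * h * k * (g * h)⁻¹) (1 : G) = _
  rw [h1, mder_comp (mdifferentiable_conj _ _) (mdifferentiable_conj _ _)]
  simp only [mul_one, mul_inv_cancel]
  rfl

lemma Ad_Ad_inv (g : G) (v : EG) : Ad g (Ad g⁻¹ v) = v := by
  have := Ad_mul (EG := EG) g g⁻¹
  rw [mul_inv_cancel, Ad_one] at this
  exact (congrArg (fun L : EG →L[ℝ] EG => L v) this).symm

lemma Ad_inv_Ad (g : G) (v : EG) : Ad g⁻¹ (Ad g v) = v := by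
  simpa using Ad_Ad_inv g⁻¹ v

local notation "κ" => extChartAt 𝓘(ℝ, EG) (1 : G)

lemma contMDiffAt_kappa_symm :
    ContMDiffAt 𝓘(ℝ, EG) 𝓘(ℝ, EG) ∞ (κ).symm (κ 1) :=
  (contMDiffOn_extChartAt_symm (n := ∞) (1 : G)).contMDiffAt (extChartAt_target_mem_nhds _)

lemma kappa_symm_one : (κ).symm (κ 1) = 1 := extChartAt_to_inv _

lemma mder_extChartAt_symm_self {E : Type*} [NormedAddCommGroup E] [NormedSpace ℝ E]
    {X : Type*} [TopologicalSpace X] [ChartedSpace E X] [IsManifold 𝓘(ℝ, E) ∞ X] (q : X) :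
    mder E E (extChartAt 𝓘(ℝ, E) q).symm (extChartAt 𝓘(ℝ, E) q q) = ContinuousLinearMap.id ℝ E := by
  have := mfderivWithin_range_extChartAt_symm (I := 𝓘(ℝ, E)) (x := q)
  rw [show range 𝓘(ℝ, E) = univ by simp, mfderivWithin_univ] at this
  exact this

lemma mder_eq_fderiv_extChartAt_comp {E' : Type*} [NormedAddCommGroup E'] [NormedSpace ℝ E']
    {E : Type*} [NormedAddCommGroup E] [NormedSpace ℝ E]
    {X : Type*} [TopologicalSpace X] [ChartedSpace E X] [IsManifold 𝓘(ℝ, E) ∞ X]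
    {f : E' → X} {y₀ : E'} {q : X} (hq : f y₀ = q)
    (hf : ContMDiffAt 𝓘(ℝ, E') 𝓘(ℝ, E) ∞ f y₀) :
    mder E' E f y₀ = fderiv ℝ (extChartAt 𝓘(ℝ, E) q ∘ f) y₀ := by
  subst hq
  ext u
  exact mfderiv_eq_fderiv_extChartAt_comp hf u

lemma contDiffAt_extChartAt_comp' {E' : Type*} [NormedAddCommGroup E'] [NormedSpace ℝ E']
    {E : Type*} [NormedAddCommGroup E] [NormedSpace ℝ E]
    {X : Type*} [TopologicalSpace X] [ChartedSpace E X] [IsManifold 𝓘(ℝ, E) ∞ X]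
    {f : E' → X} {y₀ : E'} {q : X} (hq : f y₀ = q)
    (hf : ContMDiffAt 𝓘(ℝ, E') 𝓘(ℝ, E) ∞ f y₀) :
    ContDiffAt ℝ ∞ (extChartAt 𝓘(ℝ, E) q ∘ f) y₀ := by
  subst hq
  exact contDiffAt_extChartAt_comp hf

lemma Ad_eq_fderiv (g : G) :
    Ad g = fderiv ℝ (fun ξ : EG => κ (g * (κ).symm ξ * g⁻¹)) (κ 1) := by
  have h1 : ContMDiffAt 𝓘(ℝ, EG) 𝓘(ℝ, EG) ∞ ((fun h : G => g * h * g⁻¹) ∘ (κ).symm) (κ 1) :=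
    ContMDiffAt.comp (κ 1) (I' := 𝓘(ℝ, EG)) (((contMDiff_const.mul contMDiff_id).mul contMDiff_const) _)
      (contMDiffAt_kappa_symm)
  have h2 := mder_eq_fderiv_extChartAt_comp (q := (1 : G)) (by simp [kappa_symm_one]) h1
  rw [mder_comp (mdifferentiable_conj _ _) (contMDiffAt_kappa_symm.mdifferentiableAt (by simp)),
    mder_extChartAt_symm_self, kappa_symm_one, ContinuousLinearMap.comp_id] at h2
  exact h2

lemma contDiffAt_Ad_kappa : ContDiffAt ℝ ∞ (fun x : EG => Ad (EG := EG) ((κ).symm x)) (κ 1) := by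
  simp only [Ad_eq_fderiv]
  refine ContDiffAt.fderiv (n := ∞) (f := fun x ξ : EG => κ ((κ).symm x * (κ).symm ξ * ((κ).symm x)⁻¹))
    (g := fun _ => κ 1) ?_ contDiffAt_const (by simp)
  have h1 : ContMDiffAt 𝓘(ℝ, EG × EG) 𝓘(ℝ, EG) ∞ (fun p : EG × EG => (κ).symm p.1) ((κ : PartialEquiv G EG) 1, (κ : PartialEquiv G EG) 1) :=
    ContMDiffAt.comp ((κ : PartialEquiv G EG) 1, (κ : PartialEquiv G EG) 1) (I' := 𝓘(ℝ, EG)) contMDiffAt_kappa_symm contDiffAt_fst.contMDiffAt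
  have h2 : ContMDiffAt 𝓘(ℝ, EG × EG) 𝓘(ℝ, EG) ∞ (fun p : EG × EG => (κ).symm p.2) ((κ : PartialEquiv G EG) 1, (κ : PartialEquiv G EG) 1) :=
    ContMDiffAt.comp ((κ : PartialEquiv G EG) 1, (κ : PartialEquiv G EG) 1) (I' := 𝓘(ℝ, EG)) contMDiffAt_kappa_symm contDiffAt_snd.contMDiffAt
  exact contDiffAt_extChartAt_comp' (q := (1 : G)) (f := fun p : EG × EG => (κ).symm p.1 * (κ).symm p.2 * ((κ).symm p.1)⁻¹)
    (by simp [kappa_symm_one]) ((h1.mul h2).mul h1.inv)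

/-- `Ad` is smooth. -/
lemma contMDiff_Ad : ContMDiff 𝓘(ℝ, EG) 𝓘(ℝ, EG →L[ℝ] EG) ∞ (Ad : G → EG →L[ℝ] EG) := by
  intro g
  have h1 : (Ad : G → EG →L[ℝ] EG) =ᶠ[𝓝 g] fun h =>
      (Ad g).comp (Ad ((κ).symm (κ (g⁻¹ * h)))) := by
    have : ∀ᶠ h in 𝓝 g, g⁻¹ * h ∈ (κ).source := by
      have hc : ContinuousAt (fun h : G => g⁻¹ * h) g :=
        (contMDiff_mul_left (I := 𝓘(ℝ, EG)) (n := ∞) (a := g⁻¹)).continuous.continuousAt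
      refine hc.eventually ?_
      have : (fun h : G => g⁻¹ * h) g = 1 := inv_mul_cancel g
      rw [this]
      exact extChartAt_source_mem_nhds _
    filter_upwards [this] with h hh
    rw [(κ).left_inv hh, ← Ad_mul]
    simp
  refine ContMDiffAt.congr_of_eventuallyEq ?_ h1
  have h2 : ContMDiffAt 𝓘(ℝ, EG) 𝓘(ℝ, EG) ∞ (fun h : G => κ (g⁻¹ * h)) g := by
    refine ContMDiffAt.comp_of_eq (I' := 𝓘(ℝ, EG)) (contMDiffAt_extChartAt (x := (1 : G))) (contMDiff_mul_left (I := 𝓘(ℝ, EG)) (n := ∞) (a := g⁻¹) g) (by simp)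
  have h3 : ContMDiffAt 𝓘(ℝ, EG) 𝓘(ℝ, EG →L[ℝ] EG) ∞ (fun h : G => Ad ((κ).symm (κ (g⁻¹ * h)))) g :=
    ContMDiffAt.comp_of_eq (I' := 𝓘(ℝ, EG)) (contDiffAt_Ad_kappa (EG := EG) (G := G)).contMDiffAt h2 (by simp)
  exact contMDiffAt_const.clm_comp h3

lemma mpullbackWithin_extChartAt_symm {E : Type*} [NormedAddCommGroup E] [NormedSpace ℝ E]
    {X : Type*} [TopologicalSpace X] [ChartedSpace E X] [IsManifold 𝓘(ℝ, E) ∞ X] {q : X}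
    (W : (x : X) → TangentSpace 𝓘(ℝ, E) x) {z : E} (hz : z ∈ (extChartAt 𝓘(ℝ, E) q).target) :
    VectorField.mpullbackWithin 𝓘(ℝ, E) 𝓘(ℝ, E) (extChartAt 𝓘(ℝ, E) q).symm W (range 𝓘(ℝ, E)) z =
      mder E E (extChartAt 𝓘(ℝ, E) q) ((extChartAt 𝓘(ℝ, E) q).symm z)
        (W ((extChartAt 𝓘(ℝ, E) q).symm z)) := by
  unfold VectorField.mpullbackWithin
  rw [ContinuousLinearMap.inverse_eq (mfderivWithin_extChartAt_symm_comp_mfderiv_extChartAt hz)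
    (mfderiv_extChartAt_comp_mfderivWithin_extChartAt_symm hz)]
  rfl

variable (G) in
/-- Multiplication in the chart of `G` at the identity. -/
def mulKappa (p : EG × EG) : EG := (κ : PartialEquiv G EG) ((κ).symm p.1 * (κ).symm p.2)

variable (G) in
/-- The left-invariant vector field of `v` in the chart of `G` at the identity. -/
def leftField (v : EG) (z : EG) : EG :=
  VectorField.mpullbackWithin 𝓘(ℝ, EG) 𝓘(ℝ, EG) (κ : PartialEquiv G EG).symm
      (mulInvariantVectorField (I := 𝓘(ℝ, EG)) (G := G) v) (range 𝓘(ℝ, EG)) z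

lemma contDiffAt_mulKappa : ContDiffAt ℝ ∞ (mulKappa G) ((κ : PartialEquiv G EG) 1, (κ : PartialEquiv G EG) 1) := by
  have h1 : ContMDiffAt 𝓘(ℝ, EG × EG) 𝓘(ℝ, EG) ∞ (fun p : EG × EG => (κ).symm p.1) ((κ : PartialEquiv G EG) 1, (κ : PartialEquiv G EG) 1) :=
    ContMDiffAt.comp ((κ : PartialEquiv G EG) 1, (κ : PartialEquiv G EG) 1) (I' := 𝓘(ℝ, EG)) contMDiffAt_kappa_symm contDiffAt_fst.contMDiffAt
  have h2 : ContMDiffAt 𝓘(ℝ, EG × EG) 𝓘(ℝ, EG) ∞ (fun p : EG × EG => (κ).symm p.2) ((κ : PartialEquiv G EG) 1, (κ : PartialEquiv G EG) 1) :=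
    ContMDiffAt.comp ((κ : PartialEquiv G EG) 1, (κ : PartialEquiv G EG) 1) (I' := 𝓘(ℝ, EG)) contMDiffAt_kappa_symm contDiffAt_snd.contMDiffAt
  exact contDiffAt_extChartAt_comp' (q := (1 : G)) (f := fun p : EG × EG => (κ).symm p.1 * (κ).symm p.2)
    (by simp [kappa_symm_one]) (h1.mul h2)

/-- In the chart, the left-invariant vector field of `v` at `z` is the derivative of the
multiplication in the second variable. -/
lemma mulInvariant_chart (v : EG) :
    leftField G v =ᶠ[𝓝 ((κ : PartialEquiv G EG) 1)] fun z => fderiv ℝ (mulKappa G) (z, (κ : PartialEquiv G EG) 1) (0, v) := by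
  have h1 : ∀ᶠ z in 𝓝 (κ 1), DifferentiableAt ℝ (mulKappa G) (z, (κ : PartialEquiv G EG) 1) := by
    have h := (contDiffAt_mulKappa (EG := EG) (G := G)).of_le (show (1 : WithTop ℕ∞) ≤ ∞ by simp)
    have h' := h.eventually (by simp)
    have hc : ContinuousAt (fun z : EG => (z, (κ : PartialEquiv G EG) 1)) (κ 1) := by fun_prop
    filter_upwards [hc.eventually h'] with z hz using hz.differentiableAt (by simp)
  filter_upwards [h1, extChartAt_target_mem_nhds (I := 𝓘(ℝ, EG)) (1 : G)] with z hz hzt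
  unfold leftField
  rw [mpullbackWithin_extChartAt_symm _ hzt]
  have h2 : ContMDiff 𝓘(ℝ, EG) 𝓘(ℝ, EG) ∞ (fun h : G => (κ).symm z * h) := contMDiff_mul_left
  have h3 : MDifferentiableAt 𝓘(ℝ, EG) 𝓘(ℝ, EG) κ ((κ).symm z) :=
    mdifferentiableAt_extChartAt (by simpa using (κ).map_target hzt)
  have h4 : MDifferentiableAt 𝓘(ℝ, EG) 𝓘(ℝ, EG) (κ).symm (κ 1) :=
    contMDiffAt_kappa_symm.mdifferentiableAt (by simp)
  have h5 : mder EG EG (κ ∘ (fun h : G => (κ).symm z * h) ∘ (κ).symm) (κ 1) =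
      (mder EG EG κ ((κ).symm z)).comp (mder EG EG (fun h : G => (κ).symm z * h) 1) := by
    have e1 : ((fun h : G => (κ).symm z * h) ∘ (κ).symm) (κ 1) = (κ).symm z := by
      simp [kappa_symm_one]
    rw [mder_comp (by rw [e1]; exact h3)
      (((h2 _).mdifferentiableAt (by simp)).comp _ h4), mder_comp ((h2 _).mdifferentiableAt (by simp)) h4,
      mder_extChartAt_symm_self, e1, kappa_symm_one, ContinuousLinearMap.comp_id]
  rw [mder_eq_fderiv] at h5
  have h6 : (κ ∘ (fun h : G => (κ).symm z * h) ∘ (κ).symm) = (mulKappa G) ∘ (fun ξ => (z, ξ)) := rfl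
  have h7 : HasFDerivAt (fun ξ : EG => (z, ξ)) (ContinuousLinearMap.inr ℝ EG EG) (κ 1) :=
    hasFDerivAt_prodMk_right z (κ 1)
  rw [h6, fderiv_comp (κ 1) hz h7.differentiableAt, h7.fderiv] at h5
  exact (congrArg (fun L : EG →L[ℝ] EG => L v) h5).symm

/-- The derivative of `x y = (x y x⁻¹) x` in `y` at the identity. -/
lemma mulKappa_conj (w : EG) :
    (fun z => fderiv ℝ (mulKappa G) (z, (κ : PartialEquiv G EG) 1) (0, w)) =ᶠ[𝓝 ((κ : PartialEquiv G EG) 1)]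
    fun z => fderiv ℝ (mulKappa G) ((κ : PartialEquiv G EG) 1, z) (Ad ((κ : PartialEquiv G EG).symm z) w, 0) := by
  have h := (contDiffAt_mulKappa (EG := EG) (G := G)).of_le (show (1 : WithTop ℕ∞) ≤ ∞ by simp)
  have h' := h.eventually (by simp)
  have hc : ContinuousAt (fun z : EG => (z, (κ : PartialEquiv G EG) 1)) (κ 1) := by fun_prop
  have hc' : ContinuousAt (fun z : EG => ((κ : PartialEquiv G EG) 1, z)) (κ 1) := by fun_prop
  filter_upwards [hc.eventually h', hc'.eventually h'] with z hz1 hz2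
  have hz1 := hz1.differentiableAt (by simp)
  have hz2 := hz2.differentiableAt (by simp)
  set c : EG → EG := fun ξ => κ ((κ).symm z * (κ).symm ξ * ((κ).symm z)⁻¹) with hcdef
  have hcm : ContMDiffAt 𝓘(ℝ, EG) 𝓘(ℝ, EG) ∞ (fun ξ => (κ).symm z * (κ).symm ξ * ((κ).symm z)⁻¹) (κ 1) :=
    (contMDiffAt_const.mul contMDiffAt_kappa_symm).mul contMDiffAt_const
  have hcd : ContDiffAt ℝ ∞ c (κ 1) := contDiffAt_extChartAt_comp' (by simp [kappa_symm_one]) hcm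
  have hc1 : c (κ 1) = κ 1 := by simp [hcdef, kappa_symm_one]
  have e1 : (mulKappa G) ∘ (fun ξ => (z, ξ)) =ᶠ[𝓝 (κ 1)] (mulKappa G) ∘ (fun ξ => (c ξ, z)) := by
    have : ∀ᶠ ξ in 𝓝 (κ 1), (κ).symm z * (κ).symm ξ * ((κ).symm z)⁻¹ ∈ (κ).source := by
      refine hcm.continuousAt.eventually ?_
      have : (fun ξ => (κ : PartialEquiv G EG).symm z * (κ).symm ξ * ((κ).symm z)⁻¹) (κ (1 : G)) = 1 := by
        simp [kappa_symm_one]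
      rw [this]
      exact extChartAt_source_mem_nhds _
    filter_upwards [this] with ξ hξ
    simp only [Function.comp, hcdef, mulKappa]
    rw [(κ).left_inv hξ]
    simp
  have h7 : HasFDerivAt (fun ξ : EG => (z, ξ)) (ContinuousLinearMap.inr ℝ EG EG) (κ 1) :=
    hasFDerivAt_prodMk_right z (κ 1)
  have h8 : HasFDerivAt (fun ξ : EG => (c ξ, z)) ((fderiv ℝ c (κ 1)).prod 0) (κ 1) :=
    (hcd.differentiableAt (by simp)).hasFDerivAt.prodMk (hasFDerivAt_const z _)
  have h9 := e1.fderiv_eq (𝕜 := ℝ)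
  rw [fderiv_comp (κ 1) hz1 h7.differentiableAt, h7.fderiv,
    fderiv_comp (κ 1) (by rw [hc1]; exact hz2) h8.differentiableAt, h8.fderiv, hc1] at h9
  rw [Ad_eq_fderiv]
  exact (congrArg (fun L : EG →L[ℝ] EG => L w) h9)

variable (G) in
/-- The derivative of `Ad` at the identity, as a bilinear map; see `lieBr_eq_adL`. -/
def adL : EG →L[ℝ] EG →L[ℝ] EG := fderiv ℝ (fun x : EG => Ad (EG := EG) ((κ : PartialEquiv G EG).symm x)) (κ 1)

/-- The derivative of `Ad` at the identity is the Lie bracket: in the chart, both are the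
antisymmetrized second derivative of the multiplication at the identity. -/
lemma lieBr_eq_adL (v w : EG) : lieBr G v w = adL G v w := by
  set m := mulKappa (EG := EG) G with hm
  set e : EG := extChartAt 𝓘(ℝ, EG) (1 : G) 1 with he
  have hmc : ContDiffAt ℝ ∞ m (e, e) := contDiffAt_mulKappa
  have hD : DifferentiableAt ℝ (fderiv ℝ m) (e, e) :=
    (hmc.fderiv_right (m := ∞) (by simp)).differentiableAt (by simp)
  have hsymm : IsSymmSndFDerivAt ℝ m (e, e) :=
    hmc.isSymmSndFDerivAt (by simpa using (WithTop.coe_le_coe.2 le_top : ((2 : ℕ∞) : WithTop ℕ∞) ≤ ∞))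
  have hl : HasFDerivAt (fun ξ : EG => (ξ, e)) (ContinuousLinearMap.inl ℝ EG EG) e :=
    hasFDerivAt_prodMk_left e e
  have hr : HasFDerivAt (fun ξ : EG => (e, ξ)) (ContinuousLinearMap.inr ℝ EG EG) e :=
    hasFDerivAt_prodMk_right e e
  have hfield : ∀ v u : EG, fderiv ℝ (fun z => fderiv ℝ m (z, e) (0, v)) e u =
      fderiv ℝ (fderiv ℝ m) (e, e) (u, 0) (0, v) := by
    intro v u
    have h1 : HasFDerivAt (fun z : EG => fderiv ℝ m (z, e))
        ((fderiv ℝ (fderiv ℝ m) (e, e)).comp (ContinuousLinearMap.inl ℝ EG EG)) e :=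
      HasFDerivAt.comp e hD.hasFDerivAt hl
    have h2 := h1.clm_apply (hasFDerivAt_const ((0, v) : EG × EG) e)
    rw [h2.fderiv]
    simp
  have hm1 : ∀ u : EG, fderiv ℝ m (e, e) (u, 0) = u := by
    intro u
    have h1 : m ∘ (fun ξ : EG => (ξ, e)) =ᶠ[𝓝 e] id := by
      filter_upwards [extChartAt_target_mem_nhds (I := 𝓘(ℝ, EG)) (1 : G)] with z hz
      simp only [hm, mulKappa, Function.comp, he, kappa_symm_one, mul_one, id]
      exact (κ).right_inv hz
    have h2 := h1.fderiv_eq (𝕜 := ℝ)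
    rw [(HasFDerivAt.comp (f := fun ξ : EG => (ξ, e)) e
      (hmc.differentiableAt (by simp)).hasFDerivAt hl).fderiv, fderiv_id] at h2
    exact (congrArg (fun L : EG →L[ℝ] EG => L u) h2)
  have hm2 : ∀ u : EG, fderiv ℝ m (e, e) (0, u) = u := by
    intro u
    have h1 : m ∘ (fun ξ : EG => (e, ξ)) =ᶠ[𝓝 e] id := by
      filter_upwards [extChartAt_target_mem_nhds (I := 𝓘(ℝ, EG)) (1 : G)] with z hz
      simp only [hm, mulKappa, Function.comp, he, kappa_symm_one, one_mul, id]
      exact (κ).right_inv hz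
    have h2 := h1.fderiv_eq (𝕜 := ℝ)
    rw [(HasFDerivAt.comp (f := fun ξ : EG => (e, ξ)) e
      (hmc.differentiableAt (by simp)).hasFDerivAt hr).fderiv, fderiv_id] at h2
    exact (congrArg (fun L : EG →L[ℝ] EG => L u) h2)
  have hbr : lieBr G v w = fderiv ℝ (fun z => fderiv ℝ m (z, e) (0, w)) e v -
      fderiv ℝ (fun z => fderiv ℝ m (z, e) (0, v)) e w := by
    have hV := mulInvariant_chart (G := G) v
    have hW := mulInvariant_chart (G := G) w
    have h1 : lieBr G v w = VectorField.lieBracketWithin ℝ (leftField G v) (leftField G w)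
        ((κ : PartialEquiv G EG).symm ⁻¹' univ ∩ range 𝓘(ℝ, EG)) e := by
      have hi : (mfderiv 𝓘(ℝ, EG) 𝓘(ℝ, EG) (κ : PartialEquiv G EG) 1).inverse =
          ContinuousLinearMap.id ℝ EG := by
        rw [mfderiv_extChartAt_self]
        exact ContinuousLinearMap.inverse_id
      exact congrArg (fun L : EG →L[ℝ] EG => L (VectorField.lieBracketWithin ℝ (leftField G v)
        (leftField G w) ((κ : PartialEquiv G EG).symm ⁻¹' univ ∩ range 𝓘(ℝ, EG)) e)) hi
    rw [h1, show ((κ : PartialEquiv G EG).symm ⁻¹' univ ∩ range 𝓘(ℝ, EG) : Set EG) = univ by simp,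
      VectorField.lieBracketWithin_univ, VectorField.lieBracket, hV.fderiv_eq, hW.fderiv_eq,
      hV.eq_of_nhds, hW.eq_of_nhds]
    simp only [← he, ← hm, hm2]
  have hA : DifferentiableAt ℝ (fun x : EG => Ad (EG := EG) ((κ : PartialEquiv G EG).symm x)) e :=
    contDiffAt_Ad_kappa.differentiableAt (by simp)
  -- differentiating `mulKappa_conj` exchanges the two variables of `m` at the cost of `adL`
  have hconj : fderiv ℝ (fun z => fderiv ℝ m (z, e) (0, w)) e v =
      fderiv ℝ (fderiv ℝ m) (e, e) (0, v) (w, 0) + adL G v w := by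
    have h0 := mulKappa_conj (G := G) w
    rw [h0.fderiv_eq]
    have h1 : HasFDerivAt (fun z : EG => fderiv ℝ m (e, z))
        ((fderiv ℝ (fderiv ℝ m) (e, e)).comp (ContinuousLinearMap.inr ℝ EG EG)) e :=
      HasFDerivAt.comp e hD.hasFDerivAt hr
    have h3 := hA.hasFDerivAt.clm_apply (hasFDerivAt_const w e)
    have h4 := h3.prodMk (hasFDerivAt_const (0 : EG) e)
    have h2 := h1.clm_apply h4
    rw [h2.fderiv]
    simp only [add_apply, ContinuousLinearMap.comp_apply, ContinuousLinearMap.flip_apply,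
      ContinuousLinearMap.prod_apply, zero_apply, map_zero, zero_add,
      ContinuousLinearMap.inr_apply, hm1]
    rw [add_comm]
    congr 1
    simp only [he, kappa_symm_one, Ad_one]
    rfl
  rw [hbr, hconj, hfield v w, hsymm (0, v) (w, 0)]
  abel

lemma lieBr_antisymm (v w : EG) : lieBr G v w = - lieBr G w v :=
  VectorField.mlieBracket_swap_apply

/-- The derivative of `Ad ∘ c` at a point that `c` maps to the identity. -/
lemma hasFDerivAt_Ad_comp {E : Type*} [NormedAddCommGroup E] [NormedSpace ℝ E] {c : E → G} {y : E}
    (hc : ContMDiffAt 𝓘(ℝ, E) 𝓘(ℝ, EG) ∞ c y) (hy : c y = 1) :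
    HasFDerivAt (fun z => Ad (EG := EG) (c z)) ((adL G).comp (mder E EG c y)) y := by
  have h1 : (fun z => Ad (EG := EG) (c z)) =ᶠ[𝓝 y]
      (fun x : EG => Ad (EG := EG) ((κ : PartialEquiv G EG).symm x)) ∘ (κ ∘ c) := by
    have : ∀ᶠ z in 𝓝 y, c z ∈ (κ).source := by
      refine hc.continuousAt.eventually ?_
      rw [hy]
      exact extChartAt_source_mem_nhds _
    filter_upwards [this] with z hz
    simp only [Function.comp]
    rw [(κ).left_inv hz]
  have h2 := contDiffAt_extChartAt_comp' hy hc
  have h3 := mder_eq_fderiv_extChartAt_comp hy hc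
  have h4 : (κ ∘ c) y = κ 1 := by simp only [Function.comp, hy]
  have h5 : HasFDerivAt (fun x : EG => Ad (EG := EG) ((κ : PartialEquiv G EG).symm x)) (adL G)
      ((κ ∘ c) y) := by
    rw [h4]
    exact (contDiffAt_Ad_kappa.differentiableAt (by simp)).hasFDerivAt
  rw [h3]
  exact (h5.comp y (h2.differentiableAt (by simp)).hasFDerivAt).congr_of_eventuallyEq h1

lemma hasFDerivAt_Ad_kappa :
    HasFDerivAt (fun x : EG => Ad (EG := EG) ((κ : PartialEquiv G EG).symm x)) (adL G) (κ 1) :=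
  (contDiffAt_Ad_kappa.differentiableAt (by simp)).hasFDerivAt

/-- The derivative of `x ↦ Ad x⁻¹` at the identity, from that of `Ad x ∘ Ad x⁻¹ = id`. -/
lemma hasFDerivAt_Ad_inv_kappa :
    HasFDerivAt (fun x : EG => Ad (EG := EG) ((κ : PartialEquiv G EG).symm x)⁻¹) (-adL G) (κ 1) := by
  have hs : ContMDiffAt 𝓘(ℝ, EG) 𝓘(ℝ, EG) ∞ (fun x : EG => ((κ : PartialEquiv G EG).symm x)⁻¹) (κ 1) :=
    contMDiffAt_kappa_symm.inv
  have h1 := hasFDerivAt_Ad_comp hs (by simp [kappa_symm_one])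
  have h2 := hasFDerivAt_Ad_kappa (EG := EG) (G := G)
  have h3 := h2.clm_comp h1
  have h4 : (fun x : EG => (Ad (EG := EG) ((κ : PartialEquiv G EG).symm x)).comp
      (Ad (EG := EG) ((κ : PartialEquiv G EG).symm x)⁻¹)) = fun _ => ContinuousLinearMap.id ℝ EG := by
    funext x
    rw [← Ad_mul, mul_inv_cancel, Ad_one]
  rw [h4] at h3
  have h5 := h3.unique (hasFDerivAt_const _ _)
  convert h1 using 1
  ext u w
  have h6 := congrArg (fun L : EG →L[ℝ] EG →L[ℝ] EG => L u w) h5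
  simp only [kappa_symm_one, inv_one, Ad_one, add_apply, ContinuousLinearMap.comp_apply,
    ContinuousLinearMap.compL_apply, ContinuousLinearMap.flip_apply, zero_apply,
    ContinuousLinearMap.id_apply] at h6
  rw [neg_apply, neg_apply, ← sub_eq_zero, sub_eq_add_neg, ← neg_add, neg_eq_zero, add_comm]
  exact h6

/-- `Ad` acts by automorphisms of the Lie algebra. -/
lemma Ad_adL (b : G) (v w : EG) : Ad b (adL G v w) = adL G (Ad b v) (Ad b w) := by
  have hcm : ContMDiffAt 𝓘(ℝ, EG) 𝓘(ℝ, EG) ∞ ((fun h : G => b * h * b⁻¹) ∘ (κ).symm) (κ 1) :=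
    ContMDiffAt.comp (κ 1) (I' := 𝓘(ℝ, EG)) (((contMDiff_const.mul contMDiff_id).mul contMDiff_const) _)
      (contMDiffAt_kappa_symm)
  have h1 := hasFDerivAt_Ad_comp hcm (by simp [kappa_symm_one])
  rw [mder_comp (mdifferentiable_conj _ _) (contMDiffAt_kappa_symm.mdifferentiableAt (by simp)),
    mder_extChartAt_symm_self, kappa_symm_one, ContinuousLinearMap.comp_id] at h1
  have h2 := h1.clm_apply (hasFDerivAt_const (Ad b w) (κ 1))
  have h3 := (hasFDerivAt_Ad_kappa (EG := EG) (G := G)).clm_apply (hasFDerivAt_const w (κ 1))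
  have h4 := (hasFDerivAt_const (Ad b : EG →L[ℝ] EG) (κ (1 : G))).clm_apply h3
  have h5 : (fun x : EG => Ad b (Ad ((κ : PartialEquiv G EG).symm x) w)) =
      fun x => Ad (((fun h : G => b * h * b⁻¹) ∘ (κ).symm) x) (Ad b w) := by
    funext x
    simp only [Function.comp, Ad_mul, ContinuousLinearMap.comp_apply, Ad_inv_Ad]
  rw [h5] at h4
  have h6 := congrArg (fun L : EG →L[ℝ] EG => L v) (h4.unique h2)
  rw [show (Ad b : EG →L[ℝ] EG) = mder EG EG (fun h : G => b * h * b⁻¹) 1 from rfl] at h6 ⊢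
  simpa using h6

/-- The infinitesimal form of the `Ad`-invariance of the inner product. -/
lemma AdInvariantInner.adL_inv (B : AdInvariantInner EG G) (v a b : EG) :
    B.inner (adL G v a) b + B.inner a (adL G v b) = 0 := by
  have h1 := (hasFDerivAt_Ad_kappa (EG := EG) (G := G)).clm_apply (hasFDerivAt_const a (κ 1))
  have h2 := (hasFDerivAt_Ad_kappa (EG := EG) (G := G)).clm_apply (hasFDerivAt_const b (κ 1))
  have h3 := ((hasFDerivAt_const B.inner (κ (1 : G))).clm_apply h1).clm_apply h2
  simp only [B.ad_inv] at h3
  have h4 := congrArg (fun L : EG →L[ℝ] ℝ => L v) (h3.unique (hasFDerivAt_const _ _))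
  simp only [kappa_symm_one, Ad_one] at h4
  simp at h4
  linarith

end LieCalculus

/-! ### Fundamental vectors and the horizontality of the curvature -/

section BundleCalculus
open Filter Topology

variable {EM : Type*} [NormedAddCommGroup EM] [NormedSpace ℝ EM]
  {M : Type*} [TopologicalSpace M] [ChartedSpace EM M] [IsManifold 𝓘(ℝ, EM) ∞ M]
  {EG : Type*} [NormedAddCommGroup EG] [NormedSpace ℝ EG]
  {G : Type*} [TopologicalSpace G] [ChartedSpace EG G] [Group G] [LieGroup 𝓘(ℝ, EG) ∞ G]
  {EP : Type*} [NormedAddCommGroup EP] [NormedSpace ℝ EP]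
  {P : Type*} [TopologicalSpace P] [ChartedSpace EP P] [IsManifold 𝓘(ℝ, EP) ∞ P] [MulAction Gᵐᵒᵖ P]
  {pr : P → M} (hP : IsPrincipalBundle EM EG G EP pr)

lemma act_mul (p : P) (a b : G) : p <• (a * b) = (p <• a) <• b := by
  rw [MulOpposite.op_mul, mul_smul]

lemma act_one (p : P) : p <• (1 : G) = p := by simp

variable (EG G EP) in
/-- The value at `p` of the fundamental vector field of `v`. -/
def fund (p : P) : EG →L[ℝ] EP := mder EG EP (fun a : G => p <• a) 1

include hP

lemma IsPrincipalBundle.contMDiff_right (a : G) :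
    ContMDiff 𝓘(ℝ, EP) 𝓘(ℝ, EP) ∞ (fun q : P => q <• a) :=
  hP.smooth_action.comp (contMDiff_id.prodMk contMDiff_const)

lemma IsPrincipalBundle.contMDiff_orbit (p : P) :
    ContMDiff 𝓘(ℝ, EG) 𝓘(ℝ, EP) ∞ (fun a : G => p <• a) :=
  hP.smooth_action.comp (contMDiff_const.prodMk contMDiff_id)

/-- The product rule for the action. -/
lemma IsPrincipalBundle.mder_act {E' : Type*} [NormedAddCommGroup E'] [NormedSpace ℝ E']
    {X : Type*} [TopologicalSpace X] [ChartedSpace E' X] {c : X → P} {b : X → G} {x : X}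
    (hc : MDifferentiableAt 𝓘(ℝ, E') 𝓘(ℝ, EP) c x) (hb : MDifferentiableAt 𝓘(ℝ, E') 𝓘(ℝ, EG) b x)
    (u : E') :
    mder E' EP (fun z => c z <• b z) x u =
      mder EP EP (fun q : P => q <• b x) (c x) (mder E' EP c x u) +
      mder EG EP (fun a : G => c x <• a) (b x) (mder E' EG b x u) := by
  have h1 : MDifferentiableAt (𝓘(ℝ, EP).prod 𝓘(ℝ, EG)) 𝓘(ℝ, EP) (fun q : P × G => q.1 <• q.2)
    (c x, b x) := hP.smooth_action.mdifferentiable (by simp) _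
  have h2 := mfderiv_comp x (g := fun q : P × G => q.1 <• q.2) (f := fun z => (c z, b z)) h1
    (hc.prodMk hb)
  have h3 := congrArg (fun L : E' →L[ℝ] EP => L u) h2
  refine h3.trans ?_
  rw [mfderiv_prodMk hc hb]
  exact mfderiv_prod_eq_add_apply h1

/-- The product rule for the action at a point where the group-valued factor is the identity. -/
lemma IsPrincipalBundle.mder_act_of_eq_one {E' : Type*} [NormedAddCommGroup E'] [NormedSpace ℝ E']
    {X : Type*} [TopologicalSpace X] [ChartedSpace E' X] {c : X → P} {b : X → G} {x : X}
    (hc : MDifferentiableAt 𝓘(ℝ, E') 𝓘(ℝ, EP) c x) (hb : MDifferentiableAt 𝓘(ℝ, E') 𝓘(ℝ, EG) b x)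
    (hb1 : b x = 1) (u : E') :
    mder E' EP (fun z => c z <• b z) x u =
      mder E' EP c x u + fund EG G EP (c x) (mder E' EG b x u) := by
  rw [hP.mder_act hc hb, hb1]
  have : mder EP EP (fun q : P => q <• (1 : G)) (c x) = ContinuousLinearMap.id ℝ EP := by
    simp only [act_one]
    exact mfderiv_id
  rw [this]
  rfl

/-- Fundamental vectors are vertical. -/
lemma IsPrincipalBundle.mder_proj_fund (p : P) (v : EG) : mder EP EM pr p (fund EG G EP p v) = 0 := by
  have h1 : pr ∘ (fun a : G => p <• a) = fun _ => pr p := by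
    funext a; exact hP.proj_action p a
  have h2 := mder_comp (E' := EP) (E := EG) (E'' := EM) (f := fun a : G => p <• a) (h := pr) (x := 1)
    (hP.smooth_proj.mdifferentiable (by simp) _) ((hP.contMDiff_orbit p).mdifferentiable (by simp) _)
  rw [h1, act_one] at h2
  have h3 : mder EG EM (fun _ : G => pr p) 1 = 0 := mfderiv_const
  rw [h3] at h2
  exact (congrArg (fun L : EG →L[ℝ] EM => L v) h2).symm

omit hP in
lemma Connection.form_fund (A : Connection EG G EP P) (p : P) (v : EG) :
    formAt A.form p (fund EG G EP p v) = v := by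
  have h1 : ∀ q : P, q = p → formAt A.form q (fund EG G EP p v) =
    formAt A.form p (fund EG G EP p v) := by rintro q rfl; rfl
  exact (h1 _ (act_one p)).symm.trans (A.fundamental p v)

omit hP in
/-- The equivariance of a connection form, in terms of maps between the model spaces. -/
lemma Connection.form_right (A : Connection EG G EP P) (p : P) (a : G) (w : EP) :
    formAt A.form (p <• a) (mder EP EP (fun q : P => q <• a) p w) =
      Ad a⁻¹ (formAt A.form p w) := A.equivariant p a w

/-- The bilinear map `(D, a) ↦ D(u, w) - D(w, u) + [a(u), a(w)]`, which gives the curvature in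
terms of the first derivative `D` and the value `a` of a connection form. -/
def curvOf {F : Type*} [NormedAddCommGroup F] [NormedSpace ℝ F] (br : EG →L[ℝ] EG →L[ℝ] EG)
    (D : F →L[ℝ] F →L[ℝ] EG) (a : F →L[ℝ] EG) : F →L[ℝ] F →L[ℝ] EG :=
  D - D.flip + br.bilinearComp a a

omit hP in
lemma curvOf_apply {F : Type*} [NormedAddCommGroup F] [NormedSpace ℝ F] (br : EG →L[ℝ] EG →L[ℝ] EG)
    (D : F →L[ℝ] F →L[ℝ] EG) (a : F →L[ℝ] EG) (u w : F) :
    curvOf br D a u w = D u w - D w u + br (a u) (a w) := rfl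

/-- The curvature as a continuous bilinear map. -/
def curvatureL (A : Connection EG G EP P) (p : P) : EP →L[ℝ] EP →L[ℝ] EG :=
  curvOf (adL G) (fderiv ℝ (chartForm A.form p) (extChartAt 𝓘(ℝ, EP) p p)) (formAt A.form p)

omit hP in
lemma curvature_eq (A : Connection EG G EP P) (p : P) (u w : EP) :
    curvature G A.form p u w = curvatureL A p u w := by
  refine congrArg₂ (· + ·) (extDerivOne_eq (A.smooth.contDiffAt_chartForm p) u w) ?_
  exact lieBr_eq_adL _ _

omit hP in
lemma adL_antisymm (v w : EG) : adL G v w = - adL G w v := by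
  rw [← lieBr_eq_adL, ← lieBr_eq_adL]; exact lieBr_antisymm v w

omit hP in
lemma curvatureL_antisymm (A : Connection EG G EP P) (p : P) (u w : EP) :
    curvatureL A p u w = - curvatureL A p w u := by
  simp only [curvatureL, curvOf_apply]
  rw [adL_antisymm (formAt A.form p u)]
  abel

omit hP in
lemma curvatureL_pullForm (A : Connection EG G EP P) {E' : Type*} [NormedAddCommGroup E']
    [NormedSpace ℝ E'] {f : E' → P} {y : E'} (hf : ContMDiffAt 𝓘(ℝ, E') 𝓘(ℝ, EP) ∞ f y) (u w : E') :
    curvatureL A (f y) (mder E' EP f y u) (mder E' EP f y w) =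
      curvOf (adL G) (fderiv ℝ (pullForm A.form f) y) (pullForm A.form f y) u w := by
  rw [← curvature_eq, curvOf_apply]
  refine congrArg₂ (· + ·) (extDerivOne_pullForm hf (A.smooth.contDiffAt_chartForm _) u w) ?_
  exact lieBr_eq_adL _ _

/-- The curvature is horizontal: pulled back by `(q, b) ↦ q b` to a product of charts, the form of the
connection in the direction of the fibre is determined by its equivariance, and the terms
`dA(v, w)` and `[A v, A w]` cancel. -/
lemma IsPrincipalBundle.curvatureL_fund (A : Connection EG G EP P) (p : P) (v : EG) (w : EP) :
    curvatureL A p (fund EG G EP p v) w = 0 := by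
  set φ := extChartAt 𝓘(ℝ, EP) p
  set κ := extChartAt 𝓘(ℝ, EG) (1 : G)
  have hφ : φ.symm (φ p) = p := extChartAt_to_inv p
  have hκ : κ.symm (κ 1) = 1 := extChartAt_to_inv 1
  set y₀ : EP × EG := (φ p, κ 1) with hy₀
  have hφs : ContMDiffAt 𝓘(ℝ, EP) 𝓘(ℝ, EP) ∞ φ.symm (φ p) :=
    (contMDiffOn_extChartAt_symm (n := ∞) p).contMDiffAt (extChartAt_target_mem_nhds _)
  have hκs : ContMDiffAt 𝓘(ℝ, EG) 𝓘(ℝ, EG) ∞ κ.symm (κ 1) := contMDiffAt_kappa_symm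
  have hc : ContMDiffAt 𝓘(ℝ, EP × EG) 𝓘(ℝ, EP) ∞ (fun z : EP × EG => φ.symm z.1) y₀ :=
    ContMDiffAt.comp y₀ (I' := 𝓘(ℝ, EP)) hφs contDiffAt_fst.contMDiffAt
  have hb : ContMDiffAt 𝓘(ℝ, EP × EG) 𝓘(ℝ, EG) ∞ (fun z : EP × EG => κ.symm z.2) y₀ :=
    ContMDiffAt.comp y₀ (I' := 𝓘(ℝ, EG)) hκs contDiffAt_snd.contMDiffAt
  set f : EP × EG → P := fun z => φ.symm z.1 <• κ.symm z.2 with hf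
  have hfs : ContMDiffAt 𝓘(ℝ, EP × EG) 𝓘(ℝ, EP) ∞ f y₀ :=
    ContMDiffAt.comp y₀ (hP.smooth_action (φ.symm y₀.1, κ.symm y₀.2)) (hc.prodMk hb)
  have hfy : f y₀ = p := by simp only [hf, hy₀, hφ, hκ, act_one]
  have hdc : ∀ z : EP × EG, MDifferentiableAt 𝓘(ℝ, EP) 𝓘(ℝ, EP) φ.symm z.1 →
      mder (EP × EG) EP (fun z : EP × EG => φ.symm z.1) z =
      (mder EP EP φ.symm z.1).comp (ContinuousLinearMap.fst ℝ EP EG) := by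
    intro z hz
    have := mder_comp (E := EP × EG) (f := fun z : EP × EG => z.1) (h := φ.symm) (x := z) hz
      differentiableAt_fst.mdifferentiableAt
    rw [mder_eq_fderiv, fderiv_fst] at this
    exact this
  have hdb : ∀ z : EP × EG, MDifferentiableAt 𝓘(ℝ, EG) 𝓘(ℝ, EG) κ.symm z.2 →
      mder (EP × EG) EG (fun z : EP × EG => κ.symm z.2) z =
      (mder EG EG κ.symm z.2).comp (ContinuousLinearMap.snd ℝ EP EG) := by
    intro z hz
    have := mder_comp (E := EP × EG) (f := fun z : EP × EG => z.2) (h := κ.symm) (x := z) hz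
      differentiableAt_snd.mdifferentiableAt
    rw [mder_eq_fderiv, fderiv_snd] at this
    exact this
  have hφd := hφs.mdifferentiableAt (by simp)
  have hκd := hκs.mdifferentiableAt (by simp)
  have hmd : ∀ (w : EP) (v : EG), mder (EP × EG) EP f y₀ (w, v) = w + fund EG G EP p v := by
    intro w v
    rw [hf, hP.mder_act_of_eq_one (hc.mdifferentiableAt (by simp)) (hb.mdifferentiableAt (by simp)) hκ,
      hdc y₀ hφd, hdb y₀ hκd]
    simp only [hy₀, hφ, ContinuousLinearMap.comp_apply]
    have e1 : mder EP EP φ.symm (φ p) = ContinuousLinearMap.id ℝ EP := mder_extChartAt_symm_self p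
    have e2 : mder EG EG κ.symm (κ 1) = ContinuousLinearMap.id ℝ EG := mder_extChartAt_symm_self 1
    rw [e1, e2]
    rfl
  have hpull : DifferentiableAt ℝ (pullForm A.form f) y₀ :=
    (contDiffAt_pullForm hfs (A.smooth.contDiffAt_chartForm _)).differentiableAt (by simp)
  -- along the fibre direction the equivariance of `A` determines the pulled-back form
  have hD1 : fderiv ℝ (pullForm A.form f) y₀ (0, v) (w, 0) =
      - adL G v (formAt A.form p w) := by
    have hr : HasFDerivAt (fun ξ : EG => (φ p, ξ)) (ContinuousLinearMap.inr ℝ EP EG) (κ 1) :=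
      hasFDerivAt_prodMk_right (φ p) (κ 1)
    have h1 : HasFDerivAt (fun ξ : EG => pullForm A.form f (φ p, ξ))
        ((fderiv ℝ (pullForm A.form f) y₀).comp (ContinuousLinearMap.inr ℝ EP EG)) (κ 1) :=
      HasFDerivAt.comp (f := fun ξ : EG => (φ p, ξ)) (κ 1) hpull.hasFDerivAt hr
    have h2 := h1.clm_apply (hasFDerivAt_const ((w, 0) : EP × EG) (κ 1))
    have h3 : (fun ξ : EG => pullForm A.form f (φ p, ξ) (w, 0)) =ᶠ[𝓝 (κ 1)]
        fun ξ => Ad (κ.symm ξ)⁻¹ (formAt A.form p w) := by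
      have h4 : ∀ᶠ ξ in 𝓝 (κ 1), MDifferentiableAt 𝓘(ℝ, EG) 𝓘(ℝ, EG) κ.symm ξ := by
        have := (contMDiffAt_iff_contMDiffAt_nhds (n := 1) (by simp)).1 (hκs.of_le (by simp))
        filter_upwards [this] with ξ hξ using hξ.mdifferentiableAt (by simp)
      filter_upwards [h4] with ξ hξ
      change formAt A.form (f (φ p, ξ)) (mder (EP × EG) EP f (φ p, ξ) (w, 0)) = _
      have hc' : MDifferentiableAt 𝓘(ℝ, EP × EG) 𝓘(ℝ, EP) (fun z : EP × EG => φ.symm z.1) (φ p, ξ) :=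
        MDifferentiableAt.comp (I' := 𝓘(ℝ, EP)) (φ p, ξ) (g := φ.symm) (f := fun z : EP × EG => z.1) hφd differentiableAt_fst.mdifferentiableAt
      have hb' : MDifferentiableAt 𝓘(ℝ, EP × EG) 𝓘(ℝ, EG) (fun z : EP × EG => κ.symm z.2) (φ p, ξ) :=
        MDifferentiableAt.comp (I' := 𝓘(ℝ, EG)) (φ p, ξ) (g := κ.symm) (f := fun z : EP × EG => z.2) hξ differentiableAt_snd.mdifferentiableAt
      have h5 : mder (EP × EG) EP f (φ p, ξ) (w, 0) = mder EP EP (fun q : P => q <• κ.symm ξ) p w := by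
        rw [hf, hP.mder_act hc' hb', hdc _ hφd, hdb _ hξ]
        have e1 : mder EP EP φ.symm (φ p) = ContinuousLinearMap.id ℝ EP := mder_extChartAt_symm_self p
        simp [e1, hφ]
      rw [h5]
      have h6 : f (φ p, ξ) = p <• κ.symm ξ := by simp only [hf, hφ]
      rw [h6]
      exact A.form_right p (κ.symm ξ) w
    have h7 := (hasFDerivAt_Ad_inv_kappa (EG := EG) (G := G)).clm_apply
      (hasFDerivAt_const (formAt A.form p w) (κ 1))
    have h8 := congrArg (fun L : EG →L[ℝ] EG => L v) (h2.unique (h7.congr_of_eventuallyEq h3))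
    simpa using h8
  -- along the base direction the fundamental field is mapped to the constant `v`
  have hD2 : fderiv ℝ (pullForm A.form f) y₀ (w, 0) (0, v) = 0 := by
    have hl : HasFDerivAt (fun z : EP => (z, κ 1)) (ContinuousLinearMap.inl ℝ EP EG) (φ p) :=
      hasFDerivAt_prodMk_left (φ p) (κ 1)
    have h1 : HasFDerivAt (fun z : EP => pullForm A.form f (z, κ 1))
        ((fderiv ℝ (pullForm A.form f) y₀).comp (ContinuousLinearMap.inl ℝ EP EG)) (φ p) :=
      HasFDerivAt.comp (f := fun z : EP => (z, κ 1)) (φ p) hpull.hasFDerivAt hl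
    have h2 := h1.clm_apply (hasFDerivAt_const ((0, v) : EP × EG) (φ p))
    have h3 : (fun z : EP => pullForm A.form f (z, κ 1) (0, v)) =ᶠ[𝓝 (φ p)] fun z => v := by
      have h4 : ∀ᶠ z in 𝓝 (φ p), MDifferentiableAt 𝓘(ℝ, EP) 𝓘(ℝ, EP) φ.symm z := by
        have := (contMDiffAt_iff_contMDiffAt_nhds (n := 1) (by simp)).1 (hφs.of_le (by simp))
        filter_upwards [this] with ξ hξ using hξ.mdifferentiableAt (by simp)
      filter_upwards [h4] with z hz
      change formAt A.form (f (z, κ 1)) (mder (EP × EG) EP f (z, κ 1) (0, v)) = _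
      have hc' : MDifferentiableAt 𝓘(ℝ, EP × EG) 𝓘(ℝ, EP) (fun z : EP × EG => φ.symm z.1) (z, κ 1) :=
        MDifferentiableAt.comp (I' := 𝓘(ℝ, EP)) (z, κ 1) (g := φ.symm) (f := fun z : EP × EG => z.1) hz differentiableAt_fst.mdifferentiableAt
      have hb' : MDifferentiableAt 𝓘(ℝ, EP × EG) 𝓘(ℝ, EG) (fun z : EP × EG => κ.symm z.2) (z, κ 1) :=
        MDifferentiableAt.comp (I' := 𝓘(ℝ, EG)) (z, κ 1) (g := κ.symm) (f := fun z : EP × EG => z.2) hκd differentiableAt_snd.mdifferentiableAt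
      have h5 : mder (EP × EG) EP f (z, κ 1) (0, v) = fund EG G EP (φ.symm z) v := by
        rw [hf, hP.mder_act_of_eq_one hc' hb' hκ, hdc _ hz, hdb _ hκd]
        have e1 : mder EG EG κ.symm (κ 1) = ContinuousLinearMap.id ℝ EG := mder_extChartAt_symm_self 1
        simp [e1]
      have h6 : f (z, κ 1) = φ.symm z := by simp only [hf, hκ, act_one]
      rw [h5, h6]
      exact A.form_fund _ _
    have h8 := congrArg (fun L : EP →L[ℝ] EG => L w)
      (h2.unique ((hasFDerivAt_const v (φ p)).congr_of_eventuallyEq h3))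
    simpa using h8
  have h1 := curvatureL_pullForm A hfs (0, v) (w, 0)
  rw [hmd, hmd, hfy, curvOf_apply, hD1, hD2] at h1
  have h2 : ∀ (w : EP) (v : EG), pullForm A.form f y₀ (w, v) = formAt A.form p w + v := by
    intro w v
    change formAt A.form (f y₀) (mder (EP × EG) EP f y₀ (w, v)) = _
    rw [hmd, hfy, map_add, A.form_fund]
  rw [h2, h2] at h1
  simpa [hmd] using h1

end BundleCalculus

/-! ### Local gauges and horizontal lifts -/

section Gauges
open Filter Topology

variable {EM : Type*} [NormedAddCommGroup EM] [NormedSpace ℝ EM]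
  {M : Type*} [TopologicalSpace M] [ChartedSpace EM M] [IsManifold 𝓘(ℝ, EM) ∞ M]
  {EG : Type*} [NormedAddCommGroup EG] [NormedSpace ℝ EG]
  {G : Type*} [TopologicalSpace G] [ChartedSpace EG G] [Group G] [LieGroup 𝓘(ℝ, EG) ∞ G]
  {EP : Type*} [NormedAddCommGroup EP] [NormedSpace ℝ EP]
  {P : Type*} [TopologicalSpace P] [ChartedSpace EP P] [IsManifold 𝓘(ℝ, EP) ∞ P] [MulAction Gᵐᵒᵖ P]

variable (EM EG G EP) in
/-- A local gauge: a smooth section of the bundle over an open subset of a chart domain of the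
base, written in the coordinates of the chart at `x₀`, together with the induced fibre coordinate
`fib` with values in `G`. -/
structure Gauge (pr : P → M) (x₀ : M) where
  /-- the coordinate domain of the section -/
  dom : Set EM
  isOpen : IsOpen dom
  subset : dom ⊆ (extChartAt 𝓘(ℝ, EM) x₀).target
  /-- the section -/
  sec : EM → P
  smooth_sec : ContMDiffOn 𝓘(ℝ, EM) 𝓘(ℝ, EP) ∞ sec dom
  proj_sec : ∀ y ∈ dom, pr (sec y) = (extChartAt 𝓘(ℝ, EM) x₀).symm y
  /-- the fibre coordinate -/
  fib : P → G
  smooth_fib : ∀ p, pr p ∈ (chartAt EM x₀).source → extChartAt 𝓘(ℝ, EM) x₀ (pr p) ∈ dom →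
    ContMDiffAt 𝓘(ℝ, EP) 𝓘(ℝ, EG) ∞ fib p
  sec_fib : ∀ p, pr p ∈ (chartAt EM x₀).source → extChartAt 𝓘(ℝ, EM) x₀ (pr p) ∈ dom →
    sec (extChartAt 𝓘(ℝ, EM) x₀ (pr p)) <• fib p = p
  fib_sec : ∀ y ∈ dom, ∀ a : G, fib (sec y <• a) = a

variable {pr : P → M} (hP : IsPrincipalBundle EM EG G EP pr)

include hP in
/-- Through every point over the chart domain there is a local gauge. -/
lemma IsPrincipalBundle.exists_gauge (x₀ : M) (p : P) (hp : pr p ∈ (chartAt EM x₀).source) :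
    ∃ g : Gauge EM EG G EP pr x₀, extChartAt 𝓘(ℝ, EM) x₀ (pr p) ∈ g.dom ∧
      g.sec (extChartAt 𝓘(ℝ, EM) x₀ (pr p)) = p := by
  obtain ⟨U, hU, hpU, σ, τ, hσ, hτ, h1, h2, h3⟩ := hP.locally_trivial (pr p)
  set φ := extChartAt 𝓘(ℝ, EM) x₀
  have hφo : IsOpen (φ.target ∩ φ.symm ⁻¹' U) :=
    (continuousOn_extChartAt_symm x₀).isOpen_inter_preimage (isOpen_extChartAt_target x₀) hU
  have hps : pr p ∈ φ.source := by simpa [φ] using hp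
  refine ⟨{ dom := φ.target ∩ φ.symm ⁻¹' U
            isOpen := hφo
            subset := inter_subset_left
            sec := fun y => σ (φ.symm y) <• τ p
            smooth_sec := ?_
            proj_sec := ?_
            fib := fun q => (τ p)⁻¹ * τ q
            smooth_fib := ?_
            sec_fib := ?_
            fib_sec := ?_ }, ?_, ?_⟩
  · have h4 : ContMDiffOn 𝓘(ℝ, EM) 𝓘(ℝ, EP) ∞ (fun y => σ (φ.symm y)) (φ.target ∩ φ.symm ⁻¹' U) :=
      hσ.comp ((contMDiffOn_extChartAt_symm x₀).mono inter_subset_left) fun y hy => hy.2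
    exact (hP.contMDiff_right (τ p)).comp_contMDiffOn h4
  · intro y hy
    rw [hP.proj_action]
    exact h1 _ hy.2
  · intro q hq hqd
    have hqs : pr q ∈ φ.source := by simpa [φ] using hq
    have hqU : pr q ∈ U := by
      have := hqd.2
      rwa [mem_preimage, φ.left_inv hqs] at this
    have : ContMDiffAt 𝓘(ℝ, EP) 𝓘(ℝ, EG) ∞ τ q :=
      hτ.contMDiffAt ((hU.preimage hP.smooth_proj.continuous).mem_nhds hqU)
    exact contMDiffAt_const.mul this
  · intro q hq hqd
    have hqs : pr q ∈ φ.source := by simpa [φ] using hq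
    have hqU : pr q ∈ U := by
      have := hqd.2
      rwa [mem_preimage, φ.left_inv hqs] at this
    change (σ (φ.symm (φ (pr q))) <• τ p) <• ((τ p)⁻¹ * τ q) = q
    rw [φ.left_inv hqs, ← act_mul, mul_inv_cancel_left]
    exact h2 q hqU
  · intro y hy a
    rw [← act_mul, h3 _ hy.2, inv_mul_cancel_left]
  · exact ⟨φ.map_source hps, by rw [mem_preimage, φ.left_inv hps]; exact hpU⟩
  · change σ (φ.symm (φ (pr p))) <• τ p = p
    rw [φ.left_inv hps]
    exact h2 p hpU

namespace Gauge

variable {x₀ : M} (g : Gauge EM EG G EP pr x₀)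

include hP in
/-- The gauge translated by a constant element of the group. -/
def translate (b : G) : Gauge EM EG G EP pr x₀ where
  dom := g.dom
  isOpen := g.isOpen
  subset := g.subset
  sec y := g.sec y <• b
  smooth_sec := (hP.contMDiff_right b).comp_contMDiffOn g.smooth_sec
  proj_sec y hy := by rw [hP.proj_action, g.proj_sec y hy]
  fib q := b⁻¹ * g.fib q
  smooth_fib q hq hqd := contMDiffAt_const.mul (g.smooth_fib q hq hqd)
  sec_fib q hq hqd := by rw [← act_mul, mul_inv_cancel_left, g.sec_fib q hq hqd]
  fib_sec y hy a := by rw [← act_mul, g.fib_sec y hy, inv_mul_cancel_left]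

lemma mem_source {y : EM} (hy : y ∈ g.dom) : pr (g.sec y) ∈ (chartAt EM x₀).source := by
  rw [g.proj_sec y hy]
  simpa using (extChartAt 𝓘(ℝ, EM) x₀).map_target (g.subset hy)

lemma coord_proj_sec {y : EM} (hy : y ∈ g.dom) : extChartAt 𝓘(ℝ, EM) x₀ (pr (g.sec y)) = y := by
  rw [g.proj_sec y hy, (extChartAt 𝓘(ℝ, EM) x₀).right_inv (g.subset hy)]

lemma contMDiffAt_sec {y : EM} (hy : y ∈ g.dom) : ContMDiffAt 𝓘(ℝ, EM) 𝓘(ℝ, EP) ∞ g.sec y :=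
  g.smooth_sec.contMDiffAt (g.isOpen.mem_nhds hy)

lemma mdifferentiableAt_sec {y : EM} (hy : y ∈ g.dom) :
    MDifferentiableAt 𝓘(ℝ, EM) 𝓘(ℝ, EP) g.sec y :=
  (g.contMDiffAt_sec hy).mdifferentiableAt (by simp)

lemma fib_sec_one {y : EM} (hy : y ∈ g.dom) : g.fib (g.sec y) = 1 := by
  have := g.fib_sec y hy 1
  rwa [act_one] at this

/-- The derivative of the section of a gauge. -/
def dsec (y : EM) : EM →L[ℝ] EP := mder EM EP g.sec y

include hP

lemma mder_proj_dsec {y : EM} (hy : y ∈ g.dom) (u : EM) :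
    mder EP EM pr (g.sec y) (g.dsec y u) = mder EM EM (extChartAt 𝓘(ℝ, EM) x₀).symm y u := by
  have h1 : pr ∘ g.sec =ᶠ[𝓝 y] (extChartAt 𝓘(ℝ, EM) x₀).symm := by
    filter_upwards [g.isOpen.mem_nhds hy] with z hz using g.proj_sec z hz
  have h2 := mder_comp (h := pr) (f := g.sec) (x := y)
    (hP.smooth_proj.mdifferentiable (by simp) _) (g.mdifferentiableAt_sec hy)
  rw [mder_congr h1] at h2
  exact (congrArg (fun L : EM →L[ℝ] EM => L u) h2).symm

lemma contMDiffAt_coord {q : P} (hq : pr q ∈ (chartAt EM x₀).source) :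
    ContMDiffAt 𝓘(ℝ, EP) 𝓘(ℝ, EM) ∞ (fun q => extChartAt 𝓘(ℝ, EM) x₀ (pr q)) q :=
  ContMDiffAt.comp (I' := 𝓘(ℝ, EM)) q (contMDiffAt_extChartAt' hq) (hP.smooth_proj q)

lemma eventually_mem {y : EM} (hy : y ∈ g.dom) :
    ∀ᶠ q in 𝓝 (g.sec y), pr q ∈ (chartAt EM x₀).source ∧ extChartAt 𝓘(ℝ, EM) x₀ (pr q) ∈ g.dom := by
  have h1 : ∀ᶠ q in 𝓝 (g.sec y), pr q ∈ (chartAt EM x₀).source :=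
    hP.smooth_proj.continuous.continuousAt.eventually
      ((chartAt EM x₀).open_source.mem_nhds (g.mem_source hy))
  have h2 : ∀ᶠ q in 𝓝 (g.sec y), extChartAt 𝓘(ℝ, EM) x₀ (pr q) ∈ g.dom := by
    refine (contMDiffAt_coord hP (g.mem_source hy)).continuousAt.eventually ?_
    simp only [g.coord_proj_sec hy]
    exact g.isOpen.mem_nhds hy
  exact h1.and h2

/-- Every tangent vector to the bundle at a point of the section is the sum of a vector tangent to
the section and a vertical vector. -/
lemma decomp {y : EM} (hy : y ∈ g.dom) (w : EP) :
    w = g.dsec y (mder EM EM (extChartAt 𝓘(ℝ, EM) x₀) (pr (g.sec y)) (mder EP EM pr (g.sec y) w)) +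
      fund EG G EP (g.sec y) (mder EP EG g.fib (g.sec y) w) := by
  set φ := extChartAt 𝓘(ℝ, EM) x₀
  set p := g.sec y
  have hps := g.mem_source hy
  have h1 : (fun q => g.sec (φ (pr q)) <• g.fib q) =ᶠ[𝓝 p] id := by
    filter_upwards [g.eventually_mem hP hy] with q hq using g.sec_fib q hq.1 hq.2
  have hcp : φ (pr p) = y := g.coord_proj_sec hy
  have hd1 : MDifferentiableAt 𝓘(ℝ, EP) 𝓘(ℝ, EM) (fun q => φ (pr q)) p :=
    (contMDiffAt_coord hP hps).mdifferentiableAt (by simp)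
  have hd0 : MDifferentiableAt 𝓘(ℝ, EM) 𝓘(ℝ, EP) g.sec (φ (pr p)) := by
    rw [hcp]; exact g.mdifferentiableAt_sec hy
  have hd2 : MDifferentiableAt 𝓘(ℝ, EP) 𝓘(ℝ, EP) (fun q => g.sec (φ (pr q))) p :=
    MDifferentiableAt.comp (I' := 𝓘(ℝ, EM)) p hd0 hd1
  have hd3 : MDifferentiableAt 𝓘(ℝ, EP) 𝓘(ℝ, EG) g.fib p :=
    (g.smooth_fib p hps (by rw [hcp]; exact hy)).mdifferentiableAt (by simp)
  have h2 := hP.mder_act_of_eq_one hd2 hd3 (g.fib_sec_one hy) w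
  rw [mder_congr h1] at h2
  have h3 : mder EP EP (id : P → P) p = ContinuousLinearMap.id ℝ EP := mfderiv_id
  have h4 := mder_comp (f := fun q => φ (pr q)) (h := g.sec) (x := p) hd0 hd1
  have h5 := mder_comp (f := pr) (h := φ) (x := p) (mdifferentiableAt_extChartAt hps)
    (hP.smooth_proj.mdifferentiable (by simp) p)
  have h6 : mder EP EP (fun q => g.sec (φ (pr q))) p w =
      g.dsec y (mder EM EM φ (pr p) (mder EP EM pr p w)) := by
    refine (congrArg (fun L : EP →L[ℝ] EP => L w) h4).trans ?_
    simp only [hcp]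
    exact congrArg (g.dsec y) (congrArg (fun L : EP →L[ℝ] EM => L w) h5)
  rw [h3, h6, hcp] at h2
  exact h2

lemma mder_symm_mder {y : EM} (hy : y ∈ g.dom) (u : EM) :
    mder EM EM (extChartAt 𝓘(ℝ, EM) x₀).symm y
      (mder EM EM (extChartAt 𝓘(ℝ, EM) x₀) (pr (g.sec y)) u) = u := by
  have := mfderivWithin_extChartAt_symm_comp_mfderiv_extChartAt (I := 𝓘(ℝ, EM)) (g.subset hy)
  rw [show range 𝓘(ℝ, EM) = univ by simp, mfderivWithin_univ, ← g.proj_sec y hy] at this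
  exact congrArg (fun L : EM →L[ℝ] EM => L u) this

lemma mder_mder_symm {y : EM} (hy : y ∈ g.dom) (u : EM) :
    mder EM EM (extChartAt 𝓘(ℝ, EM) x₀) (pr (g.sec y))
      (mder EM EM (extChartAt 𝓘(ℝ, EM) x₀).symm y u) = u := by
  have := mfderiv_extChartAt_comp_mfderivWithin_extChartAt_symm (I := 𝓘(ℝ, EM)) (g.subset hy)
  rw [show range 𝓘(ℝ, EM) = univ by simp, mfderivWithin_univ, ← g.proj_sec y hy] at this
  exact congrArg (fun L : EM →L[ℝ] EM => L u) this

/-- The horizontal lift at a point of the section: the tangent vector to the section, corrected by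
a fundamental vector so that the connection form vanishes. -/
lemma horLift_eq (A : Connection EG G EP P) {y : EM} (hy : y ∈ g.dom) (u : EM) :
    horLift EM pr A.form (g.sec y) (mder EM EM (extChartAt 𝓘(ℝ, EM) x₀).symm y u) =
      g.dsec y u - fund EG G EP (g.sec y) (pullForm A.form g.sec y u) := by
  set φ := extChartAt 𝓘(ℝ, EM) x₀
  set p := g.sec y
  let D : EM →L[ℝ] EM := mder EM EM φ (pr p)
  let L : EP →L[ℝ] EM × EG := (mder EP EM pr p).prod (formAt A.form p)
  let S : EM × EG →L[ℝ] EP := ((g.dsec y).comp D).comp (ContinuousLinearMap.fst ℝ EM EG) +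
    (fund EG G EP p).comp (ContinuousLinearMap.snd ℝ EM EG -
      ((formAt A.form p).comp ((g.dsec y).comp D)).comp (ContinuousLinearMap.fst ℝ EM EG))
  have hS : ∀ (u' : EM) (v : EG), S (u', v) = g.dsec y (D u') + fund EG G EP p
      (v - formAt A.form p (g.dsec y (D u'))) := fun _ _ => rfl
  have hL : ∀ w, L w = (mder EP EM pr p w, formAt A.form p w) := fun _ => rfl
  have hLds : ∀ u, mder EP EM pr p (g.dsec y u) = mder EM EM φ.symm y u := g.mder_proj_dsec hP hy
  have h1 : L.comp S = ContinuousLinearMap.id ℝ (EM × EG) := by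
    refine ContinuousLinearMap.ext fun ⟨u', v⟩ => ?_
    simp only [ContinuousLinearMap.comp_apply, hS, hL, map_add, hLds, hP.mder_proj_fund, add_zero,
      A.form_fund, D, g.mder_symm_mder hP hy, φ, p]
    simp
  have h2 : S.comp L = ContinuousLinearMap.id ℝ EP := by
    ext1 w
    have hw := g.decomp hP hy w
    set u' := D (mder EP EM pr p w) with hu'
    set v := mder EP EG g.fib p w
    have hw' : w = g.dsec y u' + fund EG G EP p v := hw
    simp only [ContinuousLinearMap.comp_apply, hL, hS, ← hu']
    conv_rhs => rw [ContinuousLinearMap.id_apply, hw']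
    conv_lhs => rw [hw']
    rw [map_add, A.form_fund]
    simp
  have h3 : L.inverse = S := ContinuousLinearMap.inverse_eq h1 h2
  have h4 : horLift EM pr A.form p (mder EM EM φ.symm y u) = L.inverse (mder EM EM φ.symm y u, 0) := rfl
  rw [h4, h3, hS, show D (mder EM EM φ.symm y u) = u from g.mder_mder_symm hP hy u, zero_sub, map_neg]
  exact (sub_eq_add_neg _ _).symm

/-- The curvature on horizontal lifts, computed in a gauge. -/
lemma curvature_horLift (A : Connection EG G EP P) {y : EM} (hy : y ∈ g.dom) (u w : EM) :
    curvature G A.form (g.sec y)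
      (horLift EM pr A.form (g.sec y) (mder EM EM (extChartAt 𝓘(ℝ, EM) x₀).symm y u))
      (horLift EM pr A.form (g.sec y) (mder EM EM (extChartAt 𝓘(ℝ, EM) x₀).symm y w)) =
    curvOf (adL G) (fderiv ℝ (pullForm A.form g.sec) y) (pullForm A.form g.sec y) u w := by
  refine (congrArg₂ (fun a b : EP => curvature G A.form (g.sec y) a b)
    (g.horLift_eq hP A hy u) (g.horLift_eq hP A hy w)).trans ?_
  refine (curvature_eq A _ _ _).trans ?_
  have h := hP.curvatureL_fund A (g.sec y)
  have h' : ∀ w v, curvatureL A (g.sec y) w (fund EG G EP (g.sec y) v) = 0 := by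
    intro w v
    rw [curvatureL_antisymm, h, neg_zero]
  rw [map_sub, map_sub, sub_apply, sub_apply, h, h, h']
  simp only [sub_zero]
  exact curvatureL_pullForm A (g.contMDiffAt_sec hy) u w

lemma pullForm_translate_connection (A : Connection EG G EP P) (b : G) {y : EM} (hy : y ∈ g.dom) (u : EM) :
    pullForm A.form (g.translate hP b).sec y u = Ad b⁻¹ (pullForm A.form g.sec y u) := by
  have h1 : mder EM EP (fun z => g.sec z <• b) y = (mder EP EP (fun q : P => q <• b) (g.sec y)).comp
      (mder EM EP g.sec y) :=
    mder_comp (f := g.sec) (h := fun q : P => q <• b) (x := y)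
      ((hP.contMDiff_right b).mdifferentiable (by simp) _) (g.mdifferentiableAt_sec hy)
  change formAt A.form (g.sec y <• b) (mder EM EP (fun z => g.sec z <• b) y u) = _
  rw [h1]
  exact A.form_right _ _ _

omit hP in
lemma contDiffAt_pullForm {θ : (p : P) → TangentSpace 𝓘(ℝ, EP) p →L[ℝ] EG} (hθ : SmoothOneForm θ)
    {y : EM} (hy : y ∈ g.dom) : ContDiffAt ℝ ∞ (pullForm θ g.sec) y :=
  YangMills.contDiffAt_pullForm (g.contMDiffAt_sec hy) (hθ.contDiffAt_chartForm _)

/-- The curvature transforms under constant gauge transformations by the adjoint representation. -/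
lemma curvOf_translate (A : Connection EG G EP P) (b : G) {y : EM} (hy : y ∈ g.dom) (u w : EM) :
    curvOf (adL G) (fderiv ℝ (pullForm A.form (g.translate hP b).sec) y)
      (pullForm A.form (g.translate hP b).sec y) u w =
    Ad b⁻¹ (curvOf (adL G) (fderiv ℝ (pullForm A.form g.sec) y) (pullForm A.form g.sec y) u w) := by
  have h1 : pullForm A.form (g.translate hP b).sec =ᶠ[𝓝 y]
      fun z => (Ad b⁻¹ : EG →L[ℝ] EG).comp (pullForm A.form g.sec z) := by
    filter_upwards [g.isOpen.mem_nhds hy] with z hz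
    ext u
    exact g.pullForm_translate_connection hP A b hz u
  have h2 := (g.contDiffAt_pullForm A.smooth hy).differentiableAt (by simp)
  have h3 := (((ContinuousLinearMap.compL ℝ EM EG EG) (Ad b⁻¹ : EG →L[ℝ] EG)).hasFDerivAt.comp y h2.hasFDerivAt)
  have h4 : fderiv ℝ (pullForm A.form (g.translate hP b).sec) y =
      ((ContinuousLinearMap.compL ℝ EM EG EG) (Ad b⁻¹ : EG →L[ℝ] EG)).comp
        (fderiv ℝ (pullForm A.form g.sec) y) := by
    rw [h1.fderiv_eq]
    exact h3.fderiv
  simp only [curvOf_apply, h4, g.pullForm_translate_connection hP A b hy]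
  simp [Ad_adL]

end Gauge
end Gauges

/-! ### Matrix algebra -/

section MatrixAlgebra

variable {m : ℕ} {W : Type*} [AddCommGroup W] [Module ℝ W]

lemma sum_comm_pairs {f : Fin m → Fin m → Fin m → Fin m → W} :
    ∑ i, ∑ k, ∑ a, ∑ c, f i k a c = ∑ a, ∑ c, ∑ i, ∑ k, f i k a c := by
  calc ∑ i, ∑ k, ∑ a, ∑ c, f i k a c = ∑ i, ∑ a, ∑ k, ∑ c, f i k a c :=
        Finset.sum_congr rfl fun i _ => Finset.sum_comm
    _ = ∑ a, ∑ i, ∑ k, ∑ c, f i k a c := Finset.sum_comm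
    _ = ∑ a, ∑ i, ∑ c, ∑ k, f i k a c :=
        Finset.sum_congr rfl fun a _ => Finset.sum_congr rfl fun i _ => Finset.sum_comm
    _ = ∑ a, ∑ c, ∑ i, ∑ k, f i k a c := Finset.sum_congr rfl fun a _ => Finset.sum_comm

/-- The contraction of an array with a matrix does not change if both are transformed by the same
invertible matrix. -/
lemma sum_contract {C C' J : Matrix (Fin m) (Fin m) ℝ} (hC : J * C' * J.transpose = C)
    (H : Fin m → Fin m → W) :
    ∑ i, ∑ k, C' i k • (∑ a, ∑ c, (J a i * J c k) • H a c) = ∑ a, ∑ c, C a c • H a c := by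
  have h1 : ∀ a c, C a c = ∑ i, ∑ k, C' i k * (J a i * J c k) := by
    intro a c
    rw [← hC, Matrix.mul_apply, Finset.sum_comm]
    refine Finset.sum_congr rfl fun k _ => ?_
    rw [Matrix.mul_apply, Finset.sum_mul]
    refine Finset.sum_congr rfl fun i _ => ?_
    rw [Matrix.transpose_apply]
    ring
  simp only [h1, Finset.sum_smul, Finset.smul_sum, smul_smul]
  exact sum_comm_pairs

/-- The double contraction of a four-index array is independent of the frame. -/
lemma sum_contract₂ {C C' J : Matrix (Fin m) (Fin m) ℝ} (hC : J * C' * J.transpose = C)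
    (T T' : Fin m → Fin m → Fin m → Fin m → W)
    (hT : ∀ i j k l, T' i j k l =
      ∑ a, ∑ b, (J a i * J b j) • ∑ c, ∑ d, (J c k * J d l) • T a b c d) :
    ∑ i, ∑ j, ∑ k, ∑ l, (C' i k * C' j l) • T' i j k l =
      ∑ i, ∑ j, ∑ k, ∑ l, (C i k * C j l) • T i j k l := by
  have h1 : ∀ (D : Matrix (Fin m) (Fin m) ℝ) (S : Fin m → Fin m → Fin m → Fin m → W),
      ∑ i, ∑ j, ∑ k, ∑ l, (D i k * D j l) • S i j k l =
        ∑ i, ∑ k, D i k • ∑ j, ∑ l, D j l • S i j k l := by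
    intro D S
    refine Finset.sum_congr rfl fun i _ => ?_
    rw [Finset.sum_comm]
    refine Finset.sum_congr rfl fun k _ => ?_
    simp only [Finset.smul_sum, smul_smul]
  have h2 : ∀ i j k l, T' i j k l =
      ∑ a, ∑ c, (J a i * J c k) • ∑ b, ∑ d, (J b j * J d l) • T a b c d := by
    intro i j k l
    rw [hT]
    refine Finset.sum_congr rfl fun a _ => ?_
    simp only [Finset.smul_sum, smul_smul]
    rw [Finset.sum_comm]
    refine Finset.sum_congr rfl fun c _ => Finset.sum_congr rfl fun b _ =>
      Finset.sum_congr rfl fun d _ => ?_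
    congr 1
    ring
  rw [h1, h1, ← sum_contract hC]
  refine Finset.sum_congr rfl fun i _ => Finset.sum_congr rfl fun k _ => ?_
  congr 1
  calc ∑ j, ∑ l, C' j l • T' i j k l
      = ∑ j, ∑ l, ∑ a, ∑ c, (J a i * J c k) • C' j l • ∑ b, ∑ d, (J b j * J d l) • T a b c d := by
        refine Finset.sum_congr rfl fun j _ => Finset.sum_congr rfl fun l _ => ?_
        rw [h2]
        simp only [Finset.smul_sum, smul_smul]
        refine Finset.sum_congr rfl fun a _ => Finset.sum_congr rfl fun c _ =>
          Finset.sum_congr rfl fun b _ => Finset.sum_congr rfl fun d _ => ?_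
        congr 1
        ring
    _ = ∑ a, ∑ c, (J a i * J c k) • ∑ j, ∑ l, C j l • T a j c l := by
        rw [sum_comm_pairs]
        refine Finset.sum_congr rfl fun a _ => Finset.sum_congr rfl fun c _ => ?_
        rw [← sum_contract hC]
        simp only [Finset.smul_sum]

variable {O G J : Matrix (Fin m) (Fin m) ℝ}

/-- If the metric `G` is `O J` with `J² = -1`, then raising both indices of the two-form `O` by `G` gives
minus its inverse. -/
lemma inv_mul_mul_inv_of_compatible (hO : IsUnit O.det) (hG : G = O * J) (hJ : J * J = -1) :
    G⁻¹ * O * G⁻¹ = - O⁻¹ := by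
  have h1 : G⁻¹ = -(J * O⁻¹) := by
    apply Matrix.inv_eq_left_inv
    rw [hG, Matrix.neg_mul, Matrix.mul_assoc, ← Matrix.mul_assoc O⁻¹, Matrix.nonsing_inv_mul _ hO,
      Matrix.one_mul, hJ, neg_neg]
  rw [h1, Matrix.neg_mul, Matrix.mul_assoc J, Matrix.nonsing_inv_mul _ hO, Matrix.mul_one,
    Matrix.neg_mul, Matrix.mul_neg, neg_neg, ← Matrix.mul_assoc, hJ, Matrix.neg_mul, Matrix.one_mul]

/-- `det J = ± 1` if `J² = -1`, so the metric and the two-form have the same volume density. -/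
lemma det_eq_abs_det_of_compatible (hm : Even m) (hG : G = O * J) (hJ : J * J = -1)
    (hdet : 0 < G.det) : G.det = |O.det| := by
  have h1 : J.det * J.det = 1 := by
    rw [← Matrix.det_mul, hJ, Matrix.det_neg, Matrix.det_one]
    simp [hm.neg_one_pow]
  have h2 : |J.det| = 1 := by
    have := abs_mul_abs_self J.det
    nlinarith [abs_nonneg J.det]
  rw [← abs_of_pos hdet, hG, Matrix.det_mul, abs_mul, h2, mul_one]

end MatrixAlgebra

/-! ### Coordinate frames and changes of chart -/

section LocalGeometry
open Filter Topology

variable {n : ℕ} {M : Type*} [TopologicalSpace M] [ChartedSpace (Euc n) M]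
  [IsManifold 𝓘(ℝ, Euc n) ∞ M]

variable (n) in
/-- The standard basis vector of the model space. -/
abbrev stdv (i : Fin (2 * n)) : Euc n := EuclideanSpace.single i (1 : ℝ)

/-- The coordinate frame, with values in the model space. -/
def frameV (x₀ : M) (i : Fin (2 * n)) (x : M) : Euc n := frame x₀ i x

/-- The symplectic form at a point, as a bilinear form on the model space. -/
def omegaAt (Ω : SymplecticForm n M) (x : M) : Euc n →L[ℝ] Euc n →L[ℝ] ℝ := Ω.form x

/-- The metric at a point, as a bilinear form on the model space. -/
def metricAt (g : RiemMetric n M) (x : M) : Euc n →L[ℝ] Euc n →L[ℝ] ℝ := g.inner x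

/-- The matrix of the symplectic form in the coordinate frame. -/
def omegaMat (Ω : SymplecticForm n M) (x₀ x : M) : Matrix (Fin (2 * n)) (Fin (2 * n)) ℝ :=
  Matrix.of fun i j => Ω.form x (frame x₀ i x) (frame x₀ j x)

/-- The matrix of the coordinate change from the chart at `x₁` to the chart at `x₀`, at `x`. -/
def jacMat (x₀ x₁ x : M) : Matrix (Fin (2 * n)) (Fin (2 * n)) ℝ :=
  Matrix.of fun a i => (mder (Euc n) (Euc n) (extChartAt 𝓘(ℝ, Euc n) x₀) x
    (mder (Euc n) (Euc n) (extChartAt 𝓘(ℝ, Euc n) x₁).symm (extChartAt 𝓘(ℝ, Euc n) x₁ x)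
      (stdv n i))) a

lemma frameV_eq {x₀ x : M} (hx : x ∈ (chartAt (Euc n) x₀).source) (i : Fin (2 * n)) :
    frameV x₀ i x = mder (Euc n) (Euc n) (extChartAt 𝓘(ℝ, Euc n) x₀).symm
      (extChartAt 𝓘(ℝ, Euc n) x₀ x) (stdv n i) :=
  coordField_eq_mfderiv hx _

lemma sum_single_eq (u : Euc n) : u = ∑ i, u i • stdv n i := by
  have := (EuclideanSpace.basisFun (Fin (2 * n)) ℝ).sum_repr u
  simpa using this.symm

lemma mder_symm_mder_chart {x₀ x : M} (hx : x ∈ (chartAt (Euc n) x₀).source) (u : Euc n) :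
    mder (Euc n) (Euc n) (extChartAt 𝓘(ℝ, Euc n) x₀).symm (extChartAt 𝓘(ℝ, Euc n) x₀ x)
      (mder (Euc n) (Euc n) (extChartAt 𝓘(ℝ, Euc n) x₀) x u) = u := by
  have := mfderivWithin_extChartAt_symm_comp_mfderiv_extChartAt' (I := 𝓘(ℝ, Euc n)) (x := x₀) (y := x)
    (by simpa using hx)
  rw [show range 𝓘(ℝ, Euc n) = univ by simp, mfderivWithin_univ] at this
  exact congrArg (fun L : Euc n →L[ℝ] Euc n => L u) this

lemma mder_mder_symm_chart {x₀ x : M} (hx : x ∈ (chartAt (Euc n) x₀).source) (u : Euc n) :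
    mder (Euc n) (Euc n) (extChartAt 𝓘(ℝ, Euc n) x₀) x
      (mder (Euc n) (Euc n) (extChartAt 𝓘(ℝ, Euc n) x₀).symm (extChartAt 𝓘(ℝ, Euc n) x₀ x) u) = u := by
  have := mfderiv_extChartAt_comp_mfderivWithin_extChartAt_symm' (I := 𝓘(ℝ, Euc n)) (x := x₀) (y := x)
    (by simpa using hx)
  rw [show range 𝓘(ℝ, Euc n) = univ by simp, mfderivWithin_univ] at this
  exact congrArg (fun L : Euc n →L[ℝ] Euc n => L u) this

/-- A vector of the model space seen as a combination of the coordinate frame. -/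
lemma eq_sum_frame {x₀ x : M} (hx : x ∈ (chartAt (Euc n) x₀).source) (u : Euc n) :
    u = ∑ i, (mder (Euc n) (Euc n) (extChartAt 𝓘(ℝ, Euc n) x₀) x u) i • (frameV x₀ i x) := by
  conv_lhs => rw [← mder_symm_mder_chart hx u, sum_single_eq
    (mder (Euc n) (Euc n) (extChartAt 𝓘(ℝ, Euc n) x₀) x u), map_sum]
  refine Finset.sum_congr rfl fun i _ => ?_
  rw [map_smul, frameV_eq hx]

lemma frame_change {x₀ x₁ x : M} (h₀ : x ∈ (chartAt (Euc n) x₀).source)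
    (h₁ : x ∈ (chartAt (Euc n) x₁).source) (i : Fin (2 * n)) :
    frameV x₁ i x = ∑ a, jacMat (n := n) x₀ x₁ x a i • (frameV x₀ a x) := by
  refine (eq_sum_frame h₀ (frameV x₁ i x)).trans ?_
  refine Finset.sum_congr rfl fun a _ => ?_
  rw [frameV_eq h₁]
  rfl

lemma jacMat_mul {x₀ x₁ x : M} (h₀ : x ∈ (chartAt (Euc n) x₀).source)
    (h₁ : x ∈ (chartAt (Euc n) x₁).source) : jacMat (n := n) x₀ x₁ x * jacMat x₁ x₀ x = 1 := by
  ext a i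
  rw [Matrix.mul_apply]
  have h2 : (mder (Euc n) (Euc n) (extChartAt 𝓘(ℝ, Euc n) x₀) x (frameV x₀ i x)) a =
      (stdv n i) a := by
    rw [frameV_eq h₀, mder_mder_symm_chart h₀]
  have h3 : frameV x₀ i x = ∑ b, jacMat (n := n) x₁ x₀ x b i • (frameV x₁ b x) :=
    frame_change h₁ h₀ i
  rw [h3] at h2
  simp only [map_sum, map_smul] at h2
  have h4 : ∀ b, jacMat x₀ x₁ x a b =
      (mder (Euc n) (Euc n) (extChartAt 𝓘(ℝ, Euc n) x₀) x (frameV x₁ b x)) a := by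
    intro b
    rw [frameV_eq h₁]
    rfl
  rw [Matrix.one_apply]
  simp only [h4]
  have h5 : ∀ (f : Fin (2 * n) → Euc n), (∑ b, f b) a = ∑ b, f b a := by
    intro f
    simp
  rw [h5] at h2
  simp only [PiLp.smul_apply, smul_eq_mul] at h2
  simp only [mul_comm] at h2 ⊢
  rw [h2]
  simp [eq_comm]

/-- Transformation of the components of a bilinear form under a change of chart. -/
lemma bilin_frame_change {V : Type*} [NormedAddCommGroup V] [NormedSpace ℝ V] {x₀ x₁ x : M}
    (h₀ : x ∈ (chartAt (Euc n) x₀).source)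
    (h₁ : x ∈ (chartAt (Euc n) x₁).source) (L : Euc n →L[ℝ] Euc n →L[ℝ] V) (i j : Fin (2 * n)) :
    L (frameV x₁ i x) (frameV x₁ j x) = ∑ a, ∑ b, (jacMat (n := n) x₀ x₁ x a i * jacMat (n := n) x₀ x₁ x b j) •
      L (frameV x₀ a x) (frameV x₀ b x) := by
  rw [frame_change h₀ h₁ i, frame_change h₀ h₁ j]
  simp only [map_sum, map_smul, sum_apply, smul_apply, Finset.smul_sum, smul_smul]
  rw [Finset.sum_comm]
  refine Finset.sum_congr rfl fun a _ => Finset.sum_congr rfl fun b _ => ?_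
  rw [mul_comm]

/-- The components of the metric in two charts. -/
lemma gram_change (g : RiemMetric n M) {x₀ x₁ x : M} (h₀ : x ∈ (chartAt (Euc n) x₀).source)
    (h₁ : x ∈ (chartAt (Euc n) x₁).source) :
    gram g x₁ x = (jacMat x₀ x₁ x).transpose * gram g x₀ x * jacMat x₀ x₁ x := by
  ext i j
  have := bilin_frame_change h₀ h₁ (metricAt g x) i j
  refine this.trans ?_
  rw [Matrix.mul_apply, Finset.sum_comm]
  refine Finset.sum_congr rfl fun b _ => ?_
  rw [Matrix.mul_apply, Finset.sum_mul]
  refine Finset.sum_congr rfl fun a _ => ?_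
  rw [Matrix.transpose_apply, smul_eq_mul]
  change _ * gram g x₀ x a b = _
  ring

lemma gram_posDef (g : RiemMetric n M) {x₀ x : M} (hx : x ∈ (chartAt (Euc n) x₀).source) :
    (gram g x₀ x).PosDef := by
  refine Matrix.PosDef.of_dotProduct_mulVec_pos ?_ ?_
  · ext i j
    simp only [Matrix.conjTranspose_apply, gram, Matrix.of_apply, star_trivial]
    exact g.symm x _ _
  · intro v hv
    set u : Euc n := ∑ i, v i • (frameV x₀ i x) with hu
    have hu0 : u ≠ 0 := by
      intro h
      apply hv
      have h2 : ∀ i, (mder (Euc n) (Euc n) (extChartAt 𝓘(ℝ, Euc n) x₀) x) (frameV x₀ i x) = stdv n i := by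
        intro i
        rw [frameV_eq hx, mder_mder_symm_chart hx]
      have h3 := congrArg (mder (Euc n) (Euc n) (extChartAt 𝓘(ℝ, Euc n) x₀) x) h
      rw [hu, map_sum, map_zero] at h3
      simp only [map_smul, h2] at h3
      funext i
      have h4 := congrArg (fun w : Euc n => w i) h3
      simpa [Pi.single_apply] using h4
    have h1 := g.pos x u hu0
    have h2 : (metricAt g x) u u =
        star v ⬝ᵥ (gram g x₀ x).mulVec v := by
      rw [hu]
      simp only [map_sum, map_smul, sum_apply, smul_apply, dotProduct, Matrix.mulVec, star_trivial,
        Finset.mul_sum, smul_eq_mul]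
      refine Finset.sum_congr rfl fun a _ => ?_
      refine Finset.sum_congr rfl fun b _ => ?_
      have h3 : (metricAt g x) (frameV x₀ b x) (frameV x₀ a x) = gram g x₀ x a b := g.symm x _ _
      rw [h3]
      ring
    rw [← h2]
    exact h1

end LocalGeometry

/-! ### Smoothness of the components of the metric and of the symplectic form -/

section LocalGeometrySmooth
open Filter Topology

variable {n : ℕ} {M : Type*} [TopologicalSpace M] [ChartedSpace (Euc n) M]
  [IsManifold 𝓘(ℝ, Euc n) ∞ M]

lemma contMDiffOn_frame (x₀ : M) (i : Fin (2 * n)) :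
    ContMDiffOn 𝓘(ℝ, Euc n) (𝓘(ℝ, Euc n).prod 𝓘(ℝ, Euc n)) ∞
      (fun x => TotalSpace.mk' (Euc n) (E := fun x : M => TangentSpace 𝓘(ℝ, Euc n) x) x (frame x₀ i x))
      (chartAt (Euc n) x₀).source := by
  have h := (trivializationAt (Euc n) (TangentSpace 𝓘(ℝ, Euc n)) x₀).contMDiffOn_section_baseSet_iff
    (IB := 𝓘(ℝ, Euc n)) (n := ∞) (s := frame x₀ i)
  refine h.2 ?_
  refine (contMDiffOn_const (c := stdv n i)).congr ?_
  intro x hx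
  have h1 := congrArg Prod.snd
    ((trivializationAt (Euc n) (TangentSpace 𝓘(ℝ, Euc n)) x₀).apply_mk_symm hx (stdv n i))
  have h2 : frame x₀ i x =
      (trivializationAt (Euc n) (TangentSpace 𝓘(ℝ, Euc n)) x₀).symm x (stdv n i) :=
    (trivializationAt (Euc n) (TangentSpace 𝓘(ℝ, Euc n)) x₀).symmL_apply (R := ℝ) hx _
  rw [h2]
  exact h1

/-- The components of a smooth bilinear form in a chart are smooth functions of the coordinates. -/
lemma contDiffOn_bilin_frame
    {β : (x : M) → TangentSpace 𝓘(ℝ, Euc n) x →L[ℝ] TangentSpace 𝓘(ℝ, Euc n) x →L[ℝ] ℝ}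
    (hβ : ContMDiff 𝓘(ℝ, Euc n) (𝓘(ℝ, Euc n).prod 𝓘(ℝ, Euc n →L[ℝ] Euc n →L[ℝ] ℝ)) ∞
      (fun x => TotalSpace.mk' (Euc n →L[ℝ] Euc n →L[ℝ] ℝ)
        (E := fun x : M => TangentSpace 𝓘(ℝ, Euc n) x →L[ℝ] TangentSpace 𝓘(ℝ, Euc n) x →L[ℝ] ℝ)
        x (β x))) (x₀ : M) (i j : Fin (2 * n)) :
    ContDiffOn ℝ ∞ (fun y => β ((extChartAt 𝓘(ℝ, Euc n) x₀).symm y)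
      (frame x₀ i ((extChartAt 𝓘(ℝ, Euc n) x₀).symm y))
      (frame x₀ j ((extChartAt 𝓘(ℝ, Euc n) x₀).symm y))) (extChartAt 𝓘(ℝ, Euc n) x₀).target := by
  have h1 : ContMDiffOn 𝓘(ℝ, Euc n) 𝓘(ℝ) ∞ (fun x => β x (frame x₀ i x) (frame x₀ j x))
      (chartAt (Euc n) x₀).source := by
    have : ContMDiffOn 𝓘(ℝ, Euc n) (𝓘(ℝ, Euc n).prod 𝓘(ℝ)) ∞
        (fun m ↦ TotalSpace.mk' ℝ (E := Bundle.Trivial M ℝ) m (β m (frame x₀ i m) (frame x₀ j m)))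
        (chartAt (Euc n) x₀).source := by
      apply ContMDiffOn.clm_bundle_apply₂ (F₁ := Euc n) (F₂ := Euc n)
      · exact hβ.contMDiffOn
      · exact contMDiffOn_frame x₀ i
      · exact contMDiffOn_frame x₀ j
    intro x hx
    have h := this x hx
    simp only [contMDiffWithinAt_totalSpace] at h
    exact h.2
  rw [← contMDiffOn_iff_contDiffOn]
  refine h1.comp (contMDiffOn_extChartAt_symm x₀) ?_
  intro y hy
  simpa using (extChartAt 𝓘(ℝ, Euc n) x₀).map_target hy

lemma contDiffOn_gram (g : RiemMetric n M) (x₀ : M) (i j : Fin (2 * n)) :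
    ContDiffOn ℝ ∞ (fun y => gram g x₀ ((extChartAt 𝓘(ℝ, Euc n) x₀).symm y) i j)
      (extChartAt 𝓘(ℝ, Euc n) x₀).target :=
  contDiffOn_bilin_frame g.contMDiff x₀ i j

lemma contDiffOn_omegaMat (Ω : SymplecticForm n M) (x₀ : M) (i j : Fin (2 * n)) :
    ContDiffOn ℝ ∞ (fun y => omegaMat Ω x₀ ((extChartAt 𝓘(ℝ, Euc n) x₀).symm y) i j)
      (extChartAt 𝓘(ℝ, Euc n) x₀).target :=
  contDiffOn_bilin_frame Ω.smooth x₀ i j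

lemma contDiffOn_det {m : ℕ} {E : Type*} [NormedAddCommGroup E] [NormedSpace ℝ E] {s : Set E}
    {A : E → Matrix (Fin m) (Fin m) ℝ} (hA : ∀ i j, ContDiffOn ℝ ∞ (fun y => A y i j) s) :
    ContDiffOn ℝ ∞ (fun y => (A y).det) s := by
  simp only [Matrix.det_apply]
  refine ContDiffOn.sum fun σ _ => ?_
  refine ContDiffOn.const_smul _ (contDiffOn_prod fun i _ => hA _ _)

lemma contDiffOn_inv_entry {m : ℕ} {E : Type*} [NormedAddCommGroup E] [NormedSpace ℝ E] {s : Set E}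
    {A : E → Matrix (Fin m) (Fin m) ℝ} (hA : ∀ i j, ContDiffOn ℝ ∞ (fun y => A y i j) s)
    (hdet : ∀ y ∈ s, (A y).det ≠ 0) (i j : Fin m) :
    ContDiffOn ℝ ∞ (fun y => (A y)⁻¹ i j) s := by
  have h1 : ∀ y, (A y)⁻¹ i j = ((A y).det)⁻¹ * ((A y).updateRow j (Pi.single i 1)).det := by
    intro y
    rw [Matrix.inv_def, Matrix.smul_apply, Matrix.adjugate_apply, Ring.inverse_eq_inv', smul_eq_mul]
  simp only [h1]
  refine ((contDiffOn_det hA).inv hdet).mul (contDiffOn_det fun k l => ?_)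
  by_cases hk : k = j
  · subst hk
    simp only [Matrix.updateRow_self]
    exact contDiffOn_const
  · simp only [Matrix.updateRow_ne hk]
    exact hA k l

lemma gram_det_pos (g : RiemMetric n M) {x₀ x : M} (hx : x ∈ (chartAt (Euc n) x₀).source) :
    0 < (gram g x₀ x).det := (gram_posDef g hx).det_pos

lemma density_pos (g : RiemMetric n M) {x₀ x : M} (hx : x ∈ (chartAt (Euc n) x₀).source) :
    0 < density g x₀ x := Real.sqrt_pos.2 (gram_det_pos g hx)

lemma mem_source_of_mem_target {x₀ : M} {y : Euc n} (hy : y ∈ (extChartAt 𝓘(ℝ, Euc n) x₀).target) :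
    (extChartAt 𝓘(ℝ, Euc n) x₀).symm y ∈ (chartAt (Euc n) x₀).source := by
  simpa using (extChartAt 𝓘(ℝ, Euc n) x₀).map_target hy

lemma contDiffOn_gram_inv (g : RiemMetric n M) (x₀ : M) (i j : Fin (2 * n)) :
    ContDiffOn ℝ ∞ (fun y => (gram g x₀ ((extChartAt 𝓘(ℝ, Euc n) x₀).symm y))⁻¹ i j)
      (extChartAt 𝓘(ℝ, Euc n) x₀).target :=
  contDiffOn_inv_entry (contDiffOn_gram g x₀)
    (fun _ hy => (gram_det_pos g (mem_source_of_mem_target hy)).ne') i j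

lemma contDiffOn_density (g : RiemMetric n M) (x₀ : M) :
    ContDiffOn ℝ ∞ (fun y => density g x₀ ((extChartAt 𝓘(ℝ, Euc n) x₀).symm y))
      (extChartAt 𝓘(ℝ, Euc n) x₀).target :=
  (contDiffOn_det (contDiffOn_gram g x₀)).sqrt
    fun _ hy => (gram_det_pos g (mem_source_of_mem_target hy)).ne'

/-! ### Compatibility of the metric, in a coordinate frame -/

/-- The compatible almost complex structure as a matrix `J` in the coordinate frame. -/
lemma gram_eq_omegaMat_mul {Ω : SymplecticForm n M} {g : RiemMetric n M} (hg : Compatible Ω g)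
    {x₀ x : M} (hx : x ∈ (chartAt (Euc n) x₀).source) :
    ∃ J : Matrix (Fin (2 * n)) (Fin (2 * n)) ℝ, J * J = -1 ∧ gram g x₀ x = omegaMat Ω x₀ x * J := by
  obtain ⟨J, hJ, hgJ⟩ := hg x
  let J' : Euc n →ₗ[ℝ] Euc n := J
  have hJ' : ∀ v, J' (J' v) = -v := hJ
  have hgJ' : ∀ u v, metricAt g x u v = omegaAt Ω x u (J' v) := hgJ
  let D := mder (Euc n) (Euc n) (extChartAt 𝓘(ℝ, Euc n) x₀) x
  have hD : ∀ i, D (frameV x₀ i x) = stdv n i := by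
    intro i
    rw [frameV_eq hx]
    exact mder_mder_symm_chart hx _
  have hsum : ∀ u : Euc n, u = ∑ i, D u i • frameV x₀ i x := fun u => eq_sum_frame hx u
  refine ⟨Matrix.of fun k j => D (J' (frameV x₀ j x)) k, ?_, ?_⟩
  · ext k j
    rw [Matrix.mul_apply]
    simp only [Matrix.of_apply]
    have h1 : D (J' (J' (frameV x₀ j x))) k = -(stdv n j) k := by
      rw [hJ', map_neg, hD]; rfl
    rw [hsum (J' (frameV x₀ j x))] at h1
    simp only [map_sum, map_smul] at h1
    have h5 : ∀ (f : Fin (2 * n) → Euc n), (∑ b, f b) k = ∑ b, f b k := by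
      intro f
      simp
    rw [h5] at h1
    simp only [PiLp.smul_apply, smul_eq_mul] at h1
    simp only [mul_comm] at h1 ⊢
    rw [h1]
    simp [Matrix.one_apply, eq_comm, Pi.single_apply]
  · ext i j
    rw [Matrix.mul_apply]
    have h1 := hgJ' (frameV x₀ i x) (frameV x₀ j x)
    rw [hsum (J' (frameV x₀ j x))] at h1
    simp only [map_sum, map_smul, smul_eq_mul] at h1
    refine h1.trans ?_
    refine Finset.sum_congr rfl fun k _ => ?_
    rw [mul_comm]
    rfl

lemma omegaMat_isUnit_det {Ω : SymplecticForm n M} {g : RiemMetric n M} (hg : Compatible Ω g)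
    {x₀ x : M} (hx : x ∈ (chartAt (Euc n) x₀).source) : IsUnit (omegaMat Ω x₀ x).det := by
  obtain ⟨J, -, h⟩ := gram_eq_omegaMat_mul hg hx
  have h1 := gram_det_pos g hx
  rw [h, Matrix.det_mul] at h1
  exact isUnit_iff_ne_zero.2 fun h0 => by simp [h0] at h1

/-- Raising both indices of the symplectic form gives minus the inverse of its matrix. -/
lemma gram_inv_mul_omegaMat_mul {Ω : SymplecticForm n M} {g : RiemMetric n M} (hg : Compatible Ω g)
    {x₀ x : M} (hx : x ∈ (chartAt (Euc n) x₀).source) :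
    (gram g x₀ x)⁻¹ * omegaMat Ω x₀ x * (gram g x₀ x)⁻¹ = -(omegaMat Ω x₀ x)⁻¹ := by
  obtain ⟨J, hJ, h⟩ := gram_eq_omegaMat_mul hg hx
  exact inv_mul_mul_inv_of_compatible (omegaMat_isUnit_det hg hx) h hJ

/-- The Riemannian density is the Liouville density. -/
lemma density_eq_sqrt_abs_det {Ω : SymplecticForm n M} {g : RiemMetric n M} (hg : Compatible Ω g)
    {x₀ x : M} (hx : x ∈ (chartAt (Euc n) x₀).source) :
    density g x₀ x = Real.sqrt |(omegaMat Ω x₀ x).det| := by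
  obtain ⟨J, hJ, h⟩ := gram_eq_omegaMat_mul hg hx
  rw [density, det_eq_abs_det_of_compatible (even_two_mul n) h hJ (gram_det_pos g hx)]

lemma omegaMat_antisymm (Ω : SymplecticForm n M) (x₀ x : M) (i j : Fin (2 * n)) :
    omegaMat Ω x₀ x i j = -omegaMat Ω x₀ x j i := by
  have h : ∀ v, omegaAt Ω x v v = 0 := Ω.alt x
  have h1 := h (frameV x₀ i x + frameV x₀ j x)
  simp only [map_add, add_apply, h, zero_add, add_zero] at h1
  have h2 : omegaAt Ω x (frameV x₀ i x) (frameV x₀ j x) =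
      -omegaAt Ω x (frameV x₀ j x) (frameV x₀ i x) := by linarith
  exact h2

lemma omegaMat_transpose (Ω : SymplecticForm n M) (x₀ x : M) :
    (omegaMat Ω x₀ x).transpose = -omegaMat Ω x₀ x := by
  ext i j
  rw [Matrix.transpose_apply, Matrix.neg_apply, omegaMat_antisymm]

lemma inv_neg_matrix {m : ℕ} (A : Matrix (Fin m) (Fin m) ℝ) : (-A)⁻¹ = -A⁻¹ := by
  by_cases h : IsUnit A.det
  · apply Matrix.inv_eq_left_inv
    rw [neg_mul_neg, Matrix.nonsing_inv_mul _ h]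
  · rw [Matrix.nonsing_inv_apply_not_isUnit _ h, Matrix.nonsing_inv_apply_not_isUnit, neg_zero]
    rw [Matrix.det_neg]
    simpa using h

lemma omegaMat_inv_antisymm (Ω : SymplecticForm n M) (x₀ x : M) (i j : Fin (2 * n)) :
    (omegaMat Ω x₀ x)⁻¹ i j = -(omegaMat Ω x₀ x)⁻¹ j i := by
  have h := Matrix.transpose_nonsing_inv (omegaMat Ω x₀ x)
  rw [omegaMat_transpose, inv_neg_matrix] at h
  have := congrFun (congrFun h j) i
  simpa using this

lemma gram_symm (g : RiemMetric n M) (x₀ x : M) (i j : Fin (2 * n)) :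
    gram g x₀ x i j = gram g x₀ x j i := g.symm x _ _

lemma gram_inv_symm (g : RiemMetric n M) (x₀ x : M) (i j : Fin (2 * n)) :
    (gram g x₀ x)⁻¹ i j = (gram g x₀ x)⁻¹ j i := by
  have h := Matrix.transpose_nonsing_inv (gram g x₀ x)
  rw [show (gram g x₀ x).transpose = gram g x₀ x by ext i j; exact gram_symm g x₀ x j i] at h
  exact congrFun (congrFun h j) i

/-- The transformation of the inverse metric under a change of chart. -/
lemma jacMat_mul_gram_inv (g : RiemMetric n M) {x₀ x₁ x : M} (h₀ : x ∈ (chartAt (Euc n) x₀).source)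
    (h₁ : x ∈ (chartAt (Euc n) x₁).source) :
    jacMat x₀ x₁ x * (gram g x₁ x)⁻¹ * (jacMat (n := n) x₀ x₁ x).transpose = (gram g x₀ x)⁻¹ := by
  have h01 := jacMat_mul (n := n) h₀ h₁
  have h10 := jacMat_mul (n := n) h₁ h₀
  have hu := (gram_det_pos g h₀).ne'.isUnit
  have h2 : (gram g x₁ x)⁻¹ = jacMat x₁ x₀ x * (gram g x₀ x)⁻¹ * (jacMat (n := n) x₁ x₀ x).transpose := by
    apply Matrix.inv_eq_left_inv
    rw [gram_change g h₀ h₁]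
    calc jacMat x₁ x₀ x * (gram g x₀ x)⁻¹ * (jacMat (n := n) x₁ x₀ x).transpose *
          ((jacMat (n := n) x₀ x₁ x).transpose * gram g x₀ x * jacMat x₀ x₁ x)
        = jacMat x₁ x₀ x * (gram g x₀ x)⁻¹ * ((jacMat (n := n) x₀ x₁ x) * (jacMat (n := n) x₁ x₀ x)).transpose *
            gram g x₀ x * jacMat x₀ x₁ x := by
          rw [Matrix.transpose_mul]; simp only [Matrix.mul_assoc]
      _ = 1 := by
          rw [h01, Matrix.transpose_one, Matrix.mul_one, Matrix.mul_assoc (jacMat x₁ x₀ x),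
            Matrix.nonsing_inv_mul _ hu, Matrix.mul_one, h10]
  rw [h2]
  calc jacMat x₀ x₁ x * (jacMat x₁ x₀ x * (gram g x₀ x)⁻¹ * (jacMat (n := n) x₁ x₀ x).transpose) *
        (jacMat (n := n) x₀ x₁ x).transpose
      = (jacMat x₀ x₁ x * jacMat x₁ x₀ x) * (gram g x₀ x)⁻¹ * ((jacMat (n := n) x₀ x₁ x) * (jacMat (n := n) x₁ x₀ x)).transpose := by
        rw [Matrix.transpose_mul]; simp only [Matrix.mul_assoc]
    _ = _ := by rw [h01, Matrix.transpose_one, Matrix.mul_one, Matrix.one_mul]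

end LocalGeometrySmooth

/-! ### Components of the curvature -/

section Components
open Filter Topology

variable {n : ℕ} {M : Type*} [TopologicalSpace M] [ChartedSpace (Euc n) M]
  [IsManifold 𝓘(ℝ, Euc n) ∞ M]
  {EG : Type*} [NormedAddCommGroup EG] [NormedSpace ℝ EG]
  {G : Type*} [TopologicalSpace G] [ChartedSpace EG G] [Group G] [LieGroup 𝓘(ℝ, EG) ∞ G]
  {EP : Type*} [NormedAddCommGroup EP] [NormedSpace ℝ EP]
  {P : Type*} [TopologicalSpace P] [ChartedSpace EP P] [IsManifold 𝓘(ℝ, EP) ∞ P] [MulAction Gᵐᵒᵖ P]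
  {pr : P → M} (hP : IsPrincipalBundle (Euc n) EG G EP pr)

/-- The curvature of the local connection form of a gauge. -/
def Gauge.curv {x₀ : M} (γ : Gauge (Euc n) EG G EP pr x₀)
    (θ : (p : P) → TangentSpace 𝓘(ℝ, EP) p →L[ℝ] EG) (y : Euc n) : Euc n →L[ℝ] Euc n →L[ℝ] EG :=
  curvOf (adL G) (fderiv ℝ (pullForm θ γ.sec) y) (pullForm θ γ.sec y)

lemma Gauge.frame_sec {x₀ : M} (γ : Gauge (Euc n) EG G EP pr x₀) {y : Euc n} (hy : y ∈ γ.dom)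
    (i : Fin (2 * n)) : frameV x₀ i (pr (γ.sec y)) =
      mder (Euc n) (Euc n) (extChartAt 𝓘(ℝ, Euc n) x₀).symm y (stdv n i) := by
  rw [frameV_eq (γ.mem_source hy), γ.coord_proj_sec hy]

include hP

/-- The components of the curvature along the section are those of the local connection form. -/
lemma Gauge.formComp_curvature {x₀ : M} (γ : Gauge (Euc n) EG G EP pr x₀) (A : Connection EG G EP P)
    {y : Euc n} (hy : y ∈ γ.dom) (i j : Fin (2 * n)) :
    formComp pr A.form x₀ (curvature G A.form) (γ.sec y) i j =
      γ.curv A.form y (stdv n i) (stdv n j) := by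
  refine (congrArg₂ (fun a b : Euc n => curvature G A.form (γ.sec y)
    (horLift (Euc n) pr A.form (γ.sec y) a) (horLift (Euc n) pr A.form (γ.sec y) b))
    (γ.frame_sec hy i) (γ.frame_sec hy j)).trans ?_
  exact γ.curvature_horLift hP A hy _ _

/-- The components of the curvature are equivariant. -/
lemma formComp_curvature_right (A : Connection EG G EP P) {x₀ : M} {p : P}
    (hp : pr p ∈ (chartAt (Euc n) x₀).source) (b : G) (i j : Fin (2 * n)) :
    formComp pr A.form x₀ (curvature G A.form) (p <• b) i j =
      Ad b⁻¹ (formComp pr A.form x₀ (curvature G A.form) p i j) := by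
  obtain ⟨γ, hy, hγ⟩ := hP.exists_gauge x₀ p hp
  have h1 := (γ.translate hP b).formComp_curvature hP A hy i j
  have h2 := γ.formComp_curvature hP A hy i j
  have h3 : (γ.translate hP b).sec (extChartAt 𝓘(ℝ, Euc n) x₀ (pr p)) = p <• b :=
    congrArg (fun q => q <• b) hγ
  rw [h3] at h1
  rw [hγ] at h2
  rw [h1, h2]
  exact γ.curvOf_translate hP A b hy _ _

omit hP in
variable (pr) in
/-- The curvature as a bilinear form on the tangent space of the base. -/
lemma exists_formComp_eq (A : Connection EG G EP P) (p : P) :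
    ∃ L : Euc n →L[ℝ] Euc n →L[ℝ] EG, ∀ (x₀ : M) (i j : Fin (2 * n)),
      formComp pr A.form x₀ (curvature G A.form) p i j =
        L (frameV x₀ i (pr p)) (frameV x₀ j (pr p)) := by
  let H : Euc n →L[ℝ] EP := (((mder EP (Euc n) pr p).prod (formAt A.form p)).inverse).comp
    (ContinuousLinearMap.inl ℝ (Euc n) EG)
  exact ⟨(curvatureL A p).bilinearComp H H, fun x₀ i j => curvature_eq A p _ _⟩

lemma mder_proj_horLift (A : Connection EG G EP P) (p : P) (u : Euc n) :
    mder EP (Euc n) pr p (horLift (Euc n) pr A.form p u) = u := by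
  obtain ⟨γ, hy, hγ⟩ := hP.exists_gauge (pr p) p (mem_chart_source _ _)
  set y := extChartAt 𝓘(ℝ, Euc n) (pr p) (pr p)
  have h1 := γ.horLift_eq hP A hy (mder (Euc n) (Euc n) (extChartAt 𝓘(ℝ, Euc n) (pr p)) (pr (γ.sec y)) u)
  have h3 := (congrArg (fun a : Euc n => (horLift (Euc n) pr A.form (γ.sec y) a : EP))
    (γ.mder_symm_mder hP hy u)).symm.trans h1
  have h2 : mder EP (Euc n) pr (γ.sec y) (horLift (Euc n) pr A.form (γ.sec y) u) = u := by
    refine (congrArg (mder EP (Euc n) pr (γ.sec y)) h3).trans ?_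
    rw [map_sub, γ.mder_proj_dsec hP hy, hP.mder_proj_fund, sub_zero, γ.mder_symm_mder hP hy]
  rw [hγ] at h2
  exact h2

omit hP in
/-- The change of chart for the coefficients of the curvature: double contractions of the curvature
with the inverse metric do not depend on the chart. -/
lemma contract_change {W : Type*} [AddCommGroup W] [Module ℝ W] (g : RiemMetric n M) {x₀ x₁ x : M}
    (h₀ : x ∈ (chartAt (Euc n) x₀).source) (h₁ : x ∈ (chartAt (Euc n) x₁).source)
    {V₁ V₂ : Type*} [NormedAddCommGroup V₁] [NormedSpace ℝ V₁] [NormedAddCommGroup V₂]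
    [NormedSpace ℝ V₂] (β : V₁ →ₗ[ℝ] V₂ →ₗ[ℝ] W) (L₁ : Euc n →L[ℝ] Euc n →L[ℝ] V₁)
    (L₂ : Euc n →L[ℝ] Euc n →L[ℝ] V₂) :
    ∑ i, ∑ j, ∑ k, ∑ l, ((gram g x₁ x)⁻¹ i k * (gram g x₁ x)⁻¹ j l) •
      β (L₁ (frameV x₁ i x) (frameV x₁ j x)) (L₂ (frameV x₁ k x) (frameV x₁ l x)) =
    ∑ i, ∑ j, ∑ k, ∑ l, ((gram g x₀ x)⁻¹ i k * (gram g x₀ x)⁻¹ j l) •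
      β (L₁ (frameV x₀ i x) (frameV x₀ j x)) (L₂ (frameV x₀ k x) (frameV x₀ l x)) := by
  refine sum_contract₂ (jacMat_mul_gram_inv g h₀ h₁) _ _ fun i j k l => ?_
  rw [bilin_frame_change h₀ h₁ L₁, bilin_frame_change h₀ h₁ L₂]
  simp only [map_sum, map_smul, LinearMap.sum_apply, LinearMap.smul_apply, Finset.smul_sum]
  rw [sum_comm_pairs]
  refine Finset.sum_congr rfl fun a _ => Finset.sum_congr rfl fun b _ =>
    Finset.sum_congr rfl fun c _ => Finset.sum_congr rfl fun d _ => smul_comm _ _ _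

end Components

/-! ### The densities of the three functionals -/

section Densities
open Filter Topology

variable {n : ℕ} {M : Type*} [TopologicalSpace M] [ChartedSpace (Euc n) M]
  [IsManifold 𝓘(ℝ, Euc n) ∞ M]
  {EG : Type*} [NormedAddCommGroup EG] [NormedSpace ℝ EG]
  {G : Type*} [TopologicalSpace G] [ChartedSpace EG G] [Group G] [LieGroup 𝓘(ℝ, EG) ∞ G]
  {EP : Type*} [NormedAddCommGroup EP] [NormedSpace ℝ EP]
  {P : Type*} [TopologicalSpace P] [ChartedSpace EP P] [IsManifold 𝓘(ℝ, EP) ∞ P] [MulAction Gᵐᵒᵖ P]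
  {pr : P → M} (hP : IsPrincipalBundle (Euc n) EG G EP pr)

/-- The coefficients `g^{ik} g^{jl}` of the squared norm of the curvature. -/
def coeffF (g : RiemMetric n M) (x₀ x : M) (i j k l : Fin (2 * n)) : ℝ :=
  (gram g x₀ x)⁻¹ i k * (gram g x₀ x)⁻¹ j l

/-- The coefficients of the squared norm of `Φ ω`; the bivector dual to `ω` has the components of
minus the inverse of the matrix of `ω`. -/
def coeffPhi (Ω : SymplecticForm n M) (x₀ x : M) (i j k l : Fin (2 * n)) : ℝ :=
  1 / (2 * (n : ℝ)) * ((omegaMat Ω x₀ x)⁻¹ i j * (omegaMat Ω x₀ x)⁻¹ k l)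

/-- The quadratic form `½ N^{ijkl} ⟨F_{ij}, F_{kl}⟩`. -/
def quad (B : AdInvariantInner EG G) (N : Fin (2 * n) → Fin (2 * n) → Fin (2 * n) → Fin (2 * n) → ℝ)
    (F : Fin (2 * n) → Fin (2 * n) → EG) : ℝ :=
  1 / 2 * ∑ i, ∑ j, B.inner (F i j) (∑ k, ∑ l, N i j k l • F k l)

lemma quad_eq (B : AdInvariantInner EG G) (N : Fin (2 * n) → Fin (2 * n) → Fin (2 * n) → Fin (2 * n) → ℝ)
    (F : Fin (2 * n) → Fin (2 * n) → EG) :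
    quad B N F = 1 / 2 * ∑ i, ∑ j, ∑ k, ∑ l, N i j k l • B.inner (F i j) (F k l) := by
  simp only [quad, map_sum, map_smul]

lemma quad_sub (B : AdInvariantInner EG G) (N N' : Fin (2 * n) → Fin (2 * n) → Fin (2 * n) → Fin (2 * n) → ℝ)
    (F : Fin (2 * n) → Fin (2 * n) → EG) :
    quad B (N - N') F = quad B N F - quad B N' F := by
  simp only [quad_eq, Pi.sub_apply, sub_smul, Finset.sum_sub_distrib, mul_sub]

/-- The algebraic bilinear form underlying the inner product of the Lie algebra. -/
def AdInvariantInner.bil (B : AdInvariantInner EG G) : EG →ₗ[ℝ] EG →ₗ[ℝ] ℝ :=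
  LinearMap.mk₂ ℝ (fun a b => B.inner a b) (by simp) (by simp) (by simp) (by simp)

/-- The norm of the curvature is computed in the chart at the point itself by definition, but it has the
same expression in every chart. -/
lemma normSq_curvature (g : RiemMetric n M) (B : AdInvariantInner EG G) (A : Connection EG G EP P)
    {x₀ : M} {p : P} (hp : pr p ∈ (chartAt (Euc n) x₀).source) :
    normSq pr g B A.form (curvature G A.form) p =
      quad B (coeffF g x₀ (pr p)) (formComp pr A.form x₀ (curvature G A.form) p) := by
  obtain ⟨L, hL⟩ := exists_formComp_eq (n := n) pr A p
  have h := contract_change g hp (mem_chart_source (Euc n) (pr p)) B.bil L L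
  rw [quad_eq]
  simp only [normSq, compUp, hL, map_sum, map_smul]
  exact congrArg (fun r => 1 / 2 * r) h

/-- The coefficient `Φ` in an arbitrary chart, as the contraction of the curvature with the inverse of
the matrix of the symplectic form. -/
lemma PhiOf_eq {Ω : SymplecticForm n M} {g : RiemMetric n M} (hg : Compatible Ω g)
    (A : Connection EG G EP P)
    {x₀ : M} {p : P} (hp : pr p ∈ (chartAt (Euc n) x₀).source) :
    PhiOf G pr Ω g A.form p = -(1 / (2 * (n : ℝ))) • ∑ k, ∑ l,
      (omegaMat Ω x₀ (pr p))⁻¹ k l • formComp pr A.form x₀ (curvature G A.form) p k l := by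
  obtain ⟨L, hL⟩ := exists_formComp_eq (n := n) pr A p
  have h := contract_change g hp (mem_chart_source (Euc n) (pr p)) (LinearMap.lsmul ℝ EG)
    (omegaAt Ω (pr p)) L
  have h1 : ∑ i, ∑ j, Ω.form (pr p) (frame (pr p) i (pr p)) (frame (pr p) j (pr p)) •
      compUp pr g A.form (pr p) (curvature G A.form) p i j = ∑ i, ∑ j, ∑ k, ∑ l,
      ((gram g x₀ (pr p))⁻¹ i k * (gram g x₀ (pr p))⁻¹ j l) •
      (omegaMat Ω x₀ (pr p) i j • formComp pr A.form x₀ (curvature G A.form) p k l) := by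
    simp only [hL]
    refine Eq.trans ?_ h
    refine Finset.sum_congr rfl fun i _ => Finset.sum_congr rfl fun j _ => ?_
    simp only [compUp, Finset.smul_sum, hL]
    refine Finset.sum_congr rfl fun k _ => Finset.sum_congr rfl fun l _ => ?_
    exact smul_comm _ _ _
  have h2 : ∀ k l, ∑ i, ∑ j, (gram g x₀ (pr p))⁻¹ i k * (gram g x₀ (pr p))⁻¹ j l *
      omegaMat Ω x₀ (pr p) i j = -(omegaMat Ω x₀ (pr p))⁻¹ k l := by
    intro k l
    rw [← Matrix.neg_apply, ← gram_inv_mul_omegaMat_mul hg hp, Matrix.mul_apply, Finset.sum_comm]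
    refine Finset.sum_congr rfl fun j _ => ?_
    rw [Matrix.mul_apply, Finset.sum_mul]
    refine Finset.sum_congr rfl fun i _ => ?_
    rw [gram_inv_symm g x₀ _ i k]
    ring
  unfold PhiOf
  rw [h1, sum_comm_pairs]
  simp only [smul_smul, ← Finset.sum_smul, h2, neg_smul, Finset.sum_neg_distrib, smul_neg]
  congr 2
  ring

include hP in
lemma formComp_PhiOmega (Ω : SymplecticForm n M) (g : RiemMetric n M) (A : Connection EG G EP P)
    (x₀ : M) (p : P) (i j : Fin (2 * n)) :
    formComp pr A.form x₀ (PhiOmega G pr Ω g A.form) p i j =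
      omegaMat Ω x₀ (pr p) i j • PhiOf G pr Ω g A.form p :=
  congrArg₂ (fun a b : Euc n => omegaAt Ω (pr p) a b • PhiOf G pr Ω g A.form p)
    (mder_proj_horLift hP A p (frameV x₀ i (pr p))) (mder_proj_horLift hP A p (frameV x₀ j (pr p)))

include hP in
lemma compUp_PhiOmega {Ω : SymplecticForm n M} {g : RiemMetric n M} (hg : Compatible Ω g)
    (A : Connection EG G EP P) {x₀ : M} {p : P} (hp : pr p ∈ (chartAt (Euc n) x₀).source)
    (i j : Fin (2 * n)) :
    compUp pr g A.form x₀ (PhiOmega G pr Ω g A.form) p i j =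
      -(omegaMat Ω x₀ (pr p))⁻¹ i j • PhiOf G pr Ω g A.form p := by
  simp only [compUp, formComp_PhiOmega hP, smul_smul, ← Finset.sum_smul]
  congr 1
  rw [← Matrix.neg_apply, ← gram_inv_mul_omegaMat_mul hg hp, Matrix.mul_apply, Finset.sum_comm]
  refine Finset.sum_congr rfl fun l _ => ?_
  rw [Matrix.mul_apply, Finset.sum_mul]
  refine Finset.sum_congr rfl fun k _ => ?_
  rw [gram_inv_symm g x₀ _ j l]
  ring

include hP in
lemma compUp_primitivePart {Ω : SymplecticForm n M} {g : RiemMetric n M}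
    (A : Connection EG G EP P) {x₀ : M} {p : P}
    (i j : Fin (2 * n)) :
    compUp pr g A.form x₀ (primitivePart G pr Ω g A.form) p i j =
      compUp pr g A.form x₀ (curvature G A.form) p i j -
        compUp pr g A.form x₀ (PhiOmega G pr Ω g A.form) p i j := by
  have h : ∀ k l : Fin (2 * n), formComp pr A.form x₀ (primitivePart G pr Ω g A.form) p k l =
      formComp pr A.form x₀ (curvature G A.form) p k l -
        formComp pr A.form x₀ (PhiOmega G pr Ω g A.form) p k l := fun _ _ => rfl
  simp only [compUp, h, smul_sub, Finset.sum_sub_distrib]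

lemma sum_coeffPhi {Ω : SymplecticForm n M} {g : RiemMetric n M} (hg : Compatible Ω g)
    (A : Connection EG G EP P) {x₀ : M} {p : P} (hp : pr p ∈ (chartAt (Euc n) x₀).source)
    (i j : Fin (2 * n)) :
    ∑ k, ∑ l, coeffPhi Ω x₀ (pr p) i j k l • formComp pr A.form x₀ (curvature G A.form) p k l =
      -(omegaMat Ω x₀ (pr p))⁻¹ i j • PhiOf G pr Ω g A.form p := by
  rw [PhiOf_eq hg A hp]
  simp only [coeffPhi, Finset.smul_sum, smul_smul]
  refine Finset.sum_congr rfl fun k _ => Finset.sum_congr rfl fun l _ => ?_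
  congr 1
  ring

lemma sum_omega_inv (hn : n ≠ 0) {Ω : SymplecticForm n M} {g : RiemMetric n M} (hg : Compatible Ω g)
    (A : Connection EG G EP P) {x₀ : M} {p : P} (hp : pr p ∈ (chartAt (Euc n) x₀).source) :
    ∑ k, ∑ l, (omegaMat Ω x₀ (pr p))⁻¹ k l • formComp pr A.form x₀ (curvature G A.form) p k l =
      -(2 * (n : ℝ)) • PhiOf G pr Ω g A.form p := by
  have hn' : (n : ℝ) ≠ 0 := Nat.cast_ne_zero.2 hn
  rw [PhiOf_eq hg A hp, smul_smul]
  have : -(2 * (n : ℝ)) * -(1 / (2 * (n : ℝ))) = 1 := by field_simp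
  rw [this, one_smul]

/-- The form `quad` with the coefficients `coeffPhi` is `n |Φ|²`, which is the squared norm of `Φ ω` by
`normSq_PhiOmega`. -/
lemma quad_coeffPhi (hn : n ≠ 0) {Ω : SymplecticForm n M} {g : RiemMetric n M} (hg : Compatible Ω g)
    (B : AdInvariantInner EG G)
    (A : Connection EG G EP P) {x₀ : M} {p : P} (hp : pr p ∈ (chartAt (Euc n) x₀).source) :
    quad B (coeffPhi Ω x₀ (pr p)) (formComp pr A.form x₀ (curvature G A.form) p) =
      n * B.inner (PhiOf G pr Ω g A.form p) (PhiOf G pr Ω g A.form p) := by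
  simp only [quad, sum_coeffPhi hg A hp, map_smul, smul_eq_mul]
  have h := congrArg (fun a => B.inner a (PhiOf G pr Ω g A.form p)) (sum_omega_inv hn hg A hp)
  simp only [map_sum, map_smul, sum_apply, smul_apply, smul_eq_mul] at h
  simp only [neg_mul, Finset.sum_neg_distrib, h]
  ring

/-- The contraction of the symplectic form with its inverse: the origin of the factor `n` in
`|Φ ω|² = n |Φ|²`. -/
lemma sum_omega_mul_inv {Ω : SymplecticForm n M} {g : RiemMetric n M} (hg : Compatible Ω g)
    {x₀ x : M} (hx : x ∈ (chartAt (Euc n) x₀).source) :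
    ∑ i, ∑ j, omegaMat Ω x₀ x i j * (omegaMat Ω x₀ x)⁻¹ i j = -(2 * (n : ℝ)) := by
  have h1 := congrArg Matrix.trace (Matrix.mul_nonsing_inv _ (omegaMat_isUnit_det (x₀ := x₀) hg hx))
  rw [Matrix.trace_one] at h1
  simp only [Matrix.trace, Matrix.diag, Matrix.mul_apply] at h1
  have h2 : ∀ i j, omegaMat Ω x₀ x i j * (omegaMat Ω x₀ x)⁻¹ i j =
      -(omegaMat Ω x₀ x i j * (omegaMat Ω x₀ x)⁻¹ j i) := by
    intro i j
    rw [omegaMat_inv_antisymm Ω x₀ x i j]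
    ring
  simp only [h2, Finset.sum_neg_distrib, h1]
  simp

include hP in
lemma normSq_PhiOmega {Ω : SymplecticForm n M} {g : RiemMetric n M} (hg : Compatible Ω g)
    (B : AdInvariantInner EG G) (A : Connection EG G EP P) (p : P) :
    normSq pr g B A.form (PhiOmega G pr Ω g A.form) p =
      n * B.inner (PhiOf G pr Ω g A.form p) (PhiOf G pr Ω g A.form p) := by
  have hp := mem_chart_source (Euc n) (pr p)
  simp only [normSq, formComp_PhiOmega hP, compUp_PhiOmega hP hg A hp, map_smul, smul_apply,
    smul_eq_mul]
  have h := sum_omega_mul_inv (x₀ := pr p) hg hp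
  have h2 : ∀ i j, -(omegaMat Ω (pr p) (pr p))⁻¹ i j * (omegaMat Ω (pr p) (pr p) i j *
      B.inner (PhiOf G pr Ω g A.form p) (PhiOf G pr Ω g A.form p)) =
      -(omegaMat Ω (pr p) (pr p) i j * (omegaMat Ω (pr p) (pr p))⁻¹ i j) *
      B.inner (PhiOf G pr Ω g A.form p) (PhiOf G pr Ω g A.form p) := fun i j => by ring
  simp only [h2, ← Finset.sum_mul, Finset.sum_neg_distrib, h]
  ring

include hP in
/-- The decomposition of the curvature is orthogonal. -/
lemma normSq_primitivePart (hn : n ≠ 0) {Ω : SymplecticForm n M} {g : RiemMetric n M}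
    (hg : Compatible Ω g) (B : AdInvariantInner EG G) (A : Connection EG G EP P) (p : P) :
    normSq pr g B A.form (primitivePart G pr Ω g A.form) p =
      normSq pr g B A.form (curvature G A.form) p -
        n * B.inner (PhiOf G pr Ω g A.form p) (PhiOf G pr Ω g A.form p) := by
  have hp := mem_chart_source (Euc n) (pr p)
  set Φ := PhiOf G pr Ω g A.form p with hΦ
  set O := omegaMat Ω (pr p) (pr p) with hO
  set F := formComp (n := n) pr A.form (pr p) (curvature G A.form) p with hF
  set U := compUp (n := n) pr g A.form (pr p) (curvature G A.form) p with hU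
  have h1 : ∀ i j : Fin (2 * n), formComp pr A.form (pr p) (primitivePart G pr Ω g A.form) p i j =
      F i j - O i j • Φ := fun i j =>
    congrArg (fun a => F i j - a) (formComp_PhiOmega hP Ω g A (pr p) p i j)
  have h2 : ∀ i j : Fin (2 * n), compUp pr g A.form (pr p) (primitivePart G pr Ω g A.form) p i j =
      U i j + O⁻¹ i j • Φ := by
    intro i j
    rw [compUp_primitivePart hP, compUp_PhiOmega hP hg A hp, neg_smul, sub_neg_eq_add]
  have h3 := congrArg (fun a => B.inner a Φ) (sum_omega_inv hn hg A hp)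
  simp only [map_sum, map_smul, sum_apply, smul_apply, smul_eq_mul] at h3
  have hn' : (n : ℝ) ≠ 0 := Nat.cast_ne_zero.2 hn
  have h4 : ∑ i, ∑ j, O i j • U i j = (2 * (n : ℝ)) • Φ := by
    have : Φ = (1 / (n : ℝ)) • (1 / 2 : ℝ) • ∑ i, ∑ j, O i j • U i j := rfl
    have h8 : 2 * (n : ℝ) * (1 / n) * (1 / 2) = 1 := by field_simp
    rw [this, smul_smul, smul_smul, h8, one_smul]
  have h5 := congrArg (fun a => B.inner Φ a) h4
  simp only [map_sum, map_smul, smul_eq_mul] at h5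
  have h6 := sum_omega_mul_inv (x₀ := pr p) hg hp
  have h7 : ∀ i j, B.inner (F i j - O i j • Φ) (U i j + O⁻¹ i j • Φ) =
      B.inner (F i j) (U i j) + O⁻¹ i j * B.inner (F i j) Φ - O i j * B.inner Φ (U i j) -
        O i j * O⁻¹ i j * B.inner Φ Φ := by
    intro i j
    simp only [map_add, map_sub, map_smul, sub_apply, smul_apply, smul_eq_mul]
    ring
  simp only [normSq, h1, h2, h7, Finset.sum_add_distrib, Finset.sum_sub_distrib, ← Finset.sum_mul]
  rw [h3, h5, h6]
  ring

end Densities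

/-! ### The Riemannian measure in a chart -/

section Volume
open Filter Topology

lemma measurableSet_inter_preimage_of_continuousOn {α β : Type*} [TopologicalSpace α]
    [MeasurableSpace α] [OpensMeasurableSpace α] [TopologicalSpace β] [MeasurableSpace β]
    [BorelSpace β] {f : α → β} {t : Set α} (ht : MeasurableSet t) (hf : ContinuousOn f t)
    {s : Set β} (hs : MeasurableSet s) : MeasurableSet (t ∩ f ⁻¹' s) := by
  have h1 : Measurable (fun x : t => f x) := (continuousOn_iff_continuous_domRestrict.1 hf).measurable
  have h2 := ht.subtype_image (h1 hs)
  convert h2 using 1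
  ext x
  simp [and_comm]

lemma measure_eq_measure_inter_of_ac_restrict {α : Type*} [MeasurableSpace α] {μ ν : Measure α}
    {t : Set α} (ht : MeasurableSet t) (hν : ν ≪ μ.restrict t) (s : Set α) : ν s = ν (t ∩ s) := by
  have h : ν tᶜ = 0 := hν (by simp [Measure.restrict_apply ht.compl])
  refine le_antisymm ?_ (measure_mono inter_subset_right)
  refine (measure_mono (t := (t ∩ s) ∪ tᶜ) ?_).trans
    ((measure_union_le _ _).trans (by rw [h, add_zero]))
  intro y hy
  by_cases h : y ∈ t
  · exact Or.inl ⟨h, hy⟩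
  · exact Or.inr h

variable {n : ℕ} {M : Type*} [TopologicalSpace M] [ChartedSpace (Euc n) M]
  [IsManifold 𝓘(ℝ, Euc n) ∞ M]

/-- The Riemannian densities of two charts differ by the Jacobian determinant. -/
lemma abs_det_jacMat_mul_density (g : RiemMetric n M) {x₀ x₁ x : M}
    (h₀ : x ∈ (chartAt (Euc n) x₀).source) (h₁ : x ∈ (chartAt (Euc n) x₁).source) :
    |(jacMat (n := n) x₀ x₁ x).det| * density g x₀ x = density g x₁ x := by
  unfold density
  rw [gram_change g h₀ h₁, Matrix.det_mul, Matrix.det_mul, Matrix.det_transpose,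
    show (jacMat (n := n) x₀ x₁ x).det * (gram g x₀ x).det * (jacMat (n := n) x₀ x₁ x).det =
      (jacMat (n := n) x₀ x₁ x).det ^ 2 * (gram g x₀ x).det by ring,
    Real.sqrt_mul (sq_nonneg _), Real.sqrt_sq_eq_abs]

/-- The determinant of the derivative of a change of chart. -/
lemma det_mder_chart_comp (x₀ x₁ x : M) :
    ((mder (Euc n) (Euc n) (extChartAt 𝓘(ℝ, Euc n) x₀) x).comp
      (mder (Euc n) (Euc n) (extChartAt 𝓘(ℝ, Euc n) x₁).symm (extChartAt 𝓘(ℝ, Euc n) x₁ x))).det =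
      (jacMat (n := n) x₀ x₁ x).det := by
  rw [ContinuousLinearMap.det,
    ← LinearMap.det_toMatrix (EuclideanSpace.basisFun (Fin (2 * n)) ℝ).toBasis]
  congr 1

variable [T2Space M] [SigmaCompactSpace M] [MeasurableSpace M] [BorelSpace M]

lemma chartPartition_eq_zero {c x : M} (hx : x ∉ (chartAt (Euc n) c).source) :
    chartPartition n M c x = 0 := by
  have h := Classical.choose_spec
    (SmoothPartitionOfUnity.exists_isSubordinate_chartAt_source 𝓘(ℝ, Euc n) M)
  by_contra h0
  exact hx (h c (subset_tsupport _ h0))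

/-- The part of the volume measure that comes from the chart at `c`, on a measurable subset of the
chart domain at `x₀`, computed in the chart at `x₀` by the change of variables formula. -/
lemma vol_summand (g : RiemMetric n M) (c x₀ : M) {s : Set M} (hs : MeasurableSet s)
    (hsx : s ⊆ (chartAt (Euc n) x₀).source) :
    Measure.map (extChartAt 𝓘(ℝ, Euc n) c).symm
      ((volume.restrict (extChartAt 𝓘(ℝ, Euc n) c).target).withDensity fun y =>
        ENNReal.ofReal (chartPartition n M c ((extChartAt 𝓘(ℝ, Euc n) c).symm y) *
          density g c ((extChartAt 𝓘(ℝ, Euc n) c).symm y))) s =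
    ∫⁻ y in (extChartAt 𝓘(ℝ, Euc n) x₀).target ∩ (extChartAt 𝓘(ℝ, Euc n) x₀).symm ⁻¹' s,
      ENNReal.ofReal (chartPartition n M c ((extChartAt 𝓘(ℝ, Euc n) x₀).symm y)) *
        ENNReal.ofReal (density g x₀ ((extChartAt 𝓘(ℝ, Euc n) x₀).symm y)) := by
  set φ := extChartAt 𝓘(ℝ, Euc n) x₀ with hφ
  set χ := extChartAt 𝓘(ℝ, Euc n) c with hχ
  have hφs : φ.source = (chartAt (Euc n) x₀).source := by simp [φ]
  have hχs : χ.source = (chartAt (Euc n) c).source := by simp [χ]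
  have hχm : MeasurableSet χ.target := (isOpen_extChartAt_target c).measurableSet
  have hφm : MeasurableSet φ.target := (isOpen_extChartAt_target x₀).measurableSet
  have hχc : ContinuousOn χ.symm χ.target := continuousOn_extChartAt_symm c
  have hφc : ContinuousOn φ.symm φ.target := continuousOn_extChartAt_symm x₀
  have hcm : MeasurableSet (chartAt (Euc n) c).source := (chartAt (Euc n) c).open_source.measurableSet
  have h1 : AEMeasurable χ.symm ((volume.restrict χ.target).withDensity fun y =>
        ENNReal.ofReal (chartPartition n M c (χ.symm y) * density g c (χ.symm y))) :=
    (hχc.aemeasurable hχm).mono_ac (withDensity_absolutelyContinuous _ _)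
  rw [Measure.map_apply_of_aemeasurable h1 hs]
  have hS : MeasurableSet (χ.target ∩ χ.symm ⁻¹' s) :=
    measurableSet_inter_preimage_of_continuousOn hχm hχc hs
  rw [measure_eq_measure_inter_of_ac_restrict hχm (withDensity_absolutelyContinuous _ _),
    withDensity_apply _ hS,
    Measure.restrict_restrict hS, inter_eq_self_of_subset_left (inter_subset_left)]
  set S := φ.target ∩ φ.symm ⁻¹' (s ∩ (chartAt (Euc n) c).source) with hSdef
  have hSm : MeasurableSet S := measurableSet_inter_preimage_of_continuousOn hφm hφc (hs.inter hcm)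
  have himg : χ.target ∩ χ.symm ⁻¹' s = (χ ∘ φ.symm) '' S := by
    ext y
    constructor
    · rintro ⟨hy, hys⟩
      have hx : χ.symm y ∈ φ.source := by rw [hφs]; exact hsx hys
      refine ⟨φ (χ.symm y), ⟨φ.map_source hx, ?_, ?_⟩, ?_⟩
      · rw [φ.left_inv hx]; exact hys
      · rw [φ.left_inv hx, ← hχs]; exact χ.map_target hy
      · simp only [Function.comp]
        rw [φ.left_inv hx, χ.right_inv hy]
    · rintro ⟨z, ⟨hz, hzs, hzc⟩, rfl⟩
      have hx : φ.symm z ∈ χ.source := by rw [hχs]; exact hzc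
      refine ⟨χ.map_source hx, ?_⟩
      simp only [Function.comp, mem_preimage]
      rw [χ.left_inv hx]
      exact hzs
  let D : Euc n → Euc n →L[ℝ] Euc n := fun z => (mder (Euc n) (Euc n) χ (φ.symm z)).comp
    (mder (Euc n) (Euc n) φ.symm z)
  have hD : ∀ z ∈ S, HasFDerivWithinAt (χ ∘ φ.symm) (D z) S z := by
    rintro z ⟨hz, hzs, hzc⟩
    have h3 : MDifferentiableAt 𝓘(ℝ, Euc n) 𝓘(ℝ, Euc n) φ.symm z :=
      ((contMDiffOn_extChartAt_symm (n := 1) x₀).contMDiffAt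
        ((isOpen_extChartAt_target x₀).mem_nhds hz)).mdifferentiableAt (by simp)
    have h4 : MDifferentiableAt 𝓘(ℝ, Euc n) 𝓘(ℝ, Euc n) χ (φ.symm z) :=
      mdifferentiableAt_extChartAt hzc
    have h5 := mder_comp (f := φ.symm) (h := χ) (x := z) h4 h3
    have h6 := (MDifferentiableAt.comp z h4 h3).differentiableAt.hasFDerivAt
    rw [← mder_eq_fderiv] at h6
    have h7 : mder (Euc n) (Euc n) (χ ∘ φ.symm) z = D z := h5
    rw [h7] at h6
    exact h6.hasFDerivWithinAt
  have hinj : InjOn (χ ∘ φ.symm) S := by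
    rintro z ⟨hz, hzs, hzc⟩ w ⟨hw, hws, hwc⟩ h
    have := χ.injOn (by rw [hχs]; exact hzc) (by rw [hχs]; exact hwc) h
    rw [← φ.right_inv hz, ← φ.right_inv hw, this]
  rw [himg, lintegral_image_eq_lintegral_abs_det_fderiv_mul volume hSm hD hinj]
  have hsub : S ⊆ φ.target ∩ φ.symm ⁻¹' s := fun z hz => ⟨hz.1, hz.2.1⟩
  rw [← inter_eq_self_of_subset_left hsub, ← setLIntegral_indicator hSm]
  refine setLIntegral_congr_fun (measurableSet_inter_preimage_of_continuousOn hφm hφc hs) ?_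
  rintro z ⟨hz, hzs⟩
  simp only []
  by_cases hzc : φ.symm z ∈ (chartAt (Euc n) c).source
  · rw [indicator_of_mem (show z ∈ S from ⟨hz, hzs, hzc⟩)]
    have hx : φ.symm z ∈ χ.source := by rw [hχs]; exact hzc
    have h3 : (D z).det = (jacMat (n := n) c x₀ (φ.symm z)).det := by
      rw [← det_mder_chart_comp, ← hφ, φ.right_inv hz]
    simp only [Function.comp]
    rw [χ.left_inv hx, h3, ← ENNReal.ofReal_mul (abs_nonneg _),
      ← ENNReal.ofReal_mul ((chartPartition n M).nonneg _ _)]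
    congr 1
    rw [← abs_det_jacMat_mul_density g hzc (hsx hzs)]
    ring
  · rw [indicator_of_notMem (fun h : z ∈ S => hzc h.2.2), chartPartition_eq_zero hzc]
    simp

/-- On a chart domain the volume measure is the Riemannian density times Lebesgue measure, in
coordinates. -/
lemma vol_apply_of_subset (g : RiemMetric n M) (x₀ : M) {s : Set M} (hs : MeasurableSet s)
    (hsx : s ⊆ (chartAt (Euc n) x₀).source) :
    vol g s = ∫⁻ y in (extChartAt 𝓘(ℝ, Euc n) x₀).target ∩ (extChartAt 𝓘(ℝ, Euc n) x₀).symm ⁻¹' s,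
      ENNReal.ofReal (density g x₀ ((extChartAt 𝓘(ℝ, Euc n) x₀).symm y)) := by
  set φ := extChartAt 𝓘(ℝ, Euc n) x₀ with hφ
  have hφm : MeasurableSet φ.target := (isOpen_extChartAt_target x₀).measurableSet
  have hφc : ContinuousOn φ.symm φ.target := continuousOn_extChartAt_symm x₀
  have hT := measurableSet_inter_preimage_of_continuousOn hφm hφc hs
  rw [vol, Measure.sum_apply _ hs]
  simp only [vol_summand g _ x₀ hs hsx]
  rw [← hφ]
  -- only countably many functions of the partition of unity do not vanish identically
  let I := {c : M // (Function.support (chartPartition n M c)).Nonempty}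
  have hI : Countable I := by
    have hlf : LocallyFinite fun c : I => Function.support (chartPartition n M c.1) :=
      (chartPartition n M).locallyFinite.comp_injective Subtype.val_injective
    exact countable_univ_iff.1 (hlf.countable_univ fun c => c.2)
  have hzero : ∀ c : M, ¬ (Function.support (chartPartition n M c)).Nonempty →
      ∀ x, chartPartition n M c x = 0 := by
    intro c hc x
    by_contra h
    exact hc ⟨x, h⟩
  rw [← tsum_subtype_eq_of_support_subset
    (s := {c : M | (Function.support (chartPartition n M c)).Nonempty})]
  · change ∑' c : I, _ = _
    rw [← lintegral_tsum]
    · refine setLIntegral_congr_fun hT ?_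
      rintro z -
      simp only []
      rw [ENNReal.tsum_mul_right]
      have h1 : ∑' c : I, ENNReal.ofReal (chartPartition n M c.1 (φ.symm z)) = 1 := by
        have h2 : ∑' c : I, ENNReal.ofReal (chartPartition n M c.1 (φ.symm z)) =
            ∑' c : M, ENNReal.ofReal (chartPartition n M c (φ.symm z)) := by
          refine tsum_subtype_eq_of_support_subset
            (f := fun c : M => ENNReal.ofReal (chartPartition n M c (φ.symm z)))
            (s := {c : M | (Function.support (chartPartition n M c)).Nonempty}) fun c hc => ?_
          by_contra h
          exact hc (by simp [hzero c h])
        have h3 : (Function.support fun c => chartPartition n M c (φ.symm z)).Finite :=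
          (chartPartition n M).locallyFinite.point_finite (φ.symm z)
        rw [h2, tsum_eq_sum (L := SummationFilter.unconditional M) (s := h3.toFinset)
          (fun c hc => by
            have : chartPartition n M c (φ.symm z) = 0 := by simpa using hc
            simp [this]),
          ← ENNReal.ofReal_sum_of_nonneg fun c _ => (chartPartition n M).nonneg _ _,
          ← finsum_eq_sum _ h3, (chartPartition n M).sum_eq_one (mem_univ _), ENNReal.ofReal_one]
      rw [h1, one_mul]
    · intro c
      refine AEMeasurable.fun_mul ?_ ?_
      · refine AEMeasurable.ennreal_ofReal ?_
        refine AEMeasurable.mono_measure ?_ (Measure.restrict_mono inter_subset_left le_rfl)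
        exact ContinuousOn.aemeasurable
          ((chartPartition n M c.1).contMDiff.continuous.comp_continuousOn hφc) hφm
      · refine AEMeasurable.ennreal_ofReal ?_
        refine AEMeasurable.mono_measure ?_ (Measure.restrict_mono inter_subset_left le_rfl)
        exact (contDiffOn_density g x₀).continuousOn.aemeasurable hφm
  · intro c hc
    by_contra h
    exact hc (by simp [hzero c h])

/-- The integral over the manifold of a function supported in a chart domain. -/
lemma integral_vol_eq (g : RiemMetric n M) (x₀ : M) {f : M → ℝ}
    (hf : Measurable f) (hfs : ∀ x, x ∉ (chartAt (Euc n) x₀).source → f x = 0) :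
    ∫ x, f x ∂(vol g) = ∫ y in (extChartAt 𝓘(ℝ, Euc n) x₀).target,
      density g x₀ ((extChartAt 𝓘(ℝ, Euc n) x₀).symm y) * f ((extChartAt 𝓘(ℝ, Euc n) x₀).symm y) := by
  set φ := extChartAt 𝓘(ℝ, Euc n) x₀ with hφ
  have hφm : MeasurableSet φ.target := (isOpen_extChartAt_target x₀).measurableSet
  have hφc : ContinuousOn φ.symm φ.target := continuousOn_extChartAt_symm x₀
  have hsm : MeasurableSet (chartAt (Euc n) x₀).source := (chartAt (Euc n) x₀).open_source.measurableSet
  set d : Euc n → NNReal := fun y => Real.toNNReal (density g x₀ (φ.symm y))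
  have hdm : AEMeasurable d (volume.restrict φ.target) :=
    ((contDiffOn_density g x₀).continuousOn.aemeasurable hφm).real_toNNReal
  set μ := (volume.restrict φ.target).withDensity fun y => (d y : ENNReal)
  have hφa : AEMeasurable φ.symm μ :=
    (hφc.aemeasurable hφm).mono_ac (withDensity_absolutelyContinuous _ _)
  have h1 : (vol g).restrict (chartAt (Euc n) x₀).source = Measure.map φ.symm μ := by
    ext s hs
    have hT := measurableSet_inter_preimage_of_continuousOn hφm hφc (hs.inter hsm)
    rw [Measure.restrict_apply hs, vol_apply_of_subset g x₀ (hs.inter hsm) inter_subset_right,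
      Measure.map_apply_of_aemeasurable hφa hs]
    have h3 : φ.target ∩ φ.symm ⁻¹' (s ∩ (chartAt (Euc n) x₀).source) = φ.target ∩ φ.symm ⁻¹' s := by
      ext z
      refine ⟨fun h => ⟨h.1, h.2.1⟩, fun h => ⟨h.1, h.2, mem_source_of_mem_target h.1⟩⟩
    rw [measure_eq_measure_inter_of_ac_restrict hφm (withDensity_absolutelyContinuous _ _),
      ← h3, withDensity_apply _ hT, Measure.restrict_restrict hT,
      inter_eq_self_of_subset_left inter_subset_left]
    rfl
  have h2 : ∫ x, f x ∂(vol g) = ∫ x in (chartAt (Euc n) x₀).source, f x ∂(vol g) :=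
    (setIntegral_eq_integral_of_forall_compl_eq_zero fun x hx => hfs x hx).symm
  rw [h2, h1, integral_map hφa hf.aestronglyMeasurable,
    integral_withDensity_eq_integral_smul₀ hdm]
  refine setIntegral_congr_fun hφm fun y hy => ?_
  simp only [d, NNReal.smul_def]
  rw [Real.coe_toNNReal _ (density_pos g (mem_source_of_mem_target hy)).le]
  rfl

lemma exists_nhds_vol_lt_top (g : RiemMetric n M) (x₀ : M) : ∃ s ∈ 𝓝 x₀, vol g s < ⊤ := by
  set φ := extChartAt 𝓘(ℝ, Euc n) x₀ with hφ
  have hφs : φ.source = (chartAt (Euc n) x₀).source := by simp [φ]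
  have hφc : ContinuousOn φ.symm φ.target := continuousOn_extChartAt_symm x₀
  have hx : φ x₀ ∈ φ.target := mem_extChartAt_target x₀
  obtain ⟨C, hC, hCt, hCc⟩ := local_compact_nhds
    ((isOpen_extChartAt_target (I := 𝓘(ℝ, Euc n)) x₀).mem_nhds hx)
  have hKc : IsCompact (φ.symm '' C) := hCc.image_of_continuousOn (hφc.mono hCt)
  refine ⟨φ.symm '' C, ?_, ?_⟩
  · have h1 : φ.source ∩ φ ⁻¹' C ∈ 𝓝 x₀ := inter_mem (extChartAt_source_mem_nhds x₀)
      ((continuousAt_extChartAt x₀).preimage_mem_nhds hC)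
    refine mem_of_superset h1 ?_
    rintro x ⟨hxs, hxC⟩
    exact ⟨φ x, hxC, φ.left_inv hxs⟩
  · have hsub : φ.symm '' C ⊆ (chartAt (Euc n) x₀).source := by
      rintro _ ⟨y, hy, rfl⟩
      exact mem_source_of_mem_target (hCt hy)
    have h2 : φ.target ∩ φ.symm ⁻¹' (φ.symm '' C) = C := by
      ext y
      constructor
      · rintro ⟨hy, z, hz, hzy⟩
        have := φ.symm.injOn (hCt hz) hy hzy
        exact this ▸ hz
      · intro hy
        exact ⟨hCt hy, mem_image_of_mem _ hy⟩
    rw [vol_apply_of_subset g x₀ hKc.measurableSet hsub, ← hφ, h2]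
    have h3 : IntegrableOn (fun y => density g x₀ (φ.symm y)) C :=
      ((contDiffOn_density g x₀).continuousOn.mono hCt).integrableOn_compact hCc
    exact h3.lintegral_lt_top

instance (g : RiemMetric n M) : IsLocallyFiniteMeasure (vol g) :=
  ⟨fun x => exists_nhds_vol_lt_top g x⟩

end Volume

/-! ### The first variation -/

section Variation
open Filter Topology

section Affine

variable {EG : Type*} [NormedAddCommGroup EG] [NormedSpace ℝ EG]
  {G : Type*} [TopologicalSpace G] [ChartedSpace EG G] [Group G]
  {EP : Type*} [NormedAddCommGroup EP] [NormedSpace ℝ EP]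
  {P : Type*} [TopologicalSpace P] [ChartedSpace EP P] [IsManifold 𝓘(ℝ, EP) ∞ P] [MulAction Gᵐᵒᵖ P]

lemma SmoothOneForm.add_smul {θ ξ : (p : P) → TangentSpace 𝓘(ℝ, EP) p →L[ℝ] EG}
    (hθ : SmoothOneForm θ) (hξ : SmoothOneForm ξ) (t : ℝ) :
    SmoothOneForm (fun p => θ p + t • ξ p) := by
  intro p
  refine (contMDiffAt_iff_chartForm _ p).2 ?_
  have h1 := (contMDiffAt_iff_chartForm _ p).1 (hθ p)
  have h2 := (contMDiffAt_iff_chartForm _ p).1 (hξ p)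
  exact h1.add ((contDiffAt_const (c := t)).smul h2)

/-- The connection `A + t η`. -/
def Connection.addSMul (A : Connection EG G EP P) (t : ℝ) (η : AdOneForm EG G EP P) :
    Connection EG G EP P where
  form p := A.form p + t • η.form p
  smooth := A.smooth.add_smul η.smooth t
  fundamental p v := by
    have h1 := A.fundamental p v
    have h2 := η.horizontal p v
    exact (congrArg₂ (fun a b : EG => a + t • b) h1 h2).trans (by rw [smul_zero, add_zero])
  equivariant p a w := by
    have h1 := A.equivariant p a w
    have h2 := η.equivariant p a w
    refine (congrArg₂ (fun a b : EG => a + t • b) h1 h2).trans ?_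
    rw [← map_smul, ← map_add]
    rfl

end Affine

/-- The integral of a family of functions that depend on the parameter as polynomials of degree at
most four can be differentiated under the integral sign. -/
lemma hasDerivAt_integral_of_quartic {X : Type*} [MeasurableSpace X] {μ : Measure X} {f : ℝ → X → ℝ}
    (hf : ∀ t, Integrable (f t) μ) {c₁ c₂ c₃ c₄ : X → ℝ}
    (h : ∀ t x, f t x = f 0 x + t * c₁ x + t ^ 2 * c₂ x + t ^ 3 * c₃ x + t ^ 4 * c₄ x) :
    HasDerivAt (fun t => ∫ x, f t x ∂μ) (∫ x, c₁ x ∂μ) 0 := by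
  -- the coefficients are combinations of the values at `0, ± 1, ± 2`, hence integrable
  have e1 : c₁ = fun x => (8 * f 1 x - 8 * f (-1) x - f 2 x + f (-2) x) / 12 := by
    funext x; rw [h 1, h (-1), h 2, h (-2)]; ring
  have e2 : c₂ = fun x => (16 * f 1 x + 16 * f (-1) x - f 2 x - f (-2) x - 30 * f 0 x) / 24 := by
    funext x; rw [h 1, h (-1), h 2, h (-2)]; ring
  have e3 : c₃ = fun x => (f 2 x - f (-2) x - 2 * f 1 x + 2 * f (-1) x) / 12 := by
    funext x; rw [h 1, h (-1), h 2, h (-2)]; ring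
  have e4 : c₄ = fun x => (f 2 x + f (-2) x - 4 * f 1 x - 4 * f (-1) x + 6 * f 0 x) / 24 := by
    funext x; rw [h 1, h (-1), h 2, h (-2)]; ring
  have i1 : Integrable c₁ μ := by
    rw [e1]
    exact (((((hf 1).const_mul 8).sub ((hf (-1)).const_mul 8)).sub (hf 2)).add (hf (-2))).div_const 12
  have i2 : Integrable c₂ μ := by
    rw [e2]
    exact ((((((hf 1).const_mul 16).add ((hf (-1)).const_mul 16)).sub (hf 2)).sub (hf (-2))).sub
      ((hf 0).const_mul 30)).div_const 24
  have i3 : Integrable c₃ μ := by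
    rw [e3]
    exact ((((hf 2).sub (hf (-2))).sub ((hf 1).const_mul 2)).add ((hf (-1)).const_mul 2)).div_const 12
  have i4 : Integrable c₄ μ := by
    rw [e4]
    exact (((((hf 2).add (hf (-2))).sub ((hf 1).const_mul 4)).sub ((hf (-1)).const_mul 4)).add
      ((hf 0).const_mul 6)).div_const 24
  have key : (fun t => ∫ x, f t x ∂μ) = fun t => ∫ x, f 0 x ∂μ + t * ∫ x, c₁ x ∂μ +
      t ^ 2 * ∫ x, c₂ x ∂μ + t ^ 3 * ∫ x, c₃ x ∂μ + t ^ 4 * ∫ x, c₄ x ∂μ := by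
    funext t
    simp only [← integral_const_mul]
    rw [← integral_add (hf 0) (i1.const_mul t), ← integral_add _ (i2.const_mul _),
      ← integral_add _ (i3.const_mul _), ← integral_add _ (i4.const_mul _)]
    · exact integral_congr_ae (Eventually.of_forall fun x => h t x)
    · exact (((hf 0).add (i1.const_mul t)).add (i2.const_mul _)).add (i3.const_mul _)
    · exact ((hf 0).add (i1.const_mul t)).add (i2.const_mul _)
    · exact (hf 0).add (i1.const_mul t)
  rw [key]
  have hid := hasDerivAt_id (0 : ℝ)
  have := (((((hasDerivAt_const (0 : ℝ) (∫ x, f 0 x ∂μ)).add (hid.mul_const (∫ x, c₁ x ∂μ))).add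
    ((hid.pow 2).mul_const (∫ x, c₂ x ∂μ))).add ((hid.pow 3).mul_const (∫ x, c₃ x ∂μ))).add
    ((hid.pow 4).mul_const (∫ x, c₄ x ∂μ)))
  refine HasDerivAt.congr_deriv this ?_
  simp

lemma exists_quartic_of_eq {f : ℝ → ℝ} {c₀ c₁ c₂ c₃ c₄ : ℝ}
    (h : ∀ t, f t = c₀ + t * c₁ + t ^ 2 * c₂ + t ^ 3 * c₃ + t ^ 4 * c₄) :
    ∃ c₁ c₂ c₃ c₄ : ℝ, ∀ t, f t = f 0 + t * c₁ + t ^ 2 * c₂ + t ^ 3 * c₃ + t ^ 4 * c₄ :=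
  ⟨c₁, c₂, c₃, c₄, fun t => by rw [h t, h 0]; ring⟩

variable {n : ℕ} {M : Type*} [TopologicalSpace M] [ChartedSpace (Euc n) M]
  [IsManifold 𝓘(ℝ, Euc n) ∞ M]
  {EG : Type*} [NormedAddCommGroup EG] [NormedSpace ℝ EG]
  {G : Type*} [TopologicalSpace G] [ChartedSpace EG G] [Group G] [LieGroup 𝓘(ℝ, EG) ∞ G]
  {EP : Type*} [NormedAddCommGroup EP] [NormedSpace ℝ EP]
  {P : Type*} [TopologicalSpace P] [ChartedSpace EP P] [IsManifold 𝓘(ℝ, EP) ∞ P] [MulAction Gᵐᵒᵖ P]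
  {pr : P → M} (hP : IsPrincipalBundle (Euc n) EG G EP pr)

/-- The exterior covariant derivative of a local one-form `h` with derivative `D`, for the local
connection form `a`. -/
def covExt (br : EG →L[ℝ] EG →L[ℝ] EG) (a : Euc n →L[ℝ] EG) (D : Euc n →L[ℝ] Euc n →L[ℝ] EG)
    (h : Euc n →L[ℝ] EG) (u w : Euc n) : EG :=
  D u w - D w u + br (a u) (h w) + br (h u) (a w)

lemma pullForm_addSMul (A : Connection EG G EP P) (t : ℝ) (η : AdOneForm EG G EP P) {x₀ : M}
    (γ : Gauge (Euc n) EG G EP pr x₀) (y : Euc n) :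
    pullForm (A.addSMul t η).form γ.sec y = pullForm A.form γ.sec y + t • pullForm η.form γ.sec y := rfl

/-- The curvature of `A + t η`. -/
lemma Gauge.curv_addSMul (A : Connection EG G EP P) (t : ℝ) (η : AdOneForm EG G EP P) {x₀ : M}
    (γ : Gauge (Euc n) EG G EP pr x₀) {y : Euc n} (hy : y ∈ γ.dom) (u w : Euc n) :
    γ.curv (A.addSMul t η).form y u w = γ.curv A.form y u w +
      t • covExt (adL G) (pullForm A.form γ.sec y) (fderiv ℝ (pullForm η.form γ.sec) y)
        (pullForm η.form γ.sec y) u w +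
      t ^ 2 • adL G (pullForm η.form γ.sec y u) (pullForm η.form γ.sec y w) := by
  have h1 := (γ.contDiffAt_pullForm A.smooth hy).differentiableAt (by simp)
  have h2 := (γ.contDiffAt_pullForm η.smooth hy).differentiableAt (by simp)
  have h3 : fderiv ℝ (pullForm (A.addSMul t η).form γ.sec) y =
      fderiv ℝ (pullForm A.form γ.sec) y + t • fderiv ℝ (pullForm η.form γ.sec) y :=
    (h1.hasFDerivAt.add (h2.hasFDerivAt.const_smul t)).fderiv
  simp only [Gauge.curv, curvOf_apply, covExt, h3, pullForm_addSMul]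
  simp only [add_apply, smul_apply, map_add, map_smul, smul_sub, smul_add, smul_smul, pow_two]
  module

/-- The coefficients of a functional that is quadratic in the curvature: an array of functions
`N^{ijkl}` for each chart, with the symmetries of a symmetric bilinear form on two-forms. -/
structure QuadCoeff (n : ℕ) (M : Type*) [TopologicalSpace M] [ChartedSpace (Euc n) M] where
  /-- the coefficients in the chart at a first point, at a second point -/
  coeff : M → M → Fin (2 * n) → Fin (2 * n) → Fin (2 * n) → Fin (2 * n) → ℝ
  smooth : ∀ x₀ i j k l, ContDiffOn ℝ ∞
    (fun y => coeff x₀ ((extChartAt 𝓘(ℝ, Euc n) x₀).symm y) i j k l)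
    (extChartAt 𝓘(ℝ, Euc n) x₀).target
  symm : ∀ x₀ x i j k l, coeff x₀ x i j k l = coeff x₀ x k l i j
  flip : ∀ x₀ x i j k l, coeff x₀ x i j k l = coeff x₀ x j i l k

/-- The array contracted with the components of a two-form. -/
def raise (N : Fin (2 * n) → Fin (2 * n) → Fin (2 * n) → Fin (2 * n) → ℝ)
    (F : Fin (2 * n) → Fin (2 * n) → EG) (i j : Fin (2 * n)) : EG :=
  ∑ k, ∑ l, N i j k l • F k l

lemma quad_eq_raise (B : AdInvariantInner EG G)
    (N : Fin (2 * n) → Fin (2 * n) → Fin (2 * n) → Fin (2 * n) → ℝ)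
    (F : Fin (2 * n) → Fin (2 * n) → EG) :
    quad B N F = 1 / 2 * ∑ i, ∑ j, B.inner (raise N F i j) (F i j) := by
  simp only [quad, raise]
  congr 1
  refine Finset.sum_congr rfl fun i _ => Finset.sum_congr rfl fun j _ => B.symm _ _

lemma sum_raise_symm (B : AdInvariantInner EG G)
    {N : Fin (2 * n) → Fin (2 * n) → Fin (2 * n) → Fin (2 * n) → ℝ}
    (hN : ∀ i j k l, N i j k l = N k l i j) (F H : Fin (2 * n) → Fin (2 * n) → EG) :
    ∑ i, ∑ j, B.inner (raise N F i j) (H i j) = ∑ i, ∑ j, B.inner (raise N H i j) (F i j) := by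
  simp only [raise, map_sum, map_smul, sum_apply, smul_apply]
  rw [sum_comm_pairs]
  refine Finset.sum_congr rfl fun i _ => Finset.sum_congr rfl fun j _ =>
    Finset.sum_congr rfl fun k _ => Finset.sum_congr rfl fun l _ => ?_
  rw [hN, B.symm]

/-- The value of `quad` at a family of two-forms that is quadratic in `t`, such as the curvature of
`A + t η`. -/
lemma quad_quartic (B : AdInvariantInner EG G)
    {N : Fin (2 * n) → Fin (2 * n) → Fin (2 * n) → Fin (2 * n) → ℝ}
    (hN : ∀ i j k l, N i j k l = N k l i j) (F D H : Fin (2 * n) → Fin (2 * n) → EG) (t : ℝ) :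
    quad B N (fun i j => F i j + t • D i j + t ^ 2 • H i j) = quad B N F +
      t * (∑ i, ∑ j, B.inner (raise N F i j) (D i j)) +
      t ^ 2 * (quad B N D + ∑ i, ∑ j, B.inner (raise N F i j) (H i j)) +
      t ^ 3 * (∑ i, ∑ j, B.inner (raise N D i j) (H i j)) + t ^ 4 * quad B N H := by
  have h1 : ∀ i j, raise N (fun i j => F i j + t • D i j + t ^ 2 • H i j) i j =
      raise N F i j + t • raise N D i j + t ^ 2 • raise N H i j := by
    intro i j
    simp only [raise, smul_add, Finset.sum_add_distrib, Finset.smul_sum, smul_smul, mul_comm]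
  have h2 := sum_raise_symm B hN D F
  have h3 := sum_raise_symm B hN H F
  have h4 := sum_raise_symm B hN H D
  simp only [quad_eq_raise, h1, map_add, map_smul, add_apply, smul_apply, smul_eq_mul,
    Finset.sum_add_distrib, ← Finset.mul_sum] at h2 h3 h4 ⊢
  rw [h2, h3, h4]
  ring

/-- A functional density that is quadratic in the curvature: in every chart it is given by the
coefficients `N`. -/
def HasCoeff (pr : P → M) (B : AdInvariantInner EG G) (N : QuadCoeff n M)
    (e : Connection EG G EP P → P → ℝ) : Prop :=
  ∀ (A : Connection EG G EP P) (x₀ : M) (p : P), pr p ∈ (chartAt (Euc n) x₀).source →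
    e A p = quad B (N.coeff x₀ (pr p)) (formComp pr A.form x₀ (curvature G A.form) p)

variable {B : AdInvariantInner EG G} {N : QuadCoeff n M} {e : Connection EG G EP P → P → ℝ}

include hP

lemma IsPrincipalBundle.surjective_proj : Function.Surjective pr := by
  intro x
  obtain ⟨U, -, hx, σ, -, -, -, h1, -⟩ := hP.locally_trivial x
  exact ⟨σ x, h1 x hx⟩

lemma IsPrincipalBundle.exists_act_eq {p p' : P} (h : pr p = pr p') : ∃ b : G, p' = p <• b := by
  obtain ⟨γ, hy, hγ⟩ := hP.exists_gauge (pr p) p (mem_chart_source _ _)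
  have h1 := γ.sec_fib p' (by rw [← h]; exact mem_chart_source _ _) (by rw [← h]; exact hy)
  rw [← h, hγ] at h1
  exact ⟨_, h1.symm⟩

/-- The density is invariant under the group, as the curvature transforms by `Ad` and the inner product
is `Ad`-invariant. -/
lemma HasCoeff.factorsThrough (he : HasCoeff pr B N e) (A : Connection EG G EP P) :
    Function.FactorsThrough (e A) pr := by
  intro p p' h
  obtain ⟨b, rfl⟩ := hP.exists_act_eq h
  rw [he A (pr p) p (mem_chart_source _ _), he A (pr p) (p <• b) (by rw [← h]; exact mem_chart_source _ _),
    ← h, quad_eq, quad_eq]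
  simp only [formComp_curvature_right hP A (mem_chart_source (Euc n) (pr p)), B.ad_inv]

lemma HasCoeff.extend_sec (he : HasCoeff pr B N e) (A : Connection EG G EP P) {x₀ : M}
    (γ : Gauge (Euc n) EG G EP pr x₀) {y : Euc n} (hy : y ∈ γ.dom) :
    Function.extend pr (e A) 0 ((extChartAt 𝓘(ℝ, Euc n) x₀).symm y) =
      quad B (N.coeff x₀ ((extChartAt 𝓘(ℝ, Euc n) x₀).symm y))
        (fun i j => γ.curv A.form y (stdv n i) (stdv n j)) := by
  rw [← γ.proj_sec y hy, (he.factorsThrough hP A).extend_apply, he A x₀ _ (γ.mem_source hy)]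
  congr 1
  funext i j
  exact γ.formComp_curvature hP A hy i j

omit hP in
lemma Gauge.contDiffOn_curv (A : Connection EG G EP P) {x₀ : M}
    (γ : Gauge (Euc n) EG G EP pr x₀) (u w : Euc n) :
    ContDiffOn ℝ ∞ (fun y => γ.curv A.form y u w) γ.dom := by
  intro y hy
  have h1 := γ.contDiffAt_pullForm A.smooth hy
  have h2 : ContDiffAt ℝ ∞ (fderiv ℝ (pullForm A.form γ.sec)) y := h1.fderiv_right (by simp)
  have h3 : ContDiffAt ℝ ∞ (fun y => γ.curv A.form y u w) y := by
    simp only [Gauge.curv, curvOf_apply]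
    have h4 : ∀ v, ContDiffAt ℝ ∞ (fun y => pullForm A.form γ.sec y v) y := fun v =>
      h1.clm_apply contDiffAt_const
    exact (((h2.clm_apply contDiffAt_const).clm_apply contDiffAt_const).sub
      ((h2.clm_apply contDiffAt_const).clm_apply contDiffAt_const)).add
      ((contDiffAt_const.clm_apply (h4 u)).clm_apply (h4 w))
  exact h3.contDiffWithinAt

omit hP in
lemma Gauge.contDiffOn_raise (A : Connection EG G EP P) (N : QuadCoeff n M) {x₀ : M}
    (γ : Gauge (Euc n) EG G EP pr x₀) (i j : Fin (2 * n)) :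
    ContDiffOn ℝ ∞ (fun y => raise (N.coeff x₀ ((extChartAt 𝓘(ℝ, Euc n) x₀).symm y))
      (fun i j => γ.curv A.form y (stdv n i) (stdv n j)) i j) γ.dom := by
  simp only [raise]
  exact ContDiffOn.sum fun k _ => ContDiffOn.sum fun l _ =>
    ((N.smooth x₀ i j k l).mono γ.subset).smul (γ.contDiffOn_curv A _ _)

lemma HasCoeff.continuous_extend (he : HasCoeff pr B N e) (A : Connection EG G EP P) :
    Continuous (Function.extend pr (e A) 0) := by
  refine continuous_iff_continuousAt.2 fun x => ?_
  obtain ⟨p, rfl⟩ := hP.surjective_proj x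
  obtain ⟨γ, hy, hγ⟩ := hP.exists_gauge (pr p) p (mem_chart_source _ _)
  set φ := extChartAt 𝓘(ℝ, Euc n) (pr p)
  have h1 : Function.extend pr (e A) 0 =ᶠ[𝓝 (pr p)] (fun y => quad B (N.coeff (pr p) (φ.symm y))
        (fun i j => γ.curv A.form y (stdv n i) (stdv n j))) ∘ φ := by
    filter_upwards [extChartAt_source_mem_nhds (I := 𝓘(ℝ, Euc n)) (pr p),
      (continuousAt_extChartAt (I := 𝓘(ℝ, Euc n)) (pr p)).preimage_mem_nhds (γ.isOpen.mem_nhds hy)]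
      with x hx hxd
    have := he.extend_sec hP A γ hxd
    rw [φ.left_inv hx] at this
    simp only [Function.comp]
    rw [φ.left_inv hx, this]
  refine ContinuousAt.congr ?_ h1.symm
  refine ContinuousAt.comp ?_ (continuousAt_extChartAt (pr p))
  have h2 : ContinuousOn (fun y => quad B (N.coeff (pr p) (φ.symm y))
        (fun i j => γ.curv A.form y (stdv n i) (stdv n j))) γ.dom := by
    simp only [quad_eq_raise]
    refine continuousOn_const.mul (continuousOn_finsetSum _ fun i _ => continuousOn_finsetSum _ fun j _ => ?_)
    exact ((continuousOn_const.clm_apply (γ.contDiffOn_raise A N i j).continuousOn)).clm_apply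
      (γ.contDiffOn_curv A _ _).continuousOn
  exact h2.continuousAt (γ.isOpen.mem_nhds hy)

/-- The density of the functional at `A + t η` is a polynomial in `t`. -/
lemma HasCoeff.exists_quartic (he : HasCoeff pr B N e) (A : Connection EG G EP P)
    (η : AdOneForm EG G EP P) (x : M) : ∃ c₁ c₂ c₃ c₄ : ℝ, ∀ t : ℝ,
      Function.extend pr (e (A.addSMul t η)) 0 x = Function.extend pr (e (A.addSMul 0 η)) 0 x +
        t * c₁ + t ^ 2 * c₂ + t ^ 3 * c₃ + t ^ 4 * c₄ := by
  obtain ⟨p, rfl⟩ := hP.surjective_proj x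
  obtain ⟨γ, hy, hγ⟩ := hP.exists_gauge (pr p) p (mem_chart_source _ _)
  have hx : (extChartAt 𝓘(ℝ, Euc n) (pr p)).symm (extChartAt 𝓘(ℝ, Euc n) (pr p) (pr p)) = pr p :=
    extChartAt_to_inv (pr p)
  have h1 := fun t => he.extend_sec hP (A.addSMul t η) γ hy
  simp only [γ.curv_addSMul A _ η hy, quad_quartic B (N.symm _ _), hx] at h1
  exact exists_quartic_of_eq h1

/-- The first variation of the density `e` at `A` in the direction `η`, as a function on the base: the
value of the five-point difference formula, which on a polynomial of degree at most four in `t` is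
exactly the derivative at `t = 0`. (`Function.extend pr` turns an invariant function on the bundle
into a function on the base.) -/
def firstVar (pr : P → M) (e : Connection EG G EP P → P → ℝ) (A : Connection EG G EP P)
    (η : AdOneForm EG G EP P) (x : M) : ℝ :=
  (8 * Function.extend pr (e (A.addSMul 1 η)) 0 x - 8 * Function.extend pr (e (A.addSMul (-1) η)) 0 x -
    Function.extend pr (e (A.addSMul 2 η)) 0 x + Function.extend pr (e (A.addSMul (-2) η)) 0 x) / 12

lemma HasCoeff.continuous_firstVar (he : HasCoeff pr B N e) (A : Connection EG G EP P)
    (η : AdOneForm EG G EP P) : Continuous (firstVar pr e A η) := by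
  have h := fun t => he.continuous_extend hP (A.addSMul t η)
  exact ((((continuous_const.mul (h 1)).sub (continuous_const.mul (h (-1)))).sub (h 2)).add
    (h (-2))).div_const 12

/-- The first variation in a gauge is the pairing of `N F` with `d_A η`. -/
lemma HasCoeff.firstVar_sec (he : HasCoeff pr B N e) (A : Connection EG G EP P)
    (η : AdOneForm EG G EP P) {x₀ : M}
    (γ : Gauge (Euc n) EG G EP pr x₀) {y : Euc n} (hy : y ∈ γ.dom) :
    firstVar pr e A η ((extChartAt 𝓘(ℝ, Euc n) x₀).symm y) =
      ∑ i, ∑ j, B.inner (raise (N.coeff x₀ ((extChartAt 𝓘(ℝ, Euc n) x₀).symm y))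
        (fun i j => γ.curv A.form y (stdv n i) (stdv n j)) i j)
        (covExt (adL G) (pullForm A.form γ.sec y) (fderiv ℝ (pullForm η.form γ.sec) y)
          (pullForm η.form γ.sec y) (stdv n i) (stdv n j)) := by
  have h1 := fun t => he.extend_sec hP (A.addSMul t η) γ hy
  simp only [γ.curv_addSMul A _ η hy, quad_quartic B (N.symm _ _)] at h1
  unfold firstVar
  rw [h1, h1, h1, h1]
  ring

/-- The derivative of the functional is the integral of the first variation of its density. -/
lemma HasCoeff.hasDerivAt [T2Space M] [SigmaCompactSpace M] [MeasurableSpace M] [BorelSpace M]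
    (g : RiemMetric n M) (he : HasCoeff pr B N e) (A : Connection EG G EP P)
    (η : AdOneForm EG G EP P) {K : Set M} (hK : IsCompact K) :
    HasDerivAt (fun t => integralOver pr g K (e (A.addSMul t η)))
      (∫ x in K, firstVar pr e A η x ∂(vol g)) 0 := by
  choose c₁ c₂ c₃ c₄ hc using he.exists_quartic hP A η
  have h1 : firstVar pr e A η = c₁ := by
    funext x
    unfold firstVar
    rw [hc x 1, hc x (-1), hc x 2, hc x (-2)]
    ring
  rw [h1]
  refine hasDerivAt_integral_of_quartic (f := fun t => Function.extend pr (e (A.addSMul t η)) 0)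
    (fun t => ?_) (fun t x => hc x t)
  exact (he.continuous_extend hP _).continuousOn.integrableOn_compact hK

end Variation

/-! ### Covariant integration by parts -/

section IntegrationByParts
open Filter Topology

/-- The integral of the derivative of a compactly supported function is zero. -/
lemma integral_fderiv_apply_eq_zero {E : Type*} [NormedAddCommGroup E] [NormedSpace ℝ E]
    [FiniteDimensional ℝ E] [MeasurableSpace E] [BorelSpace E] (μ : Measure E) [μ.IsAddHaarMeasure]
    {u : E → ℝ} (hu : ContDiff ℝ 1 u) (hc : HasCompactSupport u) (v : E) :
    ∫ x, fderiv ℝ u x v ∂μ = 0 := by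
  have h1 : Integrable (fun x => fderiv ℝ u x v) μ := by
    refine Continuous.integrable_of_hasCompactSupport ?_ ?_
    · exact (hu.continuous_fderiv (by simp)).clm_apply continuous_const
    · exact hc.fderiv_apply (𝕜 := ℝ) v
  have h2 : Integrable u μ := hu.continuous.integrable_of_hasCompactSupport hc
  have := integral_mul_fderiv_eq_neg_fderiv_mul_of_integrable (μ := μ) (f := fun _ : E => (1 : ℝ))
    (g := u) (v := v) (by simp) (by simpa using h1) (by simpa using h2)
    (fun x _ => differentiableAt_const _) (fun x _ => hu.differentiable (by simp) x)
  simpa using this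

variable {n : ℕ} {EG : Type*} [NormedAddCommGroup EG] [NormedSpace ℝ EG]
  {G : Type*} [TopologicalSpace G] [ChartedSpace EG G] [Group G] [LieGroup 𝓘(ℝ, EG) ∞ G]

/-- Extension by zero of a function that is smooth on an open set and vanishes off a compact
subset. -/
lemma contDiff_indicator {E : Type*} [NormedAddCommGroup E] [NormedSpace ℝ E] {F : Type*}
    [NormedAddCommGroup F] [NormedSpace ℝ F] {U C : Set E} (hU : IsOpen U) (hC : IsClosed C)
    (hCU : C ⊆ U) {f : E → F} {m : WithTop ℕ∞} (hf : ContDiffOn ℝ m f U) (h0 : ∀ y ∈ U, y ∉ C → f y = 0) :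
    ContDiff ℝ m (U.indicator f) := by
  refine contDiff_iff_contDiffAt.2 fun y => ?_
  by_cases hy : y ∈ U
  · refine (hf.contDiffAt (hU.mem_nhds hy)).congr_of_eventuallyEq ?_
    filter_upwards [hU.mem_nhds hy] with z hz using indicator_of_mem hz f
  · have h1 : U.indicator f =ᶠ[𝓝 y] fun _ => 0 := by
      filter_upwards [hC.isOpen_compl.mem_nhds fun h => hy (hCU h)] with z hz
      by_cases hzU : z ∈ U
      · rw [indicator_of_mem hzU, h0 z hzU hz]
      · exact indicator_of_notMem hzU f
    exact contDiffAt_const.congr_of_eventuallyEq h1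

lemma hasCompactSupport_indicator {E : Type*} [TopologicalSpace E] [T2Space E] {F : Type*} [Zero F] {U C : Set E}
    (hC : IsCompact C) {f : E → F} (h0 : ∀ y ∈ U, y ∉ C → f y = 0) :
    HasCompactSupport (U.indicator f) := by
  refine HasCompactSupport.intro hC fun y hy => ?_
  by_cases hyU : y ∈ U
  · rw [indicator_of_mem hyU, h0 y hyU hy]
  · exact indicator_of_notMem hyU f

/-- The covariant divergence of an array of functions, for the local connection form `a`. -/
def covDivergence (br : EG →L[ℝ] EG →L[ℝ] EG) (a : Euc n → Euc n →L[ℝ] EG)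
    (R : Fin (2 * n) → Fin (2 * n) → Euc n → EG) (j : Fin (2 * n)) (y : Euc n) : EG :=
  ∑ i, (fderiv ℝ (R i j) y (stdv n i) + br (a y (stdv n i)) (R i j y))

lemma continuousOn_covDivergence {U : Set (Euc n)} (hU : IsOpen U)
    {R : Fin (2 * n) → Fin (2 * n) → Euc n → EG} (hR : ∀ i j, ContDiffOn ℝ ∞ (R i j) U)
    {a : Euc n → Euc n →L[ℝ] EG} (ha : ContinuousOn a U) (br : EG →L[ℝ] EG →L[ℝ] EG) (j : Fin (2 * n)) :
    ContinuousOn (covDivergence br a R j) U := by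
  refine continuousOn_finsetSum _ fun i _ => ContinuousOn.add ?_ ?_
  · exact ((hR i j).continuousOn_fderiv_of_isOpen hU (by simp)).clm_apply continuousOn_const
  · exact (continuousOn_const.clm_apply (ha.clm_apply continuousOn_const)).clm_apply (hR i j).continuousOn

/-- Covariant integration by parts: the integral of the divergence of the compactly supported vector
field `∑ j, ⟨R i j, h j⟩` is zero, and the bracket terms cancel since `ad` is skew-adjoint. -/
lemma integral_covariant_by_parts (B : AdInvariantInner EG G) {U C : Set (Euc n)} (hU : IsOpen U)
    (hC : IsCompact C) (hCU : C ⊆ U) {R : Fin (2 * n) → Fin (2 * n) → Euc n → EG}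
    (hR : ∀ i j, ContDiffOn ℝ ∞ (R i j) U) {a h : Euc n → Euc n →L[ℝ] EG} (ha : ContinuousOn a U)
    (hh : ContDiffOn ℝ ∞ h U) (h0 : ∀ y ∈ U, y ∉ C → h y = 0) :
    ∫ y in U, ∑ i, ∑ j, B.inner (R i j y)
        (fderiv ℝ h y (stdv n i) (stdv n j) + adL G (a y (stdv n i)) (h y (stdv n j))) =
      -∫ y in U, ∑ j, B.inner (covDivergence (adL G) a R j y) (h y (stdv n j)) := by
  have hhj : ∀ j, ContDiffOn ℝ ∞ (fun y => h y (stdv n j)) U := fun j =>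
    hh.clm_apply contDiffOn_const
  set u : Fin (2 * n) → Euc n → ℝ := fun i y => ∑ j, B.inner (R i j y) (h y (stdv n j)) with hu
  have huU : ∀ i, ContDiffOn ℝ ∞ (u i) U := fun i => ContDiffOn.sum fun j _ =>
    (contDiffOn_const.clm_apply (hR i j)).clm_apply (hhj j)
  have hu0 : ∀ i, ∀ y ∈ U, y ∉ C → u i y = 0 := by
    intro i y hy hyC
    simp [hu, h0 y hy hyC]
  have hui : ∀ i, ContDiff ℝ 1 (U.indicator (u i)) := fun i =>
    contDiff_indicator hU hC.isClosed hCU ((huU i).of_le (by simp)) (hu0 i)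
  have huc : ∀ i, HasCompactSupport (U.indicator (u i)) := fun i =>
    hasCompactSupport_indicator hC (hu0 i)
  have hd : ∀ i, ∀ y ∈ U, fderiv ℝ (U.indicator (u i)) y (stdv n i) =
      ∑ j, (B.inner (fderiv ℝ (R i j) y (stdv n i)) (h y (stdv n j)) +
        B.inner (R i j y) (fderiv ℝ h y (stdv n i) (stdv n j))) := by
    intro i y hy
    have e1 : U.indicator (u i) =ᶠ[𝓝 y] u i := by
      filter_upwards [hU.mem_nhds hy] with z hz using indicator_of_mem hz _
    have e2 : ∀ j, HasFDerivAt (R i j) (fderiv ℝ (R i j) y) y := fun j =>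
      (((hR i j).contDiffAt (hU.mem_nhds hy)).differentiableAt (by simp)).hasFDerivAt
    have e3 : HasFDerivAt h (fderiv ℝ h y) y :=
      ((hh.contDiffAt (hU.mem_nhds hy)).differentiableAt (by simp)).hasFDerivAt
    have e4 : ∀ j, HasFDerivAt (fun y => B.inner (R i j y) (h y (stdv n j))) _ y := fun j =>
      ((hasFDerivAt_const B.inner y).clm_apply (e2 j)).clm_apply (e3.clm_apply (hasFDerivAt_const (stdv n j) y))
    have e5 := HasFDerivAt.fun_sum (u := Finset.univ) fun j _ => e4 j
    rw [e1.fderiv_eq, show fderiv ℝ (u i) y = _ from e5.fderiv, sum_apply]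
    refine Finset.sum_congr rfl fun j _ => ?_
    simp [add_comm]
  have hint : ∀ i, ∫ y in U, fderiv ℝ (U.indicator (u i)) y (stdv n i) = 0 := by
    intro i
    rw [← integral_fderiv_apply_eq_zero volume (hui i) (huc i) (stdv n i)]
    refine setIntegral_eq_integral_of_forall_compl_eq_zero fun y hy => ?_
    have e1 : U.indicator (u i) =ᶠ[𝓝 y] fun _ => 0 := by
      filter_upwards [hC.isClosed.isOpen_compl.mem_nhds fun h => hy (hCU h)] with z hz
      by_cases hzU : z ∈ U
      · rw [indicator_of_mem hzU, hu0 i z hzU hz]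
      · exact indicator_of_notMem hzU _
    rw [e1.fderiv_eq]
    simp
  have hdi : ∀ i, IntegrableOn (fun y => fderiv ℝ (U.indicator (u i)) y (stdv n i)) U := fun i =>
    (Continuous.integrable_of_hasCompactSupport
      (((hui i).continuous_fderiv (by simp)).clm_apply continuous_const)
      ((huc i).fderiv_apply (𝕜 := ℝ) (stdv n i))).integrableOn
  have hri : IntegrableOn (fun y => ∑ j, B.inner (covDivergence (adL G) a R j y) (h y (stdv n j))) U := by
    have e1 : IntegrableOn (fun y => ∑ j, B.inner (covDivergence (adL G) a R j y) (h y (stdv n j))) C := by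
      refine ContinuousOn.integrableOn_compact hC ?_
      refine ContinuousOn.mono ?_ hCU
      exact continuousOn_finsetSum _ fun j _ => (continuousOn_const.clm_apply
        (continuousOn_covDivergence hU hR ha _ j)).clm_apply (hhj j).continuousOn
    refine e1.of_forall_sdiff_eq_zero hU.measurableSet fun y hy => ?_
    simp [h0 y hy.1 hy.2]
  have key : ∀ y ∈ U, ∑ i, ∑ j, B.inner (R i j y)
        (fderiv ℝ h y (stdv n i) (stdv n j) + adL G (a y (stdv n i)) (h y (stdv n j))) =
      ∑ i, fderiv ℝ (U.indicator (u i)) y (stdv n i) -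
        ∑ j, B.inner (covDivergence (adL G) a R j y) (h y (stdv n j)) := by
    intro y hy
    have e1 : ∀ i j, B.inner (R i j y) (adL G (a y (stdv n i)) (h y (stdv n j))) =
        -B.inner (adL G (a y (stdv n i)) (R i j y)) (h y (stdv n j)) := fun i j =>
      eq_neg_of_add_eq_zero_right (B.adL_inv _ _ _)
    rw [Finset.sum_congr rfl fun i _ => hd i y hy]
    simp only [covDivergence, map_add, map_sum, sum_apply, add_apply, e1, Finset.sum_add_distrib,
      Finset.sum_neg_distrib]
    rw [Finset.sum_comm (f := fun j i => B.inner (fderiv ℝ (R i j) y (stdv n i)) (h y (stdv n j))),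
      Finset.sum_comm (f := fun j i => B.inner (adL G (a y (stdv n i)) (R i j y)) (h y (stdv n j)))]
    ring
  rw [setIntegral_congr_fun hU.measurableSet key, integral_sub (integrable_finsetSum _ fun i _ => hdi i) hri,
    integral_finsetSum _ fun i _ => hdi i]
  simp [hint]

variable {M : Type*} [TopologicalSpace M] [ChartedSpace (Euc n) M]
  [IsManifold 𝓘(ℝ, Euc n) ∞ M]
  {EP : Type*} [NormedAddCommGroup EP] [NormedSpace ℝ EP]
  {P : Type*} [TopologicalSpace P] [ChartedSpace EP P] [IsManifold 𝓘(ℝ, EP) ∞ P] [MulAction Gᵐᵒᵖ P]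
  {pr : P → M} (hP : IsPrincipalBundle (Euc n) EG G EP pr)

/-- The components `√(det g) N^{ijkl} F_{kl}` in a gauge. -/
def Gauge.momentum (g : RiemMetric n M) (N : QuadCoeff n M) (A : Connection EG G EP P) {x₀ : M}
    (γ : Gauge (Euc n) EG G EP pr x₀) (i j : Fin (2 * n)) (y : Euc n) : EG :=
  density g x₀ ((extChartAt 𝓘(ℝ, Euc n) x₀).symm y) •
    raise (N.coeff x₀ ((extChartAt 𝓘(ℝ, Euc n) x₀).symm y))
      (fun i j => γ.curv A.form y (stdv n i) (stdv n j)) i j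

/-- The Euler-Lagrange expression `∂_i (√(det g) N^{ijkl} F_{kl}) + [a_i, √(det g) N^{ijkl} F_{kl}]` in a
gauge with the local connection form `a`. -/
def Gauge.eulerLagrange (g : RiemMetric n M) (N : QuadCoeff n M) (A : Connection EG G EP P) {x₀ : M}
    (γ : Gauge (Euc n) EG G EP pr x₀) (j : Fin (2 * n)) (y : Euc n) : EG :=
  covDivergence (adL G) (pullForm A.form γ.sec) (γ.momentum g N A) j y

lemma Gauge.contDiffOn_momentum (g : RiemMetric n M) (N : QuadCoeff n M) (A : Connection EG G EP P)
    {x₀ : M} (γ : Gauge (Euc n) EG G EP pr x₀) (i j : Fin (2 * n)) :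
    ContDiffOn ℝ ∞ (γ.momentum g N A i j) γ.dom :=
  ((contDiffOn_density g x₀).mono γ.subset).smul (γ.contDiffOn_raise A N i j)

lemma Gauge.contDiffOn_pullForm {θ : (p : P) → TangentSpace 𝓘(ℝ, EP) p →L[ℝ] EG}
    (hθ : SmoothOneForm θ) {x₀ : M} (γ : Gauge (Euc n) EG G EP pr x₀) :
    ContDiffOn ℝ ∞ (pullForm θ γ.sec) γ.dom :=
  fun _ hy => (γ.contDiffAt_pullForm hθ hy).contDiffWithinAt

lemma Gauge.continuousOn_eulerLagrange (g : RiemMetric n M) (N : QuadCoeff n M)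
    (A : Connection EG G EP P) {x₀ : M} (γ : Gauge (Euc n) EG G EP pr x₀) (j : Fin (2 * n)) :
    ContinuousOn (γ.eulerLagrange g N A j) γ.dom :=
  continuousOn_covDivergence γ.isOpen (γ.contDiffOn_momentum g N A)
    (γ.contDiffOn_pullForm A.smooth).continuousOn _ j

/-- The open subset of the base over which a gauge is defined. -/
def Gauge.base {x₀ : M} (γ : Gauge (Euc n) EG G EP pr x₀) : Set M :=
  (extChartAt 𝓘(ℝ, Euc n) x₀).source ∩ extChartAt 𝓘(ℝ, Euc n) x₀ ⁻¹' γ.dom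

lemma Gauge.isOpen_base {x₀ : M} (γ : Gauge (Euc n) EG G EP pr x₀) : IsOpen γ.base :=
  (continuousOn_extChartAt x₀).isOpen_inter_preimage (isOpen_extChartAt_source x₀) γ.isOpen

lemma Gauge.symm_mem_base {x₀ : M} (γ : Gauge (Euc n) EG G EP pr x₀) {y : Euc n} (hy : y ∈ γ.dom) :
    (extChartAt 𝓘(ℝ, Euc n) x₀).symm y ∈ γ.base := by
  refine ⟨(extChartAt 𝓘(ℝ, Euc n) x₀).map_target (γ.subset hy), ?_⟩
  rw [mem_preimage, (extChartAt 𝓘(ℝ, Euc n) x₀).right_inv (γ.subset hy)]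
  exact hy

lemma curv_antisymm (A : Connection EG G EP P) {x₀ : M} (γ : Gauge (Euc n) EG G EP pr x₀)
    (y : Euc n) (u w : Euc n) : γ.curv A.form y u w = -γ.curv A.form y w u := by
  simp only [Gauge.curv, curvOf_apply]
  rw [adL_antisymm]
  abel

lemma Gauge.raise_antisymm (N : QuadCoeff n M) (A : Connection EG G EP P) {x₀ : M}
    (γ : Gauge (Euc n) EG G EP pr x₀) (x : M) (y : Euc n) (i j : Fin (2 * n)) :
    raise (N.coeff x₀ x) (fun i j => γ.curv A.form y (stdv n i) (stdv n j)) i j =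
      -raise (N.coeff x₀ x) (fun i j => γ.curv A.form y (stdv n i) (stdv n j)) j i := by
  simp only [raise]
  rw [Finset.sum_comm, ← Finset.sum_neg_distrib]
  refine Finset.sum_congr rfl fun k _ => ?_
  rw [← Finset.sum_neg_distrib]
  refine Finset.sum_congr rfl fun l _ => ?_
  rw [N.flip, curv_antisymm, smul_neg]

variable {B : AdInvariantInner EG G} {N : QuadCoeff n M} {e : Connection EG G EP P → P → ℝ}

lemma pullForm_eq_zero {η : AdOneForm EG G EP P} {K : Set M} (hη : ∀ p, pr p ∉ K → η.form p = 0)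
    {x₀ : M} (γ : Gauge (Euc n) EG G EP pr x₀) {y : Euc n} (hy : y ∈ γ.dom)
    (hyK : (extChartAt 𝓘(ℝ, Euc n) x₀).symm y ∉ K) : pullForm η.form γ.sec y = 0 := by
  have h := hη (γ.sec y) (by rwa [γ.proj_sec y hy])
  unfold pullForm
  rw [h]
  rfl

include hP

/-- The first variation has the support of the variation. -/
lemma HasCoeff.firstVar_eq_zero (he : HasCoeff pr B N e) (A : Connection EG G EP P)
    {η : AdOneForm EG G EP P} {K : Set M} (hK : IsClosed K) (hη : ∀ p, pr p ∉ K → η.form p = 0) {x : M}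
    (hx : x ∉ K) : firstVar pr e A η x = 0 := by
  obtain ⟨p, rfl⟩ := hP.surjective_proj x
  obtain ⟨γ, hy, hγ⟩ := hP.exists_gauge (pr p) p (mem_chart_source _ _)
  set φ := extChartAt 𝓘(ℝ, Euc n) (pr p)
  have hx' : φ.symm (φ (pr p)) = pr p := extChartAt_to_inv (pr p)
  have h1 := he.firstVar_sec hP A η γ hy
  have h2 : pullForm η.form γ.sec =ᶠ[𝓝 (φ (pr p))] fun _ => 0 := by
    have h3 : ∀ᶠ y in 𝓝 (φ (pr p)), φ.symm y ∉ K := by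
      have : ContinuousAt φ.symm (φ (pr p)) := continuousAt_extChartAt_symm (pr p)
      refine this.preimage_mem_nhds (t := Kᶜ) ?_
      rw [hx']
      exact hK.isOpen_compl.mem_nhds hx
    filter_upwards [h3, γ.isOpen.mem_nhds hy] with y hyK hyd using pullForm_eq_zero hη γ hyd hyK
  have h4 : fderiv ℝ (pullForm η.form γ.sec) (φ (pr p)) = 0 := by
    rw [h2.fderiv_eq]
    simp
  rw [hx', h4, h2.eq_of_nhds] at h1
  rw [h1]
  simp [covExt]

/-- The first variation of the functional, integrated by parts in a gauge. -/
lemma HasCoeff.integral_firstVar [T2Space M] [SigmaCompactSpace M] [MeasurableSpace M] [BorelSpace M]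
    (g : RiemMetric n M) (he : HasCoeff pr B N e) (A : Connection EG G EP P)
    {η : AdOneForm EG G EP P} {x₀ : M} (γ : Gauge (Euc n) EG G EP pr x₀) {K : Set M}
    (hK : IsCompact K) (hKγ : K ⊆ γ.base) (hη : ∀ p, pr p ∉ K → η.form p = 0) :
    ∫ x, firstVar pr e A η x ∂(vol g) =
      -(2 * ∫ y in γ.dom, ∑ j, B.inner (γ.eulerLagrange g N A j y)
        (pullForm η.form γ.sec y (stdv n j))) := by
  set φ := extChartAt 𝓘(ℝ, Euc n) x₀ with hφ
  have hvan : ∀ x, x ∉ K → firstVar pr e A η x = 0 := fun x hx =>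
    he.firstVar_eq_zero hP A hK.isClosed hη hx
  rw [integral_vol_eq g x₀ (he.continuous_firstVar hP A η).measurable fun x hx => hvan x fun hxK => hx
    (by have := (hKγ hxK).1; simpa using this)]
  rw [setIntegral_eq_of_subset_of_forall_sdiff_eq_zero (isOpen_extChartAt_target x₀).measurableSet γ.subset
    fun y hy => by
      rw [hvan _ fun h => hy.2 ?_, mul_zero]
      have := (hKγ h).2
      rwa [mem_preimage, φ.right_inv hy.1] at this]
  have hCc : IsCompact (φ '' K) := hK.image_of_continuousOn
    ((continuousOn_extChartAt x₀).mono fun x hx => (hKγ hx).1)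
  have hCd : φ '' K ⊆ γ.dom := by
    rintro _ ⟨x, hx, rfl⟩
    exact (hKγ hx).2
  have h0 : ∀ y ∈ γ.dom, y ∉ φ '' K → pullForm η.form γ.sec y = 0 := by
    intro y hy hyK
    refine pullForm_eq_zero hη γ hy fun h => hyK ⟨_, h, ?_⟩
    exact φ.right_inv (γ.subset hy)
  have hibp := integral_covariant_by_parts B γ.isOpen hCc hCd (γ.contDiffOn_momentum g N A)
    (γ.contDiffOn_pullForm A.smooth).continuousOn (γ.contDiffOn_pullForm η.smooth) h0
  have h2 : ∀ y ∈ γ.dom, density g x₀ (φ.symm y) * firstVar pr e A η (φ.symm y) =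
      2 * ∑ i, ∑ j, B.inner (γ.momentum g N A i j y)
        (fderiv ℝ (pullForm η.form γ.sec) y (stdv n i) (stdv n j) +
          adL G (pullForm A.form γ.sec y (stdv n i)) (pullForm η.form γ.sec y (stdv n j))) := by
    intro y hy
    rw [he.firstVar_sec hP A η γ hy]
    set α := raise (N.coeff x₀ (φ.symm y)) (fun i j => γ.curv A.form y (stdv n i) (stdv n j)) with hα
    set T : Fin (2 * n) → Fin (2 * n) → EG := fun i j =>
      fderiv ℝ (pullForm η.form γ.sec) y (stdv n i) (stdv n j) +
          adL G (pullForm A.form γ.sec y (stdv n i)) (pullForm η.form γ.sec y (stdv n j)) with hT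
    have h3 : ∀ i j, covExt (adL G) (pullForm A.form γ.sec y) (fderiv ℝ (pullForm η.form γ.sec) y)
          (pullForm η.form γ.sec y) (stdv n i) (stdv n j) = T i j - T j i := by
      intro i j
      simp only [covExt, hT]
      rw [adL_antisymm (pullForm η.form γ.sec y (stdv n i))]
      abel
    have h4 : ∀ i j, α i j = -α j i := γ.raise_antisymm N A _ y
    have h5 : ∑ i, ∑ j, B.inner (α i j) (T j i) = -∑ i, ∑ j, B.inner (α i j) (T i j) := by
      rw [Finset.sum_comm, ← Finset.sum_neg_distrib]
      refine Finset.sum_congr rfl fun i _ => ?_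
      rw [← Finset.sum_neg_distrib]
      refine Finset.sum_congr rfl fun j _ => ?_
      rw [h4 j i, map_neg, neg_apply]
    have h6 : ∀ i j, γ.momentum g N A i j y = density g x₀ (φ.symm y) • α i j := fun _ _ => rfl
    simp only [h3, map_sub, Finset.sum_sub_distrib, h5, h6, map_smul, smul_apply, smul_eq_mul,
      ← Finset.mul_sum]
    ring
  rw [setIntegral_congr_fun γ.isOpen.measurableSet h2, integral_const_mul, hibp]
  simp only [Gauge.eulerLagrange]
  ring

end IntegrationByParts

/-! ### Test forms -/

section TestForms
open Filter Topology

variable {n : ℕ} {M : Type*} [TopologicalSpace M] [ChartedSpace (Euc n) M]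
  [IsManifold 𝓘(ℝ, Euc n) ∞ M]
  {EG : Type*} [NormedAddCommGroup EG] [NormedSpace ℝ EG]
  {G : Type*} [TopologicalSpace G] [ChartedSpace EG G] [Group G] [LieGroup 𝓘(ℝ, EG) ∞ G]
  {EP : Type*} [NormedAddCommGroup EP] [NormedSpace ℝ EP]
  {P : Type*} [TopologicalSpace P] [ChartedSpace EP P] [IsManifold 𝓘(ℝ, EP) ∞ P] [MulAction Gᵐᵒᵖ P]
  {pr : P → M} (hP : IsPrincipalBundle (Euc n) EG G EP pr)

lemma contDiffAt_comp_extChartAt_symm {f : P → ℝ} (hf : ContMDiff 𝓘(ℝ, EP) 𝓘(ℝ) ∞ f) (p : P) :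
    ContDiffAt ℝ ∞ (fun z => f ((extChartAt 𝓘(ℝ, EP) p).symm z)) (extChartAt 𝓘(ℝ, EP) p p) := by
  have := (hf p).comp_of_eq (f := (extChartAt 𝓘(ℝ, EP) p).symm) (x := extChartAt 𝓘(ℝ, EP) p p)
    (I := 𝓘(ℝ, EP)) ((contMDiffOn_extChartAt_symm (n := ∞) p).contMDiffAt
      (extChartAt_target_mem_nhds p)) (extChartAt_to_inv p)
  exact this.contDiffAt

lemma SmoothOneForm.smul {ξ : (p : P) → TangentSpace 𝓘(ℝ, EP) p →L[ℝ] EG}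
    (hξ : SmoothOneForm ξ) {f : P → ℝ} (hf : ContMDiff 𝓘(ℝ, EP) 𝓘(ℝ) ∞ f) :
    SmoothOneForm (fun p => f p • ξ p) := by
  intro p
  refine (contMDiffAt_iff_chartForm _ p).2 ?_
  exact (contDiffAt_comp_extChartAt_symm hf p).smul ((contMDiffAt_iff_chartForm _ p).1 (hξ p))

/-- A one-form is smooth if its pull-backs by the inverses of the charts are. -/
lemma SmoothOneForm.of_pullForm {ξ : (p : P) → TangentSpace 𝓘(ℝ, EP) p →L[ℝ] EG}
    (h : ∀ p, ContDiffAt ℝ ∞ (pullForm ξ (extChartAt 𝓘(ℝ, EP) p).symm) (extChartAt 𝓘(ℝ, EP) p p)) :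
    SmoothOneForm ξ := by
  intro p
  refine (contMDiffAt_iff_chartForm _ p).2 ((h p).congr_of_eventuallyEq ?_)
  filter_upwards [extChartAt_target_mem_nhds (I := 𝓘(ℝ, EP)) p] with z hz
  ext v
  have h1 : (extChartAt 𝓘(ℝ, EP) p).symm z ∈ (chartAt EP p).source := by
    simpa using (extChartAt 𝓘(ℝ, EP) p).map_target hz
  have h2 := coordField_eq_mfderiv h1 v
  rw [(extChartAt 𝓘(ℝ, EP) p).right_inv hz] at h2
  exact congrArg (formAt ξ ((extChartAt 𝓘(ℝ, EP) p).symm z)) h2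

include hP in
/-- The product of an element of `Ω¹(M, Ad P)` and a function on `M`. -/
def AdOneForm.smulFun (f : M → ℝ) (hf : ContMDiff 𝓘(ℝ, Euc n) 𝓘(ℝ) ∞ f) (η : AdOneForm EG G EP P) :
    AdOneForm EG G EP P where
  form p := f (pr p) • η.form p
  smooth := η.smooth.smul (f := fun p => f (pr p)) (hf.comp hP.smooth_proj)
  horizontal p v :=
    (congrArg (fun b : EG => f (pr (p <• (1 : G))) • b) (η.horizontal p v)).trans (smul_zero _)
  equivariant p a w := by
    have h2 := η.equivariant p a w
    refine (congrArg (fun b : EG => f (pr (p <• a)) • b) h2).trans ?_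
    rw [← map_smul, hP.proj_action]
    rfl

lemma pullForm_smulFun {f : M → ℝ} (hf : ContMDiff 𝓘(ℝ, Euc n) 𝓘(ℝ) ∞ f) (η : AdOneForm EG G EP P)
    {x₀ : M} (γ : Gauge (Euc n) EG G EP pr x₀) {y : Euc n} (hy : y ∈ γ.dom) :
    pullForm (η.smulFun hP f hf).form γ.sec y =
      f ((extChartAt 𝓘(ℝ, Euc n) x₀).symm y) • pullForm η.form γ.sec y := by
  rw [← γ.proj_sec y hy]
  rfl

include hP in
lemma Gauge.fib_act {x₀ : M} (γ : Gauge (Euc n) EG G EP pr x₀) {p : P} (hp : pr p ∈ γ.base) (a : G) :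
    γ.fib (p <• a) = γ.fib p * a := by
  have h1 := γ.sec_fib p (by simpa using hp.1) hp.2
  conv_lhs => rw [← h1, ← act_mul]
  exact γ.fib_sec _ hp.2 _

/-- The equivariant horizontal one-form whose pull-back by the section of a gauge is the constant `L`. -/
def Gauge.constForm {x₀ : M} (γ : Gauge (Euc n) EG G EP pr x₀) (L : Euc n →L[ℝ] EG) (p : P) :
    EP →L[ℝ] EG :=
  (Ad (γ.fib p)⁻¹ : EG →L[ℝ] EG).comp (L.comp ((mder (Euc n) (Euc n) (extChartAt 𝓘(ℝ, Euc n) x₀) (pr p)).comp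
    (mder EP (Euc n) pr p)))

include hP in
lemma Gauge.contDiffAt_constForm {x₀ : M} (γ : Gauge (Euc n) EG G EP pr x₀) (L : Euc n →L[ℝ] EG) {p : P}
    (hp : pr p ∈ γ.base) :
    ContDiffAt ℝ ∞ (fun z => (γ.constForm L ((extChartAt 𝓘(ℝ, EP) p).symm z)).comp
      (mder EP EP (extChartAt 𝓘(ℝ, EP) p).symm z)) (extChartAt 𝓘(ℝ, EP) p p) := by
  set φ := extChartAt 𝓘(ℝ, Euc n) x₀ with hφ
  set ψ := extChartAt 𝓘(ℝ, EP) p with hψ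
  have hs : pr p ∈ (chartAt (Euc n) x₀).source := by simpa [φ] using hp.1
  have hψp : ψ.symm (ψ p) = p := extChartAt_to_inv p
  have hψs : ContMDiffAt 𝓘(ℝ, EP) 𝓘(ℝ, EP) ∞ ψ.symm (ψ p) :=
    (contMDiffOn_extChartAt_symm p).contMDiffAt (extChartAt_target_mem_nhds p)
  have h1 : ContMDiffAt 𝓘(ℝ, EP) 𝓘(ℝ, EG →L[ℝ] EG) ∞ (fun z => (Ad (γ.fib (ψ.symm z))⁻¹ : EG →L[ℝ] EG)) (ψ p) := by
    have e1 : ContMDiffAt 𝓘(ℝ, EP) 𝓘(ℝ, EG) ∞ γ.fib (ψ.symm (ψ p)) := by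
      rw [hψp]; exact γ.smooth_fib p hs hp.2
    exact contMDiff_Ad.contMDiffAt.comp (ψ p) ((e1.comp (ψ p) hψs).inv)
  have h2 : ContMDiffAt 𝓘(ℝ, EP) 𝓘(ℝ, Euc n) ∞ (fun z => φ (pr (ψ.symm z))) (ψ p) := by
    have e1 : ContMDiffAt 𝓘(ℝ, EP) 𝓘(ℝ, Euc n) ∞ (fun q => φ (pr q)) (ψ.symm (ψ p)) := by
      rw [hψp]; exact Gauge.contMDiffAt_coord hP hs
    exact e1.comp (ψ p) hψs
  have h3 : ContDiffAt ℝ ∞ (fderiv ℝ (fun z => φ (pr (ψ.symm z)))) (ψ p) :=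
    h2.contDiffAt.fderiv_right (by simp)
  have h4 : ContDiffAt ℝ ∞ (fun z => (Ad (γ.fib (ψ.symm z))⁻¹ : EG →L[ℝ] EG).comp
      (L.comp (fderiv ℝ (fun z => φ (pr (ψ.symm z))) z))) (ψ p) :=
    h1.contDiffAt.clm_comp (contDiffAt_const.clm_comp h3)
  refine h4.congr_of_eventuallyEq ?_
  have h5 : ∀ᶠ z in 𝓝 (ψ p), pr (ψ.symm z) ∈ (chartAt (Euc n) x₀).source := by
    have : ContinuousAt (fun z => pr (ψ.symm z)) (ψ p) :=
      hP.smooth_proj.continuous.continuousAt.comp hψs.continuousAt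
    refine this.preimage_mem_nhds ((chartAt (Euc n) x₀).open_source.mem_nhds ?_)
    rw [hψp]; exact hs
  filter_upwards [h5, extChartAt_target_mem_nhds (I := 𝓘(ℝ, EP)) p] with z hz hzt
  have d1 : MDifferentiableAt 𝓘(ℝ, EP) 𝓘(ℝ, EP) ψ.symm z :=
    ((contMDiffOn_extChartAt_symm (n := 1) p).contMDiffAt
      ((isOpen_extChartAt_target p).mem_nhds hzt)).mdifferentiableAt (by simp)
  have d2 : MDifferentiableAt 𝓘(ℝ, EP) 𝓘(ℝ, Euc n) pr (ψ.symm z) :=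
    hP.smooth_proj.mdifferentiable (by simp) _
  have d3 : MDifferentiableAt 𝓘(ℝ, Euc n) 𝓘(ℝ, Euc n) φ (pr (ψ.symm z)) :=
    mdifferentiableAt_extChartAt hz
  have c1 := mder_comp (f := pr ∘ ψ.symm) (h := φ) (x := z) d3 (d2.comp z d1)
  have c2 := mder_comp (f := ψ.symm) (h := pr) (x := z) d2 d1
  rw [c2] at c1
  have c3 : fderiv ℝ (fun z => φ (pr (ψ.symm z))) z = mder EP (Euc n) (φ ∘ (pr ∘ ψ.symm)) z :=
    mder_eq_fderiv.symm
  rw [c3, c1]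
  rfl

include hP in
/-- An element of `Ω¹(M, Ad P)` with a prescribed value at a point of a gauge, supported in the
domain of the gauge. -/
def Gauge.testForm {x₀ : M} (γ : Gauge (Euc n) EG G EP pr x₀) (L : Euc n →L[ℝ] EG) (χ : M → ℝ)
    (hχ : ContMDiff 𝓘(ℝ, Euc n) 𝓘(ℝ) ∞ χ) (hχs : tsupport χ ⊆ γ.base) : AdOneForm EG G EP P where
  form p := χ (pr p) • γ.constForm L p
  smooth := by
    refine SmoothOneForm.of_pullForm fun p => ?_
    by_cases hp : pr p ∈ γ.base
    · exact (contDiffAt_comp_extChartAt_symm (hχ.comp hP.smooth_proj) p).smul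
        (γ.contDiffAt_constForm hP L hp)
    · have h1 : ∀ᶠ z in 𝓝 (extChartAt 𝓘(ℝ, EP) p p), χ (pr ((extChartAt 𝓘(ℝ, EP) p).symm z)) = 0 := by
        have e1 : ContinuousAt (fun z => pr ((extChartAt 𝓘(ℝ, EP) p).symm z)) (extChartAt 𝓘(ℝ, EP) p p) :=
          hP.smooth_proj.continuous.continuousAt.comp (continuousAt_extChartAt_symm p)
        have e2 := e1.preimage_mem_nhds (t := (tsupport χ)ᶜ)
          ((isClosed_tsupport χ).isOpen_compl.mem_nhds (by
            rw [extChartAt_to_inv]; exact fun h => hp (hχs h)))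
        filter_upwards [e2] with z hz using image_eq_zero_of_notMem_tsupport hz
      refine (contDiffAt_const (c := (0 : EP →L[ℝ] EG))).congr_of_eventuallyEq ?_
      filter_upwards [h1] with z hz
      ext v
      have e3 : pullForm (fun p => (show TangentSpace 𝓘(ℝ, EP) p →L[ℝ] EG from χ (pr p) • γ.constForm L p))
          (extChartAt 𝓘(ℝ, EP) p).symm z v = χ (pr ((extChartAt 𝓘(ℝ, EP) p).symm z)) •
          γ.constForm L ((extChartAt 𝓘(ℝ, EP) p).symm z)
            (mder EP EP (extChartAt 𝓘(ℝ, EP) p).symm z v) := rfl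
      refine e3.trans ?_
      rw [hz, zero_smul]
      rfl
  horizontal p v := by
    have h1 : γ.constForm L p (fund EG G EP p v) = 0 := by
      simp [Gauge.constForm, hP.mder_proj_fund]
    have h2 : ∀ q : P, q = p → χ (pr q) • γ.constForm L q (fund EG G EP p v) = 0 := by
      rintro q rfl
      rw [h1, smul_zero]
    exact h2 _ (act_one p)
  equivariant p a w := by
    change χ (pr (p <• a)) • γ.constForm L (p <• a) (mder EP EP (fun q : P => q <• a) p w) =
      Ad a⁻¹ (χ (pr p) • γ.constForm L p w)
    rw [hP.proj_action, map_smul]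
    by_cases hp : pr p ∈ γ.base
    · congr 1
      have h1 : mder EP (Euc n) pr (p <• a) (mder EP EP (fun q : P => q <• a) p w) =
          mder EP (Euc n) pr p w := by
        have e1 := mder_comp (f := fun q : P => q <• a) (h := pr) (x := p)
          (hP.smooth_proj.mdifferentiable (by simp) _) ((hP.contMDiff_right a).mdifferentiable (by simp) p)
        have e2 : pr ∘ (fun q : P => q <• a) = pr := funext fun q => hP.proj_action q a
        rw [e2] at e1
        exact (congrArg (fun T : EP →L[ℝ] Euc n => T w) e1).symm
      simp only [Gauge.constForm, ContinuousLinearMap.comp_apply]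
      rw [h1, hP.proj_action, γ.fib_act hP hp, mul_inv_rev, Ad_mul]
      rfl
    · rw [image_eq_zero_of_notMem_tsupport fun h => hp (hχs h), zero_smul, zero_smul]

lemma Gauge.pullForm_testForm {x₀ : M} (γ : Gauge (Euc n) EG G EP pr x₀) (L : Euc n →L[ℝ] EG) {χ : M → ℝ}
    (hχ : ContMDiff 𝓘(ℝ, Euc n) 𝓘(ℝ) ∞ χ) (hχs : tsupport χ ⊆ γ.base) {y : Euc n} (hy : y ∈ γ.dom) :
    pullForm (γ.testForm hP L χ hχ hχs).form γ.sec y = χ ((extChartAt 𝓘(ℝ, Euc n) x₀).symm y) • L := by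
  ext u
  have h1 : pullForm (γ.testForm hP L χ hχ hχs).form γ.sec y u =
      χ (pr (γ.sec y)) • Ad (γ.fib (γ.sec y))⁻¹ (L (mder (Euc n) (Euc n) (extChartAt 𝓘(ℝ, Euc n) x₀)
        (pr (γ.sec y)) (mder EP (Euc n) pr (γ.sec y) (γ.dsec y u)))) := rfl
  rw [h1, γ.mder_proj_dsec hP hy, γ.mder_mder_symm hP hy, γ.fib_sec_one hy, γ.proj_sec y hy]
  simp [Ad_one]

end TestForms

/-! ### The Euler-Lagrange equations -/

section EulerLagrange
open Filter Topology

variable {n : ℕ} {M : Type*} [TopologicalSpace M] [ChartedSpace (Euc n) M]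
  [IsManifold 𝓘(ℝ, Euc n) ∞ M] [T2Space M] [SigmaCompactSpace M] [MeasurableSpace M] [BorelSpace M]

/-- Nonempty open sets have positive volume, since the density is positive; hence a continuous function
that vanishes almost everywhere vanishes. -/
instance (g : RiemMetric n M) : (vol g).IsOpenPosMeasure := by
  refine ⟨fun U hU ⟨x, hx⟩ h0 => ?_⟩
  set φ := extChartAt 𝓘(ℝ, Euc n) x with hφ
  set W := U ∩ (chartAt (Euc n) x).source
  have hW : IsOpen W := hU.inter (chartAt (Euc n) x).open_source
  have h1 : vol g W = 0 := measure_mono_null inter_subset_left h0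
  rw [vol_apply_of_subset g x hW.measurableSet inter_subset_right, ← hφ] at h1
  have hT : IsOpen (φ.target ∩ φ.symm ⁻¹' W) :=
    (continuousOn_extChartAt_symm x).isOpen_inter_preimage (isOpen_extChartAt_target x) hW
  have hne : (φ.target ∩ φ.symm ⁻¹' W).Nonempty :=
    ⟨φ x, mem_extChartAt_target x, by
      rw [mem_preimage, extChartAt_to_inv]; exact ⟨hx, mem_chart_source _ _⟩⟩
  have hm : AEMeasurable (fun y => ENNReal.ofReal (density g x (φ.symm y)))
      (volume.restrict (φ.target ∩ φ.symm ⁻¹' W)) :=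
    (((contDiffOn_density g x).continuousOn.mono inter_subset_left).aemeasurable hT.measurableSet).ennreal_ofReal
  rw [lintegral_eq_zero_iff' hm] at h1
  have h2 := ae_imp_of_ae_restrict h1
  have h3 : ∀ᵐ y ∂(volume : Measure (Euc n)), y ∉ φ.target ∩ φ.symm ⁻¹' W := by
    filter_upwards [h2] with y hy hyT
    have h4 := hy hyT
    simp only [Pi.zero_apply, ENNReal.ofReal_eq_zero] at h4
    exact absurd h4 (not_le.2 (density_pos g (mem_source_of_mem_target hyT.1)))
  refine (hT.measure_pos volume hne).ne' ?_
  have h4 := ae_iff.1 h3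
  simp only [not_not] at h4
  exact h4

/-- The fundamental lemma of the calculus of variations. -/
lemma eq_zero_of_integral_smul_eq_zero (g : RiemMetric n M) {W : Set M} (hW : IsOpen W) {c : M → ℝ}
    (hc : ContinuousOn c W)
    (h : ∀ f : M → ℝ, ContMDiff 𝓘(ℝ, Euc n) 𝓘(ℝ) ∞ f → HasCompactSupport f → tsupport f ⊆ W →
      ∫ x, f x * c x ∂(vol g) = 0) {x : M} (hx : x ∈ W) : c x = 0 := by
  have := ChartedSpace.secondCountable_of_sigmaCompact (Euc n) M
  have := ChartedSpace.locallyCompactSpace (Euc n) M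
  have h1 : LocallyIntegrableOn c W (vol g) := hc.locallyIntegrableOn hW.measurableSet
  have h2 := hW.ae_eq_zero_of_integral_contMDiff_smul_eq_zero 𝓘(ℝ, Euc n) h1 fun f hf hfc hfs =>
    h f hf hfc hfs
  exact Measure.eqOn_open_of_ae_eq (μ := vol g) (f := c) (g := fun _ => 0)
    ((ae_restrict_iff' hW.measurableSet).2 h2) hW hc continuousOn_const hx

variable {EG : Type*} [NormedAddCommGroup EG] [NormedSpace ℝ EG]
  {G : Type*} [TopologicalSpace G] [ChartedSpace EG G] [Group G] [LieGroup 𝓘(ℝ, EG) ∞ G]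
  {EP : Type*} [NormedAddCommGroup EP] [NormedSpace ℝ EP]
  {P : Type*} [TopologicalSpace P] [ChartedSpace EP P] [IsManifold 𝓘(ℝ, EP) ∞ P] [MulAction Gᵐᵒᵖ P]
  {pr : P → M} (hP : IsPrincipalBundle (Euc n) EG G EP pr)
  {B : AdInvariantInner EG G} {N : QuadCoeff n M} {e : Connection EG G EP P → P → ℝ}

/-- The pairing of the Euler-Lagrange expression with a one-form, as a function on the base. It is
meaningful on `γ.base`; the density of the chart is divided out, so that it is integrated against the
Riemannian measure. -/
def Gauge.pairing (g : RiemMetric n M) (B : AdInvariantInner EG G) (N : QuadCoeff n M)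
    (A : Connection EG G EP P) {x₀ : M} (γ : Gauge (Euc n) EG G EP pr x₀) (η : AdOneForm EG G EP P)
    (x : M) : ℝ :=
  (density g x₀ x)⁻¹ * ∑ j, B.inner (γ.eulerLagrange g N A j (extChartAt 𝓘(ℝ, Euc n) x₀ x))
    (pullForm η.form γ.sec (extChartAt 𝓘(ℝ, Euc n) x₀ x) (stdv n j))

lemma Gauge.continuousOn_pairing (g : RiemMetric n M) (B : AdInvariantInner EG G) (N : QuadCoeff n M)
    (A : Connection EG G EP P) {x₀ : M} (γ : Gauge (Euc n) EG G EP pr x₀) (η : AdOneForm EG G EP P) :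
    ContinuousOn (γ.pairing g B N A η) γ.base := by
  set φ := extChartAt 𝓘(ℝ, Euc n) x₀ with hφ
  have hφc : ContinuousOn φ γ.base := (continuousOn_extChartAt x₀).mono fun x hx => hx.1
  have hm : MapsTo φ γ.base γ.dom := fun x hx => hx.2
  have h1 : ContinuousOn (fun y => (density g x₀ (φ.symm y))⁻¹ *
      ∑ j, B.inner (γ.eulerLagrange g N A j y) (pullForm η.form γ.sec y (stdv n j))) γ.dom := by
    refine ContinuousOn.mul ?_ ?_
    · exact ((contDiffOn_density g x₀).continuousOn.mono γ.subset).inv₀ fun y hy =>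
        (density_pos g (mem_source_of_mem_target (γ.subset hy))).ne'
    · exact continuousOn_finsetSum _ fun j _ => (continuousOn_const.clm_apply
        (γ.continuousOn_eulerLagrange g N A j)).clm_apply
        ((γ.contDiffOn_pullForm η.smooth).continuousOn.clm_apply continuousOn_const)
  refine (h1.comp hφc hm).congr fun x hx => ?_
  simp only [Function.comp, Gauge.pairing]
  rw [φ.left_inv hx.1]

lemma Gauge.pairing_smulFun (g : RiemMetric n M) (A : Connection EG G EP P) {x₀ : M}
    (γ : Gauge (Euc n) EG G EP pr x₀) (η : AdOneForm EG G EP P) {f : M → ℝ}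
    (hf : ContMDiff 𝓘(ℝ, Euc n) 𝓘(ℝ) ∞ f) {x : M} (hx : x ∈ γ.base) :
    γ.pairing g B N A (η.smulFun hP f hf) x = f x * γ.pairing g B N A η x := by
  have h1 := pullForm_smulFun hP hf η γ hx.2
  rw [(extChartAt 𝓘(ℝ, Euc n) x₀).left_inv hx.1] at h1
  simp only [Gauge.pairing, h1, smul_apply, map_smul, smul_eq_mul, ← Finset.mul_sum]
  ring

include hP

/-- The first variation in the direction of a form supported in the domain of a gauge, as an integral
over the manifold. -/
lemma HasCoeff.integral_firstVar_eq_pairing (g : RiemMetric n M) (he : HasCoeff pr B N e)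
    (A : Connection EG G EP P) {η : AdOneForm EG G EP P} {x₀ : M}
    (γ : Gauge (Euc n) EG G EP pr x₀) {K : Set M} (hK : IsCompact K) (hKγ : K ⊆ γ.base)
    (hη : ∀ p, pr p ∉ K → η.form p = 0) :
    ∫ x, firstVar pr e A η x ∂(vol g) = -(2 * ∫ x in γ.base, γ.pairing g B N A η x ∂(vol g)) := by
  set φ := extChartAt 𝓘(ℝ, Euc n) x₀ with hφ
  rw [he.integral_firstVar hP g A γ hK hKγ hη, ← integral_indicator γ.isOpen_base.measurableSet,
    integral_vol_eq g x₀ (f := γ.base.indicator (γ.pairing g B N A η)) ?_ ?_]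
  · congr 2
    rw [setIntegral_eq_of_subset_of_forall_sdiff_eq_zero (isOpen_extChartAt_target x₀).measurableSet γ.subset
      fun y hy => ?_]
    · refine setIntegral_congr_fun γ.isOpen.measurableSet fun y hy => ?_
      rw [indicator_of_mem (γ.symm_mem_base hy), Gauge.pairing, φ.right_inv (γ.subset hy),
        mul_inv_cancel_left₀ (density_pos g (mem_source_of_mem_target (γ.subset hy))).ne']
    · rw [indicator_of_notMem, mul_zero]
      intro h
      have := h.2
      rw [mem_preimage, φ.right_inv hy.1] at this
      exact hy.2 this
  · classical
    have h1 := (γ.continuousOn_pairing g B N A η).measurable_piecewise (g := fun _ => (0 : ℝ))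
      continuousOn_const γ.isOpen_base.measurableSet
    rwa [show (fun _ => (0 : ℝ)) = (0 : M → ℝ) from rfl, piecewise_eq_indicator] at h1
  · intro x hx
    refine indicator_of_notMem (fun h => hx ?_) _
    simpa using h.1

lemma HasCoeff.integral_firstVar_smulFun (g : RiemMetric n M) (he : HasCoeff pr B N e)
    (A : Connection EG G EP P) (η : AdOneForm EG G EP P) {x₀ : M}
    (γ : Gauge (Euc n) EG G EP pr x₀) {f : M → ℝ} (hf : ContMDiff 𝓘(ℝ, Euc n) 𝓘(ℝ) ∞ f)
    (hfc : HasCompactSupport f) (hfs : tsupport f ⊆ γ.base) :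
    ∫ x, firstVar pr e A (η.smulFun hP f hf) x ∂(vol g) =
      -(2 * ∫ x, f x * γ.pairing g B N A η x ∂(vol g)) := by
  rw [he.integral_firstVar_eq_pairing hP g A γ hfc hfs]
  · congr 2
    rw [setIntegral_congr_fun γ.isOpen_base.measurableSet fun x hx => γ.pairing_smulFun hP g A η hf hx]
    refine setIntegral_eq_integral_of_forall_compl_eq_zero fun x hx => ?_
    rw [image_eq_zero_of_notMem_tsupport fun h => hx (hfs h), zero_mul]
  · intro p hp
    change f (pr p) • η.form p = 0
    rw [image_eq_zero_of_notMem_tsupport hp, zero_smul]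

/-- The pairing does not depend on the gauge nor on the chart: both pairings are continuous and
represent the first variation. -/
lemma HasCoeff.pairing_eq (g : RiemMetric n M) (he : HasCoeff pr B N e)
    (A : Connection EG G EP P) (η : AdOneForm EG G EP P) {x₀ x₁ : M}
    (γ : Gauge (Euc n) EG G EP pr x₀) (γ' : Gauge (Euc n) EG G EP pr x₁) {x : M}
    (hx : x ∈ γ.base) (hx' : x ∈ γ'.base) : γ.pairing g B N A η x = γ'.pairing g B N A η x := by
  have hW : IsOpen (γ.base ∩ γ'.base) := γ.isOpen_base.inter γ'.isOpen_base
  have hc := (γ.continuousOn_pairing g B N A η).mono (inter_subset_left (t := γ'.base))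
  have hc' := (γ'.continuousOn_pairing g B N A η).mono (inter_subset_right (s := γ.base))
  refine sub_eq_zero.1 (eq_zero_of_integral_smul_eq_zero g hW
    (c := fun x => γ.pairing g B N A η x - γ'.pairing g B N A η x) (hc.sub hc') ?_ ⟨hx, hx'⟩)
  intro f hf hfc hfs
  have h1 := he.integral_firstVar_smulFun hP g A η γ hf hfc (hfs.trans inter_subset_left)
  have h2 := he.integral_firstVar_smulFun hP g A η γ' hf hfc (hfs.trans inter_subset_right)
  have hint : ∀ c : M → ℝ, ContinuousOn c (γ.base ∩ γ'.base) → Integrable (fun x => f x * c x) (vol g) := by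
    intro c hc
    have i1 : IntegrableOn (fun x => f x * c x) (tsupport f) (vol g) :=
      ContinuousOn.integrableOn_compact hfc (hf.continuous.continuousOn.mul (hc.mono hfs))
    refine (integrableOn_iff_integrable_of_support_subset ?_).1 i1
    intro x hx
    exact subset_tsupport f fun h => hx (by simp [h])
  simp only [mul_sub]
  rw [integral_sub (hint _ hc) (hint _ hc')]
  linarith

/-- The Euler-Lagrange expression is determined by its pairings with one-forms. -/
lemma Gauge.eulerLagrange_eq_zero_iff (g : RiemMetric n M) (B : AdInvariantInner EG G) (N : QuadCoeff n M)
    (A : Connection EG G EP P) {x₀ : M}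
    (γ : Gauge (Euc n) EG G EP pr x₀) {x : M} (hx : x ∈ γ.base) :
    (∀ η, γ.pairing g B N A η x = 0) ↔
      ∀ j, γ.eulerLagrange g N A j (extChartAt 𝓘(ℝ, Euc n) x₀ x) = 0 := by
  set φ := extChartAt 𝓘(ℝ, Euc n) x₀ with hφ
  have hd : density g x₀ x ≠ 0 := (density_pos g (by simpa [φ] using hx.1)).ne'
  constructor
  · intro h j
    obtain ⟨χ, -, hχ⟩ := (SmoothBumpFunction.nhds_basis_tsupport (I := 𝓘(ℝ, Euc n)) x).mem_iff.1
      (γ.isOpen_base.mem_nhds hx)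
    set w := γ.eulerLagrange g N A j (φ x) with hw
    -- pair with the test form whose only component is the Euler-Lagrange expression itself
    let L : Euc n →L[ℝ] EG := (EuclideanSpace.proj j : Euc n →L[ℝ] ℝ).smulRight w
    have h1 := h (γ.testForm hP L χ χ.contMDiff hχ)
    have h2 := γ.pullForm_testForm hP L χ.contMDiff hχ hx.2
    rw [← hφ, φ.left_inv hx.1, χ.eq_one, one_smul] at h2
    have hL : ∀ k, L (stdv n k) = (if j = k then (1 : ℝ) else 0) • w := by
      intro k
      simp [L, Pi.single_apply]
    simp only [Gauge.pairing, ← hφ, h2, hL, map_smul, smul_eq_mul, ite_mul, one_mul, zero_mul,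
      Finset.sum_ite_eq, Finset.mem_univ, if_true] at h1
    rw [← hw] at h1
    by_contra h0
    have h3 := B.pos w h0
    rcases mul_eq_zero.1 h1 with h4 | h4
    · exact inv_ne_zero hd h4
    · exact h3.ne' h4
  · intro h η
    simp only [Gauge.pairing, ← hφ, h, map_zero, zero_apply, Finset.sum_const_zero, mul_zero]

/-- The first variation is linear with respect to a decomposition of the variation by functions
that add up to one on its support. -/
lemma HasCoeff.firstVar_eq_sum (he : HasCoeff pr B N e)
    (A : Connection EG G EP P) {η : AdOneForm EG G EP P} {K : Set M}
    (hη : ∀ p, pr p ∉ K → η.form p = 0) {ι : Type*} (s : Finset ι) {f : ι → M → ℝ}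
    (hf : ∀ i, ContMDiff 𝓘(ℝ, Euc n) 𝓘(ℝ) ∞ (f i)) (hs : ∀ x ∈ K, ∑ i ∈ s, f i x = 1) (x : M) :
    firstVar pr e A η x = ∑ i ∈ s, firstVar pr e A (η.smulFun hP (f i) (hf i)) x := by
  obtain ⟨p, rfl⟩ := hP.surjective_proj x
  obtain ⟨γ, hy, hγ⟩ := hP.exists_gauge (pr p) p (mem_chart_source _ _)
  set φ := extChartAt 𝓘(ℝ, Euc n) (pr p)
  have hx' : φ.symm (φ (pr p)) = pr p := extChartAt_to_inv (pr p)
  have h1 := fun η => he.firstVar_sec hP A η γ hy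
  rw [hx'] at h1
  simp only [h1]
  have h2 : ∀ y ∈ γ.dom, pullForm η.form γ.sec y =
      ∑ i ∈ s, pullForm (η.smulFun hP (f i) (hf i)).form γ.sec y := by
    intro y hyd
    simp only [pullForm_smulFun hP (hf _) η γ hyd, ← Finset.sum_smul]
    by_cases hK : φ.symm y ∈ K
    · rw [hs _ hK, one_smul]
    · rw [pullForm_eq_zero hη γ hyd hK, smul_zero]
  have h3 : pullForm η.form γ.sec =ᶠ[𝓝 (φ (pr p))] fun y =>
      ∑ i ∈ s, pullForm (η.smulFun hP (f i) (hf i)).form γ.sec y := by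
    filter_upwards [γ.isOpen.mem_nhds hy] with y hyd using h2 y hyd
  have h4 : fderiv ℝ (pullForm η.form γ.sec) (φ (pr p)) =
      ∑ i ∈ s, fderiv ℝ (pullForm (η.smulFun hP (f i) (hf i)).form γ.sec) (φ (pr p)) := by
    rw [h3.fderiv_eq, fderiv_fun_sum fun i _ =>
      (γ.contDiffAt_pullForm (η.smulFun hP (f i) (hf i)).smooth hy).differentiableAt (by simp)]
  have h5 : ∀ u w, covExt (adL G) (pullForm A.form γ.sec (φ (pr p)))
      (fderiv ℝ (pullForm η.form γ.sec) (φ (pr p))) (pullForm η.form γ.sec (φ (pr p))) u w =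
      ∑ i ∈ s, covExt (adL G) (pullForm A.form γ.sec (φ (pr p)))
        (fderiv ℝ (pullForm (η.smulFun hP (f i) (hf i)).form γ.sec) (φ (pr p)))
        (pullForm (η.smulFun hP (f i) (hf i)).form γ.sec (φ (pr p))) u w := by
    intro u w
    simp only [covExt, h4, h2 _ hy, sum_apply, map_sum, Finset.sum_add_distrib, Finset.sum_sub_distrib]
  simp only [h5, map_sum]
  exact (Finset.sum_congr rfl fun i _ => Finset.sum_comm).trans Finset.sum_comm

omit [T2Space M] [SigmaCompactSpace M] [MeasurableSpace M] [BorelSpace M] in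
/-- A gauge centred at a point of the bundle. -/
lemma IsPrincipalBundle.exists_gauge_centered (x : M) : ∃ γ : Gauge (Euc n) EG G EP pr x, x ∈ γ.base := by
  obtain ⟨p, rfl⟩ := hP.surjective_proj x
  obtain ⟨γ, hy, hγ⟩ := hP.exists_gauge (pr p) p (mem_chart_source _ _)
  exact ⟨γ, mem_extChartAt_source _, hy⟩

/-- If all pairings vanish, so does the first variation in every direction with compact support: a
partition of unity reduces this to directions supported in the domain of a gauge. -/
lemma HasCoeff.integral_firstVar_eq_zero (g : RiemMetric n M) (he : HasCoeff pr B N e)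
    (A : Connection EG G EP P)
    (h : ∀ (x₀ : M) (γ : Gauge (Euc n) EG G EP pr x₀) (η : AdOneForm EG G EP P), ∀ x ∈ γ.base,
      γ.pairing g B N A η x = 0) {η : AdOneForm EG G EP P} {K : Set M} (hK : IsCompact K)
    (hη : ∀ p, pr p ∉ K → η.form p = 0) : ∫ x, firstVar pr e A η x ∂(vol g) = 0 := by
  choose γ hγ using fun x : M => hP.exists_gauge_centered x
  obtain ⟨ρ, hρ⟩ := SmoothPartitionOfUnity.exists_isSubordinate 𝓘(ℝ, Euc n) (isClosed_univ (X := M))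
    (fun x => (γ x).base) (fun x => (γ x).isOpen_base) (fun x _ => mem_iUnion.2 ⟨x, hγ x⟩)
  have hfin : {i | (Function.support (ρ i) ∩ K).Nonempty}.Finite :=
    ρ.locallyFinite.finite_nonempty_inter_compact hK
  set s := hfin.toFinset
  have hs : ∀ x ∈ K, ∑ i ∈ s, ρ i x = 1 := by
    intro x hx
    rw [← ρ.sum_eq_one (mem_univ x)]
    refine (finsum_eq_sum_of_support_subset _ fun i hi => ?_).symm
    simp only [s, Finite.coe_toFinset]
    exact ⟨x, hi, hx⟩
  have hsupp : ∀ i, ∀ p, pr p ∉ K ∩ tsupport (ρ i) →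
      (η.smulFun hP (ρ i) (ρ i).contMDiff).form p = 0 := by
    intro i p hp
    change ρ i (pr p) • η.form p = 0
    by_cases h1 : pr p ∈ K
    · rw [image_eq_zero_of_notMem_tsupport fun h2 => hp ⟨h1, h2⟩, zero_smul]
    · rw [hη p h1, smul_zero]
  have hKc : ∀ i, IsCompact (K ∩ tsupport (ρ i)) := fun i => hK.inter_right (isClosed_tsupport _)
  have hint : ∀ i, Integrable (firstVar pr e A (η.smulFun hP (ρ i) (ρ i).contMDiff)) (vol g) := fun i =>
    (he.continuous_firstVar hP A _).integrable_of_hasCompactSupport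
      (HasCompactSupport.intro (hKc i) fun x hx =>
        he.firstVar_eq_zero hP A (hKc i).isClosed (hsupp i) hx)
  rw [integral_congr_ae (Eventually.of_forall fun x =>
    he.firstVar_eq_sum hP A hη s (fun i => (ρ i).contMDiff) hs x), integral_finsetSum _ fun i _ => hint i]
  refine Finset.sum_eq_zero fun i _ => ?_
  rw [he.integral_firstVar_eq_pairing hP g A (γ i) (hKc i) (inter_subset_right.trans (hρ i)) (hsupp i),
    setIntegral_congr_fun (γ i).isOpen_base.measurableSet fun x hx => h i (γ i) _ x hx]
  simp

/-- Critical points are characterised by the vanishing of the first variation. -/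
lemma HasCoeff.isCriticalPoint_iff_firstVar (g : RiemMetric n M) (he : HasCoeff pr B N e)
    {S : Set M → ((p : P) → TangentSpace 𝓘(ℝ, EP) p →L[ℝ] EG) → ℝ}
    (hS : ∀ K (A : Connection EG G EP P), S K A.form = integralOver pr g K (e A))
    (A : Connection EG G EP P) :
    IsCriticalPoint pr S A ↔ ∀ K, IsCompact K → ∀ η : AdOneForm EG G EP P,
      (∀ p, pr p ∉ K → η.form p = 0) → ∫ x, firstVar pr e A η x ∂(vol g) = 0 := by
  refine forall₂_congr fun K hK => forall₂_congr fun η hη => ?_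
  have h1 := he.hasDerivAt hP g A η hK
  have h2 : ∫ x in K, firstVar pr e A η x ∂(vol g) = ∫ x, firstVar pr e A η x ∂(vol g) :=
    setIntegral_eq_integral_of_forall_compl_eq_zero fun x hx =>
      he.firstVar_eq_zero hP A hK.isClosed hη hx
  rw [h2] at h1
  have h3 : (fun t : ℝ => S K (fun p => A.form p + t • η.form p)) =
      fun t => integralOver pr g K (e (A.addSMul t η)) := funext fun t => hS K (A.addSMul t η)
  rw [h3]
  exact ⟨fun h => h1.unique h, fun h => h ▸ h1⟩

/-- The Euler-Lagrange equations of a functional that is quadratic in the curvature; it suffices to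
check them at the centres of the charts. -/
theorem HasCoeff.isCriticalPoint_iff (g : RiemMetric n M) (he : HasCoeff pr B N e)
    {S : Set M → ((p : P) → TangentSpace 𝓘(ℝ, EP) p →L[ℝ] EG) → ℝ}
    (hS : ∀ K (A : Connection EG G EP P), S K A.form = integralOver pr g K (e A))
    (A : Connection EG G EP P) :
    IsCriticalPoint pr S A ↔ ∀ (x : M) (γ : Gauge (Euc n) EG G EP pr x), x ∈ γ.base →
      ∀ j, γ.eulerLagrange g N A j (extChartAt 𝓘(ℝ, Euc n) x x) = 0 := by
  rw [he.isCriticalPoint_iff_firstVar hP g hS A]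
  constructor
  · intro h x γ hx
    refine (γ.eulerLagrange_eq_zero_iff hP g B N A hx).1 fun η => ?_
    refine eq_zero_of_integral_smul_eq_zero g γ.isOpen_base (γ.continuousOn_pairing g B N A η) ?_ hx
    intro f hf hfc hfs
    have h1 := he.integral_firstVar_smulFun hP g A η γ hf hfc hfs
    rw [h _ hfc _ fun p hp => ?_] at h1
    · linarith
    · change f (pr p) • η.form p = 0
      rw [image_eq_zero_of_notMem_tsupport hp, zero_smul]
  · intro h K hK η hη
    refine he.integral_firstVar_eq_zero hP g A (fun x₀ γ η x hx => ?_) hK hη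
    obtain ⟨γ', hx'⟩ := hP.exists_gauge_centered x
    rw [he.pairing_eq hP g A η γ γ' hx hx']
    exact (γ'.eulerLagrange_eq_zero_iff hP g B N A hx').2 (h x γ' hx') η

end EulerLagrange

/-! ### Derivatives of equivariant functions -/

section Equivariant
open Filter Topology

variable {EM : Type*} [NormedAddCommGroup EM] [NormedSpace ℝ EM]
  {M : Type*} [TopologicalSpace M] [ChartedSpace EM M] [IsManifold 𝓘(ℝ, EM) ∞ M]
  {EG : Type*} [NormedAddCommGroup EG] [NormedSpace ℝ EG]
  {G : Type*} [TopologicalSpace G] [ChartedSpace EG G] [Group G] [LieGroup 𝓘(ℝ, EG) ∞ G]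
  {EP : Type*} [NormedAddCommGroup EP] [NormedSpace ℝ EP]
  {P : Type*} [TopologicalSpace P] [ChartedSpace EP P] [IsManifold 𝓘(ℝ, EP) ∞ P] [MulAction Gᵐᵒᵖ P]
  {pr : P → M} (hP : IsPrincipalBundle EM EG G EP pr)

/-- The equivariant function on the bundle with the expression `R` in a gauge. -/
def Gauge.extend {x₀ : M} (γ : Gauge EM EG G EP pr x₀) (R : EM → EG) (q : P) : EG :=
  Ad (γ.fib q)⁻¹ (R (extChartAt 𝓘(ℝ, EM) x₀ (pr q)))

include hP

/-- The derivative of an equivariant function: along the section it is that of its local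
expression, along the fibre it is given by the bracket. -/
lemma Gauge.dirDeriv_extend {x₀ : M} (γ : Gauge EM EG G EP pr x₀) {y : EM} (hy : y ∈ γ.dom)
    {R : EM → EG} (hR : ContDiffAt ℝ ∞ R y) {Q : P → EG} (hQ : Q =ᶠ[𝓝 (γ.sec y)] γ.extend R)
    (v : EM) (ξ : EG) :
    dirDeriv Q (γ.sec y) (γ.dsec y v + fund EG G EP (γ.sec y) ξ) = fderiv ℝ R y v - adL G ξ (R y) := by
  set p := γ.sec y with hp
  set φ := extChartAt 𝓘(ℝ, EM) x₀
  have hcp : φ (pr p) = y := γ.coord_proj_sec hy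
  have hps := γ.mem_source hy
  have hQd : MDifferentiableAt 𝓘(ℝ, EP) 𝓘(ℝ, EG) Q p := by
    have h1 : ContMDiffAt 𝓘(ℝ, EP) 𝓘(ℝ, EG) ∞ γ.fib p := γ.smooth_fib p hps (by rw [hcp]; exact hy)
    have h2 : ContMDiffAt 𝓘(ℝ, EP) 𝓘(ℝ, EG →L[ℝ] EG) ∞ (fun q => (Ad (γ.fib q)⁻¹ : EG →L[ℝ] EG)) p :=
      ContMDiffAt.comp (I' := 𝓘(ℝ, EG)) p (contMDiff_Ad _) h1.inv
    have h3 : ContMDiffAt 𝓘(ℝ, EP) 𝓘(ℝ, EG) ∞ (fun q => R (φ (pr q))) p := by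
      refine ContMDiffAt.comp (I' := 𝓘(ℝ, EM)) p ?_ (Gauge.contMDiffAt_coord hP hps)
      rw [hcp]
      exact hR.contMDiffAt
    exact ((h2.clm_apply h3).congr_of_eventuallyEq hQ).mdifferentiableAt (by simp)
  have h1 : mder EP EG Q p (γ.dsec y v) = fderiv ℝ R y v := by
    have e1 := mder_comp (f := γ.sec) (h := Q) (x := y) hQd (γ.mdifferentiableAt_sec hy)
    have e2 : Q ∘ γ.sec =ᶠ[𝓝 y] R := by
      have := (γ.contMDiffAt_sec hy).continuousAt.eventually hQ
      filter_upwards [this, γ.isOpen.mem_nhds hy] with z hz hzd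
      simp only [Function.comp, hz, Gauge.extend, γ.fib_sec_one hzd, inv_one, Ad_one,
        γ.coord_proj_sec hzd, ContinuousLinearMap.id_apply]
    rw [mder_congr e2, mder_eq_fderiv] at e1
    exact (congrArg (fun L : EM →L[ℝ] EG => L v) e1).symm
  have h2 : mder EP EG Q p (fund EG G EP p ξ) = -adL G ξ (R y) := by
    set κ := extChartAt 𝓘(ℝ, EG) (1 : G)
    set f : EG → P := (fun a : G => p <• a) ∘ κ.symm with hf
    have hf1 : f (κ 1) = p := by
      simp only [hf, Function.comp]
      rw [show κ.symm (κ 1) = 1 from extChartAt_to_inv 1, act_one]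
    have hκ : MDifferentiableAt 𝓘(ℝ, EG) 𝓘(ℝ, EG) κ.symm (κ 1) :=
      contMDiffAt_kappa_symm.mdifferentiableAt (by simp)
    have ho : MDifferentiable 𝓘(ℝ, EG) 𝓘(ℝ, EP) (fun a : G => p <• a) :=
      (hP.contMDiff_orbit p).mdifferentiable (by simp)
    have hfd : MDifferentiableAt 𝓘(ℝ, EG) 𝓘(ℝ, EP) f (κ 1) := MDifferentiableAt.comp _ (ho _) hκ
    have e1 := mder_comp (f := f) (h := Q) (x := κ 1) (by rw [hf1]; exact hQd) hfd
    have e2 : mder EG EP f (κ 1) = fund EG G EP p := by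
      have := mder_comp (f := κ.symm) (h := fun a : G => p <• a) (x := κ 1) (ho _) hκ
      rw [mder_extChartAt_symm_self, show κ.symm (κ 1) = 1 from extChartAt_to_inv 1,
        ContinuousLinearMap.comp_id] at this
      exact this
    have e3 : Q ∘ f =ᶠ[𝓝 (κ 1)] fun x => Ad (κ.symm x)⁻¹ (R y) := by
      have h3 : ∀ᶠ x in 𝓝 (κ 1), Q (f x) = γ.extend R (f x) := by
        have h4 : ∀ᶠ q in 𝓝 (f (κ 1)), Q q = γ.extend R q := by
          rw [hf1]
          exact hQ
        exact hfd.continuousAt.preimage_mem_nhds (t := {q | Q q = γ.extend R q}) h4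
      filter_upwards [h3] with x hx
      simp only [Function.comp] at hx ⊢
      rw [hx, Gauge.extend]
      simp only [hf, Function.comp]
      rw [γ.fib_sec y hy, hP.proj_action]
      exact congrArg (fun z => Ad (κ.symm x)⁻¹ (R z)) hcp
    have e4 := (hasFDerivAt_Ad_inv_kappa (EG := EG) (G := G)).clm_apply
      (hasFDerivAt_const (R y) (κ 1))
    rw [mder_congr e3, mder_eq_fderiv, e4.fderiv, hf1, e2] at e1
    have e5 := congrArg (fun L : EG →L[ℝ] EG => L ξ) e1
    simp at e5
    exact e5.symm
  refine (map_add (mder EP EG Q p) _ _).trans ?_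
  rw [h1, h2, sub_eq_add_neg]

/-- The derivative of an equivariant function along a horizontal lift. -/
lemma Gauge.dirDeriv_extend_horLift (A : Connection EG G EP P) {x₀ : M}
    (γ : Gauge EM EG G EP pr x₀) {y : EM} (hy : y ∈ γ.dom)
    {R : EM → EG} (hR : ContDiffAt ℝ ∞ R y) {Q : P → EG} (hQ : Q =ᶠ[𝓝 (γ.sec y)] γ.extend R) (v : EM) :
    dirDeriv Q (γ.sec y) (horLift EM pr A.form (γ.sec y)
      (mder EM EM (extChartAt 𝓘(ℝ, EM) x₀).symm y v)) =
      fderiv ℝ R y v + adL G (pullForm A.form γ.sec y v) (R y) := by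
  have h1 := γ.horLift_eq hP A hy v
  rw [sub_eq_add_neg, ← map_neg] at h1
  refine (congrArg (fun w : EP => dirDeriv Q (γ.sec y) w) h1).trans ?_
  rw [γ.dirDeriv_extend hP hy hR hQ, map_neg, neg_apply, sub_neg_eq_add]

/-- The covariant derivative of an equivariant function only depends on the projection of the
tangent vector. -/
lemma Gauge.covDeriv_extend (A : Connection EG G EP P) {x₀ : M}
    (γ : Gauge EM EG G EP pr x₀) {y : EM} (hy : y ∈ γ.dom)
    {R : EM → EG} (hR : ContDiffAt ℝ ∞ R y) {Q : P → EG} (hQ : Q =ᶠ[𝓝 (γ.sec y)] γ.extend R)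
    (v : EM) (ξ : EG) :
    covDeriv G A.form Q (γ.sec y) (γ.dsec y v + fund EG G EP (γ.sec y) ξ) =
      fderiv ℝ R y v + adL G (pullForm A.form γ.sec y v) (R y) := by
  have h1 : Q (γ.sec y) = R y := by
    rw [hQ.eq_of_nhds, Gauge.extend, γ.fib_sec_one hy, inv_one, Ad_one, γ.coord_proj_sec hy]
    rfl
  have h2 : formAt A.form (γ.sec y) (γ.dsec y v + fund EG G EP (γ.sec y) ξ) =
      pullForm A.form γ.sec y v + ξ := by
    rw [map_add, A.form_fund]
    rfl
  refine (congrArg₂ (· + ·) (γ.dirDeriv_extend hP hy hR hQ v ξ)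
    ((lieBr_eq_adL _ _).trans (congrArg₂ (fun a b => adL G a b) h2 h1))).trans ?_
  rw [map_add, add_apply]
  abel

end Equivariant

/-! ### The coefficients of the three functionals -/

section Coefficients
open Filter Topology

variable {n : ℕ} {M : Type*} [TopologicalSpace M] [ChartedSpace (Euc n) M]
  [IsManifold 𝓘(ℝ, Euc n) ∞ M]

lemma contDiffOn_omegaMat_inv {Ω : SymplecticForm n M} {g : RiemMetric n M} (hg : Compatible Ω g)
    (x₀ : M) (i j : Fin (2 * n)) :
    ContDiffOn ℝ ∞ (fun y => (omegaMat Ω x₀ ((extChartAt 𝓘(ℝ, Euc n) x₀).symm y))⁻¹ i j)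
      (extChartAt 𝓘(ℝ, Euc n) x₀).target :=
  contDiffOn_inv_entry (contDiffOn_omegaMat Ω x₀)
    (fun _ hy => (omegaMat_isUnit_det hg (mem_source_of_mem_target hy)).ne_zero) i j

/-- The coefficients of the squared norm of the curvature. -/
def QuadCoeff.curvature (g : RiemMetric n M) : QuadCoeff n M where
  coeff := coeffF g
  smooth x₀ i j k l := (contDiffOn_gram_inv g x₀ i k).mul (contDiffOn_gram_inv g x₀ j l)
  symm x₀ x i j k l := by
    simp only [coeffF]
    rw [gram_inv_symm g x₀ x i k, gram_inv_symm g x₀ x j l]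
  flip x₀ x i j k l := mul_comm _ _

/-- The coefficients of the squared norm of `Φ ω`. -/
def QuadCoeff.phi {Ω : SymplecticForm n M} {g : RiemMetric n M} (hg : Compatible Ω g) : QuadCoeff n M where
  coeff := coeffPhi Ω
  smooth x₀ i j k l := contDiffOn_const.mul
    ((contDiffOn_omegaMat_inv hg x₀ i j).mul (contDiffOn_omegaMat_inv hg x₀ k l))
  symm x₀ x i j k l := by
    simp only [coeffPhi]
    rw [mul_comm ((omegaMat Ω x₀ x)⁻¹ i j)]
  flip x₀ x i j k l := by
    simp only [coeffPhi]
    rw [omegaMat_inv_antisymm Ω x₀ x i j, omegaMat_inv_antisymm Ω x₀ x k l, neg_mul_neg]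

instance : Sub (QuadCoeff n M) where
  sub N N' :=
    { coeff := fun x₀ x => N.coeff x₀ x - N'.coeff x₀ x
      smooth := fun x₀ i j k l => (N.smooth x₀ i j k l).sub (N'.smooth x₀ i j k l)
      symm := fun x₀ x i j k l => congrArg₂ (· - ·) (N.symm x₀ x i j k l) (N'.symm x₀ x i j k l)
      flip := fun x₀ x i j k l => congrArg₂ (· - ·) (N.flip x₀ x i j k l) (N'.flip x₀ x i j k l) }

variable {EG : Type*} [NormedAddCommGroup EG] [NormedSpace ℝ EG]
  {G : Type*} [TopologicalSpace G] [ChartedSpace EG G] [Group G] [LieGroup 𝓘(ℝ, EG) ∞ G]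
  {EP : Type*} [NormedAddCommGroup EP] [NormedSpace ℝ EP]
  {P : Type*} [TopologicalSpace P] [ChartedSpace EP P] [IsManifold 𝓘(ℝ, EP) ∞ P] [MulAction Gᵐᵒᵖ P]
  {pr : P → M}

lemma raise_sub (N N' : QuadCoeff n M) (x₀ x : M) (F : Fin (2 * n) → Fin (2 * n) → EG)
    (i j : Fin (2 * n)) : raise ((N - N').coeff x₀ x) F i j =
      raise (N.coeff x₀ x) F i j - raise (N'.coeff x₀ x) F i j := by
  have h : ∀ k l, (N - N').coeff x₀ x i j k l = N.coeff x₀ x i j k l - N'.coeff x₀ x i j k l :=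
    fun _ _ => rfl
  simp only [raise, h, sub_smul, Finset.sum_sub_distrib]

/-- The Euler-Lagrange expression is linear in the coefficients of the functional. -/
lemma Gauge.eulerLagrange_sub (g : RiemMetric n M) (N N' : QuadCoeff n M) (A : Connection EG G EP P)
    {x₀ : M} (γ : Gauge (Euc n) EG G EP pr x₀) (j : Fin (2 * n)) {y : Euc n} (hy : y ∈ γ.dom) :
    γ.eulerLagrange g (N - N') A j y = γ.eulerLagrange g N A j y - γ.eulerLagrange g N' A j y := by
  have hd : ∀ (N : QuadCoeff n M) i, DifferentiableAt ℝ (γ.momentum g N A i j) y := fun N i =>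
    ((γ.contDiffOn_momentum g N A i j).contDiffAt (γ.isOpen.mem_nhds hy)).differentiableAt (by simp)
  have hm : ∀ i, γ.momentum g (N - N') A i j = fun y => γ.momentum g N A i j y - γ.momentum g N' A i j y := by
    intro i
    funext y
    simp only [Gauge.momentum, raise_sub, smul_sub]
  simp only [Gauge.eulerLagrange, covDivergence, hm, fderiv_fun_sub (hd N _) (hd N' _), sub_apply, map_sub,
    ← Finset.sum_sub_distrib]
  refine Finset.sum_congr rfl fun i _ => ?_
  abel

lemma hasCoeff_curvature (pr : P → M) (g : RiemMetric n M) (B : AdInvariantInner EG G) :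
    HasCoeff pr B (QuadCoeff.curvature g) (fun (A : Connection EG G EP P) =>
      normSq pr g B A.form (YangMills.curvature G A.form)) :=
  fun A _ _ hp => normSq_curvature g B A hp

variable (hP : IsPrincipalBundle (Euc n) EG G EP pr)
include hP

lemma hasCoeff_phi (hn : n ≠ 0) {Ω : SymplecticForm n M} {g : RiemMetric n M} (hg : Compatible Ω g)
    (B : AdInvariantInner EG G) :
    HasCoeff pr B (QuadCoeff.phi hg) (fun (A : Connection EG G EP P) =>
      normSq pr g B A.form (PhiOmega G pr Ω g A.form)) :=
  fun A _ p hp => (normSq_PhiOmega hP hg B A p).trans (quad_coeffPhi hn hg B A hp).symm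

lemma hasCoeff_primitive (hn : n ≠ 0) {Ω : SymplecticForm n M} {g : RiemMetric n M} (hg : Compatible Ω g)
    (B : AdInvariantInner EG G) :
    HasCoeff pr B (QuadCoeff.curvature g - QuadCoeff.phi hg) (fun (A : Connection EG G EP P) =>
      normSq pr g B A.form (primitivePart G pr Ω g A.form)) := by
  intro A x₀ p hp
  have h := quad_sub B (coeffF g x₀ (pr p)) (coeffPhi Ω x₀ (pr p))
    (formComp pr A.form x₀ (YangMills.curvature G A.form) p)
  rw [quad_coeffPhi hn hg B A hp, ← normSq_curvature g B A hp] at h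
  exact (normSq_primitivePart hP hn hg B A p).trans h.symm

end Coefficients

/-! ### The formal adjoint of the covariant derivative -/

section Codifferential
open Filter Topology

variable {n : ℕ} {M : Type*} [TopologicalSpace M] [ChartedSpace (Euc n) M]
  [IsManifold 𝓘(ℝ, Euc n) ∞ M]
  {EG : Type*} [NormedAddCommGroup EG] [NormedSpace ℝ EG]
  {G : Type*} [TopologicalSpace G] [ChartedSpace EG G] [Group G] [LieGroup 𝓘(ℝ, EG) ∞ G]
  {EP : Type*} [NormedAddCommGroup EP] [NormedSpace ℝ EP]
  {P : Type*} [TopologicalSpace P] [ChartedSpace EP P] [IsManifold 𝓘(ℝ, EP) ∞ P] [MulAction Gᵐᵒᵖ P]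
  {pr : P → M} (hP : IsPrincipalBundle (Euc n) EG G EP pr)

include hP

/-- The components of the curvature on the whole preimage of the domain of a gauge. -/
lemma Gauge.formComp_curvature_eq_extend {x₀ : M} (γ : Gauge (Euc n) EG G EP pr x₀)
    (A : Connection EG G EP P) {q : P} (hq : pr q ∈ γ.base) (k l : Fin (2 * n)) :
    formComp pr A.form x₀ (curvature G A.form) q k l =
      γ.extend (fun y => γ.curv A.form y (stdv n k) (stdv n l)) q := by
  have hs : pr q ∈ (chartAt (Euc n) x₀).source := by simpa using hq.1
  have h1 := formComp_curvature_right hP A (γ.mem_source hq.2) (γ.fib q) k l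
  rw [γ.sec_fib q hs hq.2, γ.formComp_curvature hP A hq.2] at h1
  exact h1

/-- `√(det g) N F` as an equivariant function on the bundle. -/
lemma Gauge.smul_raise_eq_extend {x₀ : M} (γ : Gauge (Euc n) EG G EP pr x₀) (g : RiemMetric n M)
    (N : QuadCoeff n M) (A : Connection EG G EP P) {q : P} (hq : pr q ∈ γ.base) (i j : Fin (2 * n)) :
    density g x₀ (pr q) • raise (N.coeff x₀ (pr q)) (formComp pr A.form x₀ (curvature G A.form) q) i j =
      γ.extend (γ.momentum g N A i j) q := by
  simp only [raise, γ.formComp_curvature_eq_extend hP A hq]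
  simp only [Gauge.extend, Gauge.momentum, raise, map_smul, map_sum]
  rw [(extChartAt 𝓘(ℝ, Euc n) x₀).left_inv hq.1]

lemma Gauge.eventually_mem_base {x₀ : M} (γ : Gauge (Euc n) EG G EP pr x₀) {p : P} (hp : pr p ∈ γ.base) :
    ∀ᶠ q in 𝓝 p, pr q ∈ γ.base :=
  hP.smooth_proj.continuous.continuousAt.eventually (γ.isOpen_base.mem_nhds hp)

lemma Gauge.dirDeriv_frame (A : Connection EG G EP P) {x₀ : M}
    (γ : Gauge (Euc n) EG G EP pr x₀) {y : Euc n} (hy : y ∈ γ.dom)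
    {R : Euc n → EG} (hR : ContDiffAt ℝ ∞ R y) {p : P} (hp : γ.sec y = p) {Q : P → EG}
    (hQ : Q =ᶠ[𝓝 p] γ.extend R) (i : Fin (2 * n)) :
    dirDeriv Q p (horLift (Euc n) pr A.form p (frame x₀ i (pr p))) =
      fderiv ℝ R y (stdv n i) + adL G (pullForm A.form γ.sec y (stdv n i)) (R y) := by
  subst hp
  rw [← γ.dirDeriv_extend_horLift hP A hy hR hQ]
  exact congrArg (fun a : Euc n => dirDeriv Q (γ.sec y) (horLift (Euc n) pr A.form (γ.sec y) a))
    (γ.frame_sec hy i)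

/-- The formal adjoint of the covariant derivative is minus the Euler-Lagrange expression, divided
by the density and with the index lowered. -/
lemma codiff_eq (g : RiemMetric n M) (N : QuadCoeff n M) (A : Connection EG G EP P)
    {α : (p : P) → TangentSpace 𝓘(ℝ, EP) p → TangentSpace 𝓘(ℝ, EP) p → EG}
    (hα : ∀ (x₀ : M) (q : P), pr q ∈ (chartAt (Euc n) x₀).source → ∀ i j,
      compUp pr g A.form x₀ α q i j =
        raise (N.coeff x₀ (pr q)) (formComp pr A.form x₀ (curvature G A.form) q) i j)
    (p : P) (γ : Gauge (Euc n) EG G EP pr (pr p)) (hp : pr p ∈ γ.base)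
    (hγ : γ.sec (extChartAt 𝓘(ℝ, Euc n) (pr p) (pr p)) = p) (u : Euc n) :
    codiff pr g A.form α p u = -∑ j, (metricAt g (pr p) (frameV (pr p) j (pr p)) u *
      (density g (pr p) (pr p))⁻¹) •
        γ.eulerLagrange g N A j (extChartAt 𝓘(ℝ, Euc n) (pr p) (pr p)) := by
  have h1 : ∀ i j, dirDeriv (fun q : P => density g (pr p) (pr q) • compUp pr g A.form (pr p) α q i j) p
      (horLift (Euc n) pr A.form p (frame (pr p) i (pr p))) =
      fderiv ℝ (γ.momentum g N A i j) (extChartAt 𝓘(ℝ, Euc n) (pr p) (pr p)) (stdv n i) +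
        adL G (pullForm A.form γ.sec (extChartAt 𝓘(ℝ, Euc n) (pr p) (pr p)) (stdv n i))
          (γ.momentum g N A i j (extChartAt 𝓘(ℝ, Euc n) (pr p) (pr p))) := by
    intro i j
    refine γ.dirDeriv_frame hP A hp.2
      ((γ.contDiffOn_momentum g N A i j).contDiffAt (γ.isOpen.mem_nhds hp.2)) hγ ?_ i
    filter_upwards [γ.eventually_mem_base hP hp] with q hq
    rw [hα (pr p) q (by simpa using hq.1), γ.smul_raise_eq_extend hP g N A hq]
  unfold codiff
  simp only [h1]
  rw [Finset.sum_comm]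
  simp only [Gauge.eulerLagrange, covDivergence, Finset.smul_sum]
  rfl

lemma forall_codiff_eq_zero_iff (g : RiemMetric n M) (N : QuadCoeff n M) (A : Connection EG G EP P)
    {α : (p : P) → TangentSpace 𝓘(ℝ, EP) p → TangentSpace 𝓘(ℝ, EP) p → EG}
    (hα : ∀ (x₀ : M) (q : P), pr q ∈ (chartAt (Euc n) x₀).source → ∀ i j,
      compUp pr g A.form x₀ α q i j =
        raise (N.coeff x₀ (pr q)) (formComp pr A.form x₀ (curvature G A.form) q) i j)
    (p : P) (γ : Gauge (Euc n) EG G EP pr (pr p)) (hp : pr p ∈ γ.base)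
    (hγ : γ.sec (extChartAt 𝓘(ℝ, Euc n) (pr p) (pr p)) = p) :
    (∀ u, codiff pr g A.form α p u = 0) ↔
      ∀ j, γ.eulerLagrange g N A j (extChartAt 𝓘(ℝ, Euc n) (pr p) (pr p)) = 0 := by
  have hs := mem_chart_source (Euc n) (pr p)
  constructor
  · intro h m
    -- the dual frame isolates one component
    set u : Euc n := ∑ k, (gram g (pr p) (pr p))⁻¹ k m • frameV (pr p) k (pr p) with hu
    have h1 : ∀ j, metricAt g (pr p) (frameV (pr p) j (pr p)) u = if j = m then 1 else 0 := by
      intro j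
      have h2 := congrFun (congrFun
        (Matrix.mul_nonsing_inv (gram g (pr p) (pr p)) (gram_det_pos g hs).ne'.isUnit) j) m
      rw [Matrix.mul_apply, Matrix.one_apply] at h2
      rw [hu, map_sum, ← h2]
      refine Finset.sum_congr rfl fun k _ => ?_
      rw [map_smul, smul_eq_mul, mul_comm]
      rfl
    have h2 := (codiff_eq hP g N A hα p γ hp hγ u).symm.trans (h u)
    simp only [h1, ite_mul, one_mul, zero_mul, ite_smul, zero_smul, Finset.sum_ite_eq', Finset.mem_univ,
      if_true, neg_eq_zero] at h2
    exact (smul_eq_zero.1 h2).resolve_left (inv_ne_zero (density_pos g hs).ne')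
  · intro h u
    refine (codiff_eq hP g N A hα p γ hp hγ u).trans ?_
    simp only [h, smul_zero, Finset.sum_const_zero, neg_zero]

/-- A condition on the points of the bundle and the gauges through them, that only depends on the
point or only depends on the gauge. -/
lemma forall_gauge_iff {C : P → Prop} {D : (x : M) → Gauge (Euc n) EG G EP pr x → Prop}
    (h : ∀ (p : P) (γ : Gauge (Euc n) EG G EP pr (pr p)), pr p ∈ γ.base →
      γ.sec (extChartAt 𝓘(ℝ, Euc n) (pr p) (pr p)) = p → (C p ↔ D (pr p) γ)) :
    (∀ (x : M) (γ : Gauge (Euc n) EG G EP pr x), x ∈ γ.base → D x γ) ↔ ∀ p, C p := by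
  constructor
  · intro hD p
    obtain ⟨γ, hy, hγ⟩ := hP.exists_gauge (pr p) p (mem_chart_source _ _)
    have hb : pr p ∈ γ.base := ⟨mem_extChartAt_source _, hy⟩
    exact (h p γ hb hγ).2 (hD _ γ hb)
  · intro hC x γ hx
    obtain ⟨p, hp⟩ : ∃ p, γ.sec (extChartAt 𝓘(ℝ, Euc n) x x) = p := ⟨_, rfl⟩
    have hpx : pr p = x := by
      rw [← hp, γ.proj_sec _ hx.2, extChartAt_to_inv]
    subst hpx
    exact (h p γ hx hp).1 (hC p)

variable [T2Space M] [SigmaCompactSpace M] [MeasurableSpace M] [BorelSpace M]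

/-- The critical points of a functional that is quadratic in the curvature, when its first variation
is represented by a two-form. -/
theorem HasCoeff.isCriticalPoint_iff_codiff {B : AdInvariantInner EG G} {N : QuadCoeff n M}
    {e : Connection EG G EP P → P → ℝ} (g : RiemMetric n M) (he : HasCoeff pr B N e)
    {S : Set M → ((p : P) → TangentSpace 𝓘(ℝ, EP) p →L[ℝ] EG) → ℝ}
    (hS : ∀ K (A : Connection EG G EP P), S K A.form = integralOver pr g K (e A))
    (A : Connection EG G EP P)
    {α : (p : P) → TangentSpace 𝓘(ℝ, EP) p → TangentSpace 𝓘(ℝ, EP) p → EG}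
    (hα : ∀ (x₀ : M) (q : P), pr q ∈ (chartAt (Euc n) x₀).source → ∀ i j,
      compUp pr g A.form x₀ α q i j =
        raise (N.coeff x₀ (pr q)) (formComp pr A.form x₀ (curvature G A.form) q) i j) :
    IsCriticalPoint pr S A ↔ ∀ p u, codiff pr g A.form α p u = 0 := by
  rw [he.isCriticalPoint_iff hP g hS A]
  exact forall_gauge_iff hP fun p γ hp hγ => forall_codiff_eq_zero_iff hP g N A hα p γ hp hγ

end Codifferential

/-! ### The divergence of the bivector dual to a closed two-form -/

section Jacobi
open Filter Topology

variable {m : ℕ} {E : Type*} [NormedAddCommGroup E] [NormedSpace ℝ E]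
  {A : E → Matrix (Fin m) (Fin m) ℝ} {y : E}

/-- Jacobi's formula for the derivative of a determinant. -/
lemma hasFDerivAt_det {A' : Fin m → Fin m → E →L[ℝ] ℝ} (hA : ∀ i j, HasFDerivAt (fun z => A z i j) (A' i j) y) :
    HasFDerivAt (fun z => (A z).det) (∑ i, ∑ j, (A y).adjugate j i • A' i j) y := by
  let f : ContinuousMultilinearMap ℝ (fun _ : Fin m => Fin m → ℝ) ℝ :=
    { toMultilinearMap := (Matrix.detRowAlternating (R := ℝ) (n := Fin m)).toMultilinearMap
      cont := Continuous.matrix_det continuous_id }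
  have h1 : HasFDerivAt (fun z i j => A z i j)
      (ContinuousLinearMap.pi fun i => ContinuousLinearMap.pi fun j => A' i j) y :=
    hasFDerivAt_pi.2 fun i => hasFDerivAt_pi.2 fun j => hA i j
  have h2 := (f.hasFDerivAt (A y)).comp y h1
  refine h2.congr_fderiv ?_
  ext v
  refine (f.linearDeriv_apply (A y) _).trans ?_
  simp only [sum_apply, smul_apply]
  refine Finset.sum_congr rfl fun i _ => ?_
  have h3 : f (Function.update (A y) i fun j => A' i j v) = ((A y).updateRow i fun j => A' i j v).det := rfl
  refine h3.trans ?_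
  rw [← Matrix.cramer_transpose_apply, Matrix.cramer_eq_adjugate_mulVec, ← Matrix.adjugate_transpose]
  rfl

/-- The derivative of the inverse of a matrix. -/
lemma fderiv_inv_entry {U : Set E} (hU : IsOpen U) (hy : y ∈ U)
    (hA : ∀ i j, ContDiffOn ℝ ∞ (fun z => A z i j) U) (hdet : ∀ z ∈ U, (A z).det ≠ 0) (i j : Fin m) (v : E) :
    fderiv ℝ (fun z => (A z)⁻¹ i j) y v =
      -∑ a, ∑ b, (A y)⁻¹ i a * fderiv ℝ (fun z => A z a b) y v * (A y)⁻¹ b j := by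
  have hdA : ∀ i j, DifferentiableAt ℝ (fun z => A z i j) y := fun i j =>
    ((hA i j).contDiffAt (hU.mem_nhds hy)).differentiableAt (by simp)
  have hdW : ∀ i j, DifferentiableAt ℝ (fun z => (A z)⁻¹ i j) y := fun i j =>
    ((contDiffOn_inv_entry hA hdet i j).contDiffAt (hU.mem_nhds hy)).differentiableAt (by simp)
  set D : Matrix (Fin m) (Fin m) ℝ := Matrix.of fun a b => fderiv ℝ (fun z => A z a b) y v
  set D' : Matrix (Fin m) (Fin m) ℝ := Matrix.of fun a b => fderiv ℝ (fun z => (A z)⁻¹ a b) y v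
  have h1 : D' * A y + (A y)⁻¹ * D = 0 := by
    ext k b
    have h2 : (fun z => ∑ a, (A z)⁻¹ k a * A z a b) =ᶠ[𝓝 y] fun _ => (1 : Matrix (Fin m) (Fin m) ℝ) k b := by
      filter_upwards [hU.mem_nhds hy] with z hz
      rw [← Matrix.nonsing_inv_mul (A z) (hdet z hz).isUnit, Matrix.mul_apply]
    have h3 := congrArg (fun L : E →L[ℝ] ℝ => L v) h2.fderiv_eq
    rw [fderiv_fun_sum fun a _ => (hdW k a).fun_mul (hdA a b), sum_apply, fderiv_const_apply] at h3
    rw [Matrix.add_apply, Matrix.mul_apply, Matrix.mul_apply, ← Finset.sum_add_distrib, Matrix.zero_apply]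
    refine Eq.trans (Finset.sum_congr rfl fun a _ => ?_) h3
    rw [fderiv_fun_mul (hdW k a) (hdA a b), add_apply, smul_apply, smul_apply, smul_eq_mul, smul_eq_mul,
      add_comm]
    exact congrArg (_ + ·) (mul_comm _ _)
  have h2 : D' = -((A y)⁻¹ * D * (A y)⁻¹) := by
    rw [← Matrix.neg_mul, ← eq_neg_of_add_eq_zero_left h1, Matrix.mul_assoc,
      Matrix.mul_nonsing_inv _ (hdet y hy).isUnit, Matrix.mul_one]
  have h3 := congrFun (congrFun h2 i) j
  refine h3.trans ?_
  rw [Matrix.neg_apply, Matrix.mul_apply, Finset.sum_comm]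
  refine congrArg Neg.neg (Finset.sum_congr rfl fun b _ => ?_)
  rw [Matrix.mul_apply, Finset.sum_mul]
  rfl

/-- Jacobi's formula `d √|det A| = ½ √|det A| tr (A⁻¹ dA)`. -/
lemma fderiv_sqrt_abs_det (hA : ∀ i j, DifferentiableAt ℝ (fun z => A z i j) y) (hdet : (A y).det ≠ 0) (v : E) :
    fderiv ℝ (fun z => Real.sqrt |(A z).det|) y v = 1 / 2 * Real.sqrt |(A y).det| *
      ∑ a, ∑ b, (A y)⁻¹ b a * fderiv ℝ (fun z => A z a b) y v := by
  have h1 := hasFDerivAt_det fun i j => (hA i j).hasFDerivAt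
  have h2 := ((hasDerivAt_abs hdet).comp_hasFDerivAt y h1).sqrt (by simpa using hdet)
  have h3 : ∀ a b, (A y).adjugate b a = (A y).det * (A y)⁻¹ b a := by
    intro a b
    rw [Matrix.inv_def, Matrix.smul_apply, Ring.inverse_eq_inv', smul_eq_mul, mul_inv_cancel_left₀ hdet]
  have h4 : 0 < Real.sqrt |(A y).det| := Real.sqrt_pos.2 (abs_pos.2 hdet)
  have h5 : Real.sqrt |(A y).det| * Real.sqrt |(A y).det| = SignType.sign (A y).det * (A y).det := by
    rw [Real.mul_self_sqrt (abs_nonneg _), sign_mul_self]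
  have h6 := congrArg (fun L : E →L[ℝ] ℝ => L v) h2.fderiv
  refine h6.trans ?_
  simp only [smul_apply, sum_apply, smul_eq_mul, h3, Function.comp]
  simp only [mul_assoc, ← Finset.mul_sum]
  set S := ∑ a, ∑ b, (A y)⁻¹ b a * fderiv ℝ (fun z => A z a b) y v
  have h7 : (SignType.sign (A y).det : ℝ) * ((A y).det * S) =
      Real.sqrt |(A y).det| * Real.sqrt |(A y).det| * S := by rw [h5]; ring
  rw [h7]
  field_simp

/-- The algebraic identity behind the vanishing of the divergence of the bivector dual to a closed
two-form: with the inverse matrix `W` and the derivatives `D i a b = ∂_i A_{ab}`, it compares the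
derivative of the density with that of the inverse. -/
lemma sum_mul_eq_of_cyclic {W : Fin m → Fin m → ℝ} {D : Fin m → Fin m → Fin m → ℝ}
    (hW : ∀ a b, W a b = -W b a) (hD : ∀ i a b, D i a b = -D i b a)
    (hcyc : ∀ i a b, D i a b + D a b i + D b i a = 0) (j : Fin m) :
    ∑ i, ∑ a, ∑ b, W i j * (W b a * D i a b) = 2 * ∑ i, ∑ a, ∑ b, W i a * D i a b * W b j := by
  have h1 : ∀ i a b, W i j * (W b a * D i a b) = W b a * D b a i * W i j + W a b * D a b i * W i j := by
    intro i a b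
    rw [show D i a b = -D a b i - D b i a by linarith [hcyc i a b], hD b i a, hW a b]
    ring
  have h2 : ∑ i, ∑ a, ∑ b, W a b * D a b i * W i j = ∑ i, ∑ a, ∑ b, W i a * D i a b * W b j := by
    rw [Finset.sum_comm]
    exact Finset.sum_congr rfl fun a _ => Finset.sum_comm
  have h3 : ∑ i, ∑ a, ∑ b, W b a * D b a i * W i j = ∑ i, ∑ a, ∑ b, W i a * D i a b * W b j := by
    rw [← h2]
    exact Finset.sum_congr rfl fun i _ => Finset.sum_comm
  simp only [h1, Finset.sum_add_distrib]
  rw [h2, h3]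
  ring

/-- The vanishing of the divergence of `√|det A| A⁻¹` for an invertible antisymmetric matrix `A` whose
entries are the components of a two-form that is closed at `y`. -/
lemma sum_fderiv_sqrt_det_mul_inv {U : Set E} (hU : IsOpen U) (hy : y ∈ U)
    (hA : ∀ i j, ContDiffOn ℝ ∞ (fun z => A z i j) U) (hdet : ∀ z ∈ U, (A z).det ≠ 0)
    (hanti : ∀ z i j, A z i j = -A z j i) (hW : ∀ i j, (A y)⁻¹ i j = -(A y)⁻¹ j i) {e : Fin m → E}
    (hcyc : ∀ i j k, fderiv ℝ (fun z => A z j k) y (e i) + fderiv ℝ (fun z => A z k i) y (e j) +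
      fderiv ℝ (fun z => A z i j) y (e k) = 0) (j : Fin m) :
    ∑ i, fderiv ℝ (fun z => Real.sqrt |(A z).det| * (A z)⁻¹ i j) y (e i) = 0 := by
  have hdA : ∀ i j, DifferentiableAt ℝ (fun z => A z i j) y := fun i j =>
    ((hA i j).contDiffAt (hU.mem_nhds hy)).differentiableAt (by simp)
  have hdW : ∀ i j, DifferentiableAt ℝ (fun z => (A z)⁻¹ i j) y := fun i j =>
    ((contDiffOn_inv_entry hA hdet i j).contDiffAt (hU.mem_nhds hy)).differentiableAt (by simp)
  have hρ : DifferentiableAt ℝ (fun z => Real.sqrt |(A z).det|) y :=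
    ((hasFDerivAt_det fun i j => (hdA i j).hasFDerivAt).differentiableAt.abs (hdet y hy)).sqrt
      (by simpa using hdet y hy)
  have hD : ∀ i a b, fderiv ℝ (fun z => A z a b) y (e i) = -fderiv ℝ (fun z => A z b a) y (e i) := by
    intro i a b
    rw [show (fun z => A z a b) = fun z => -A z b a from funext fun z => hanti z a b, fderiv_fun_neg,
      neg_apply]
  have key := sum_mul_eq_of_cyclic hW hD hcyc j
  simp only [fderiv_fun_mul hρ (hdW _ j), add_apply, smul_apply, smul_eq_mul,
    fderiv_inv_entry hU hy hA hdet, fderiv_sqrt_abs_det hdA (hdet y hy), Finset.sum_add_distrib]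
  simp only [mul_neg, Finset.sum_neg_distrib, ← Finset.mul_sum] at key ⊢
  have h1 : ∀ i, (A y)⁻¹ i j * (1 / 2 * Real.sqrt |(A y).det| *
      ∑ a, ∑ b, (A y)⁻¹ b a * fderiv ℝ (fun z => A z a b) y (e i)) = 1 / 2 * Real.sqrt |(A y).det| *
      ((A y)⁻¹ i j * ∑ a, ∑ b, (A y)⁻¹ b a * fderiv ℝ (fun z => A z a b) y (e i)) := fun i => by ring
  simp only [h1, ← Finset.mul_sum, key]
  ring

end Jacobi

/-! ### The Euler-Lagrange equations of the symplectic part -/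

section SymplecticPart
open Filter Topology

variable {n : ℕ} {M : Type*} [TopologicalSpace M] [ChartedSpace (Euc n) M]
  [IsManifold 𝓘(ℝ, Euc n) ∞ M]

/-- The closedness of the symplectic form, in coordinates. -/
lemma omegaMat_cyclic (Ω : SymplecticForm n M) (x : M) (i j k : Fin (2 * n)) :
    fderiv ℝ (fun z => omegaMat Ω x ((extChartAt 𝓘(ℝ, Euc n) x).symm z) j k)
        (extChartAt 𝓘(ℝ, Euc n) x x) (stdv n i) +
      fderiv ℝ (fun z => omegaMat Ω x ((extChartAt 𝓘(ℝ, Euc n) x).symm z) k i)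
        (extChartAt 𝓘(ℝ, Euc n) x x) (stdv n j) +
      fderiv ℝ (fun z => omegaMat Ω x ((extChartAt 𝓘(ℝ, Euc n) x).symm z) i j)
        (extChartAt 𝓘(ℝ, Euc n) x x) (stdv n k) = 0 := by
  have h1 : ∀ (i j : Fin (2 * n)) (u : Euc n), dirDeriv (fun x' => omegaMat Ω x x' i j) x u =
      fderiv ℝ (fun z => omegaMat Ω x ((extChartAt 𝓘(ℝ, Euc n) x).symm z) i j)
        (extChartAt 𝓘(ℝ, Euc n) x x) u := fun i j u =>
    mfderiv_comp_extChartAt (f := fun x' => omegaMat Ω x x' i j)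
      (((contDiffOn_omegaMat Ω x i j).contDiffAt (extChartAt_target_mem_nhds x)).of_le (by simp)) u
  rw [← h1, ← h1, ← h1]
  exact Ω.closed x (stdv n i) (stdv n j) (stdv n k)

/-- The bivector dual to the symplectic form is divergence free. -/
lemma sum_fderiv_density_mul_omega_inv {Ω : SymplecticForm n M} {g : RiemMetric n M} (hg : Compatible Ω g)
    (x : M) (j : Fin (2 * n)) :
    ∑ i, fderiv ℝ (fun z => density g x ((extChartAt 𝓘(ℝ, Euc n) x).symm z) *
      (omegaMat Ω x ((extChartAt 𝓘(ℝ, Euc n) x).symm z))⁻¹ i j) (extChartAt 𝓘(ℝ, Euc n) x x)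
        (stdv n i) = 0 := by
  rw [← sum_fderiv_sqrt_det_mul_inv (isOpen_extChartAt_target x) (mem_extChartAt_target x)
    (contDiffOn_omegaMat Ω x) (fun z hz => (omegaMat_isUnit_det hg (mem_source_of_mem_target hz)).ne_zero)
    (fun z => omegaMat_antisymm Ω x _) (omegaMat_inv_antisymm Ω x _) (omegaMat_cyclic Ω x) j]
  refine Finset.sum_congr rfl fun i _ => ?_
  refine congrArg (fun L : Euc n →L[ℝ] ℝ => L (stdv n i)) (EventuallyEq.fderiv_eq ?_)
  filter_upwards [extChartAt_target_mem_nhds (I := 𝓘(ℝ, Euc n)) x] with z hz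
  rw [density_eq_sqrt_abs_det hg (mem_source_of_mem_target hz)]

variable {EG : Type*} [NormedAddCommGroup EG] [NormedSpace ℝ EG]
  {G : Type*} [TopologicalSpace G] [ChartedSpace EG G] [Group G] [LieGroup 𝓘(ℝ, EG) ∞ G]
  {EP : Type*} [NormedAddCommGroup EP] [NormedSpace ℝ EP]
  {P : Type*} [TopologicalSpace P] [ChartedSpace EP P] [IsManifold 𝓘(ℝ, EP) ∞ P] [MulAction Gᵐᵒᵖ P]
  {pr : P → M} (hP : IsPrincipalBundle (Euc n) EG G EP pr)

/-- The coefficient `Φ` in a gauge. -/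
def Gauge.phi (Ω : SymplecticForm n M) (A : Connection EG G EP P) {x₀ : M}
    (γ : Gauge (Euc n) EG G EP pr x₀) (y : Euc n) : EG :=
  -(1 / (2 * (n : ℝ))) • ∑ k, ∑ l, (omegaMat Ω x₀ ((extChartAt 𝓘(ℝ, Euc n) x₀).symm y))⁻¹ k l •
    γ.curv A.form y (stdv n k) (stdv n l)

lemma Gauge.contDiffOn_phi {Ω : SymplecticForm n M} {g : RiemMetric n M} (hg : Compatible Ω g)
    (A : Connection EG G EP P) {x₀ : M} (γ : Gauge (Euc n) EG G EP pr x₀) :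
    ContDiffOn ℝ ∞ (γ.phi Ω A) γ.dom :=
  contDiffOn_const.smul (ContDiffOn.sum fun k _ => ContDiffOn.sum fun l _ =>
    ((contDiffOn_omegaMat_inv hg x₀ k l).mono γ.subset).smul (γ.contDiffOn_curv A _ _))

lemma Gauge.momentum_phi {Ω : SymplecticForm n M} {g : RiemMetric n M} (hg : Compatible Ω g)
    (A : Connection EG G EP P) {x₀ : M} (γ : Gauge (Euc n) EG G EP pr x₀) (i j : Fin (2 * n)) (y : Euc n) :
    γ.momentum g (QuadCoeff.phi hg) A i j y = -((density g x₀ ((extChartAt 𝓘(ℝ, Euc n) x₀).symm y) *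
      (omegaMat Ω x₀ ((extChartAt 𝓘(ℝ, Euc n) x₀).symm y))⁻¹ i j) • γ.phi Ω A y) := by
  have h : ∀ x k l, (QuadCoeff.phi hg).coeff x₀ x i j k l =
      1 / (2 * (n : ℝ)) * ((omegaMat Ω x₀ x)⁻¹ i j * (omegaMat Ω x₀ x)⁻¹ k l) := fun _ _ _ => rfl
  simp only [Gauge.momentum, raise, h, Gauge.phi, Finset.smul_sum, smul_smul, ← Finset.sum_neg_distrib,
    ← neg_smul]
  refine Finset.sum_congr rfl fun k _ => Finset.sum_congr rfl fun l _ => ?_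
  congr 1
  ring

/-- At the centre of a chart, the Euler-Lagrange expression of `‖Φ ω‖²` is the contraction of `d_A Φ`
with the bivector dual to the symplectic form. -/
lemma Gauge.eulerLagrange_phi {Ω : SymplecticForm n M} {g : RiemMetric n M} (hg : Compatible Ω g)
    (A : Connection EG G EP P) {x : M} (γ : Gauge (Euc n) EG G EP pr x) (hx : x ∈ γ.base)
    (j : Fin (2 * n)) :
    γ.eulerLagrange g (QuadCoeff.phi hg) A j (extChartAt 𝓘(ℝ, Euc n) x x) =
      -∑ i, (density g x x * (omegaMat Ω x x)⁻¹ i j) •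
        (fderiv ℝ (γ.phi Ω A) (extChartAt 𝓘(ℝ, Euc n) x x) (stdv n i) +
          adL G (pullForm A.form γ.sec (extChartAt 𝓘(ℝ, Euc n) x x) (stdv n i))
            (γ.phi Ω A (extChartAt 𝓘(ℝ, Euc n) x x))) := by
  set y := extChartAt 𝓘(ℝ, Euc n) x x with hy
  set c : Fin (2 * n) → Euc n → ℝ := fun i z => density g x ((extChartAt 𝓘(ℝ, Euc n) x).symm z) *
      (omegaMat Ω x ((extChartAt 𝓘(ℝ, Euc n) x).symm z))⁻¹ i j with hc
  have hyx : (extChartAt 𝓘(ℝ, Euc n) x).symm y = x := extChartAt_to_inv x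
  have hdc : ∀ i, DifferentiableAt ℝ (c i) y := fun i =>
    (((contDiffOn_density g x).mul (contDiffOn_omegaMat_inv hg x i j)).contDiffAt
      (extChartAt_target_mem_nhds x)).differentiableAt (by simp)
  have hdφ : DifferentiableAt ℝ (γ.phi Ω A) y :=
    ((γ.contDiffOn_phi hg A).contDiffAt (γ.isOpen.mem_nhds hx.2)).differentiableAt (by simp)
  have hm : ∀ i, γ.momentum g (QuadCoeff.phi hg) A i j = fun z => -(c i z • γ.phi Ω A z) := fun i =>
    funext fun z => γ.momentum_phi hg A i j z
  have h0 : ∑ i, fderiv ℝ (c i) y (stdv n i) = 0 := sum_fderiv_density_mul_omega_inv hg x j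
  have hcy : ∀ i, c i y = density g x x * (omegaMat Ω x x)⁻¹ i j := by
    intro i
    simp only [hc, hyx]
  simp only [Gauge.eulerLagrange, covDivergence, hm, ← hcy]
  have h1 : ∀ i, fderiv ℝ (fun z => -(c i z • γ.phi Ω A z)) y (stdv n i) +
      adL G (pullForm A.form γ.sec y (stdv n i)) (-(c i y • γ.phi Ω A y)) =
      -(c i y • (fderiv ℝ (γ.phi Ω A) y (stdv n i) +
          adL G (pullForm A.form γ.sec y (stdv n i)) (γ.phi Ω A y))) -
        fderiv ℝ (c i) y (stdv n i) • γ.phi Ω A y := by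
    intro i
    rw [fderiv_fun_neg, fderiv_fun_smul (hdc i) hdφ]
    simp only [neg_apply, add_apply, smul_apply, ContinuousLinearMap.smulRight_apply, map_neg, map_smul,
      smul_add]
    abel
  simp only [h1, Finset.sum_sub_distrib, ← Finset.sum_smul, h0, zero_smul, sub_zero, Finset.sum_neg_distrib]

include hP

lemma Gauge.PhiOf_eq_extend {Ω : SymplecticForm n M} {g : RiemMetric n M} (hg : Compatible Ω g)
    (A : Connection EG G EP P) {x₀ : M} (γ : Gauge (Euc n) EG G EP pr x₀) {q : P} (hq : pr q ∈ γ.base) :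
    PhiOf G pr Ω g A.form q = γ.extend (γ.phi Ω A) q := by
  rw [PhiOf_eq hg A (x₀ := x₀) (by simpa using hq.1)]
  simp only [γ.formComp_curvature_eq_extend hP A hq]
  simp only [Gauge.extend, Gauge.phi, map_smul, map_sum]
  rw [(extChartAt 𝓘(ℝ, Euc n) x₀).left_inv hq.1]

/-- The covariant derivative of `Φ` vanishes at a point of a section if and only if its local
expression does. -/
lemma Gauge.forall_covDeriv_phi_eq_zero_iff {Ω : SymplecticForm n M} {g : RiemMetric n M}
    (hg : Compatible Ω g) (A : Connection EG G EP P) {x₀ : M} (γ : Gauge (Euc n) EG G EP pr x₀)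
    {y : Euc n} (hy : y ∈ γ.dom) {p : P} (hp : γ.sec y = p) :
    (∀ u, covDeriv G A.form (PhiOf G pr Ω g A.form) p u = 0) ↔
      ∀ i, fderiv ℝ (γ.phi Ω A) y (stdv n i) +
        adL G (pullForm A.form γ.sec y (stdv n i)) (γ.phi Ω A y) = 0 := by
  subst hp
  have hR := (γ.contDiffOn_phi hg A).contDiffAt (γ.isOpen.mem_nhds hy)
  have hb : pr (γ.sec y) ∈ γ.base := by
    rw [γ.proj_sec y hy]
    exact γ.symm_mem_base hy
  have hQ : PhiOf G pr Ω g A.form =ᶠ[𝓝 (γ.sec y)] γ.extend (γ.phi Ω A) := by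
    filter_upwards [γ.eventually_mem_base hP hb] with q hq using γ.PhiOf_eq_extend hP hg A hq
  have h1 := fun v ξ => γ.covDeriv_extend hP A hy hR hQ v ξ
  constructor
  · intro h i
    rw [← h1 (stdv n i) 0]
    exact h _
  · intro h u
    refine (congrArg (fun w : EP => covDeriv G A.form (PhiOf G pr Ω g A.form) (γ.sec y) w)
      (γ.decomp hP hy u)).trans ?_
    refine (h1 _ _).trans ?_
    set v := mder (Euc n) (Euc n) (extChartAt 𝓘(ℝ, Euc n) x₀) (pr (γ.sec y))
      (mder EP (Euc n) pr (γ.sec y) u)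
    set L : Euc n →L[ℝ] EG := fderiv ℝ (γ.phi Ω A) y +
      ((adL G).flip (γ.phi Ω A y)).comp (pullForm A.form γ.sec y)
    have hL : ∀ w, fderiv ℝ (γ.phi Ω A) y w + adL G (pullForm A.form γ.sec y w) (γ.phi Ω A y) = L w :=
      fun _ => rfl
    rw [hL, sum_single_eq v, map_sum]
    refine Finset.sum_eq_zero fun i _ => ?_
    rw [map_smul, ← hL, h i, smul_zero]

/-- The Euler-Lagrange equations of `‖Φ ω‖²` amount to `d_A Φ = 0`, as the matrix of the symplectic form
is invertible. -/
lemma forall_covDeriv_phi_iff_eulerLagrange {Ω : SymplecticForm n M} {g : RiemMetric n M}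
    (hg : Compatible Ω g) (A : Connection EG G EP P) (p : P) (γ : Gauge (Euc n) EG G EP pr (pr p))
    (hp : pr p ∈ γ.base) (hγ : γ.sec (extChartAt 𝓘(ℝ, Euc n) (pr p) (pr p)) = p) :
    (∀ u, covDeriv G A.form (PhiOf G pr Ω g A.form) p u = 0) ↔
      ∀ j, γ.eulerLagrange g (QuadCoeff.phi hg) A j (extChartAt 𝓘(ℝ, Euc n) (pr p) (pr p)) = 0 := by
  rw [γ.forall_covDeriv_phi_eq_zero_iff hP hg A hp.2 hγ]
  simp only [γ.eulerLagrange_phi hg A hp, neg_eq_zero]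
  set D : Fin (2 * n) → EG := fun i =>
    fderiv ℝ (γ.phi Ω A) (extChartAt 𝓘(ℝ, Euc n) (pr p) (pr p)) (stdv n i) +
      adL G (pullForm A.form γ.sec (extChartAt 𝓘(ℝ, Euc n) (pr p) (pr p)) (stdv n i))
        (γ.phi Ω A (extChartAt 𝓘(ℝ, Euc n) (pr p) (pr p))) with hD
  have hs := mem_chart_source (Euc n) (pr p)
  have hρ := (density_pos g hs).ne'
  set O := omegaMat Ω (pr p) (pr p) with hO
  change (∀ i, D i = 0) ↔ ∀ j, ∑ i, (density g (pr p) (pr p) * O⁻¹ i j) • D i = 0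
  constructor
  · intro h j
    simp only [h, smul_zero, Finset.sum_const_zero]
  · intro h m
    have h1 : ∀ i, ∑ j, O⁻¹ i j * O j m = if i = m then 1 else 0 := by
      intro i
      rw [← Matrix.mul_apply, Matrix.nonsing_inv_mul _ (omegaMat_isUnit_det hg hs), Matrix.one_apply]
    have h2 : ∑ j, O j m • ∑ i, (density g (pr p) (pr p) * O⁻¹ i j) • D i =
        density g (pr p) (pr p) • D m := by
      simp only [Finset.smul_sum, smul_smul]
      rw [Finset.sum_comm]
      have h3 : ∀ i j, O j m * (density g (pr p) (pr p) * O⁻¹ i j) =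
          density g (pr p) (pr p) * (O⁻¹ i j * O j m) := fun i j => by ring
      simp only [h3, ← Finset.sum_smul, ← Finset.mul_sum, h1, mul_ite, mul_one, mul_zero, ite_smul,
        zero_smul, Finset.sum_ite_eq', Finset.mem_univ, if_true]
    simp only [h, smul_zero, Finset.sum_const_zero] at h2
    exact (smul_eq_zero.1 h2.symm).resolve_left hρ

end SymplecticPart

end YangMills
end

open YangMills
theorem mainTheorem10
    (n : ℕ) (hn : 2 ≤ n)
    {M : Type*} [TopologicalSpace M] [T2Space M] [SigmaCompactSpace M]
    [ChartedSpace (Euc n) M] [IsManifold 𝓘(ℝ, Euc n) ∞ M] [MeasurableSpace M] [BorelSpace M]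
    {EG : Type*} [NormedAddCommGroup EG] [NormedSpace ℝ EG] [FiniteDimensional ℝ EG]
    {G : Type*} [TopologicalSpace G] [ChartedSpace EG G] [Group G] [LieGroup 𝓘(ℝ, EG) ∞ G]
    {EP : Type*} [NormedAddCommGroup EP] [NormedSpace ℝ EP] [FiniteDimensional ℝ EP]
    {P : Type*} [TopologicalSpace P] [ChartedSpace EP P] [IsManifold 𝓘(ℝ, EP) ∞ P]
    [MulAction Gᵐᵒᵖ P]
    (pr : P → M) (hP : IsPrincipalBundle (Euc n) EG G EP pr)
    (Ω : SymplecticForm n M) (g : RiemMetric n M) (hg : Compatible Ω g)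
    (B : AdInvariantInner EG G) (A : Connection EG G EP P) :
    (IsCriticalPoint pr (energyF pr g B) A ↔
      ∀ p u, codiff pr g A.form (curvature G A.form) p u = 0) ∧
    (IsCriticalPoint pr (energyPrimitive pr Ω g B) A ↔
      ∀ p u, codiff pr g A.form (primitivePart G pr Ω g A.form) p u = 0) ∧
    (IsCriticalPoint pr (energyPhiOmega pr Ω g B) A ↔
      ∀ p u, covDeriv G A.form (PhiOf G pr Ω g A.form) p u = 0) ∧
    (IsCriticalPoint pr (energyF pr g B) A → IsCriticalPoint pr (energyPrimitive pr Ω g B) A →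
      IsCriticalPoint pr (energyPhiOmega pr Ω g B) A) ∧
    (IsCriticalPoint pr (energyF pr g B) A → IsCriticalPoint pr (energyPhiOmega pr Ω g B) A →
      IsCriticalPoint pr (energyPrimitive pr Ω g B) A) ∧
    (IsCriticalPoint pr (energyPrimitive pr Ω g B) A → IsCriticalPoint pr (energyPhiOmega pr Ω g B) A →
      IsCriticalPoint pr (energyF pr g B) A) := by 
  have hn0 : n ≠ 0 := by omega
  have hF := hasCoeff_curvature (EP := EP) (P := P) pr g B
  have hΦ := hasCoeff_phi hP hn0 hg B
  have hp := hasCoeff_primitive hP hn0 hg B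
  -- the first variations of `‖F‖²` and `‖F_p‖²` are represented by the two-forms `F` and `F_p`
  have hαF : ∀ (x₀ : M) (q : P), pr q ∈ (chartAt (Euc n) x₀).source → ∀ i j,
      compUp pr g A.form x₀ (curvature G A.form) q i j = raise ((QuadCoeff.curvature g).coeff x₀ (pr q))
        (formComp pr A.form x₀ (curvature G A.form) q) i j := fun _ _ _ _ _ => rfl
  have hαp : ∀ (x₀ : M) (q : P), pr q ∈ (chartAt (Euc n) x₀).source → ∀ i j,
      compUp pr g A.form x₀ (primitivePart G pr Ω g A.form) q i j =
        raise ((QuadCoeff.curvature g - QuadCoeff.phi hg).coeff x₀ (pr q))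
          (formComp pr A.form x₀ (curvature G A.form) q) i j := by
    intro x₀ q hq i j
    rw [compUp_primitivePart hP, compUp_PhiOmega hP hg A hq, ← sum_coeffPhi hg A hq, raise_sub]
    rfl
  have eF := hF.isCriticalPoint_iff hP g (S := energyF pr g B) (fun _ _ => rfl) A
  have ep := hp.isCriticalPoint_iff hP g (S := energyPrimitive pr Ω g B) (fun _ _ => rfl) A
  have eΦ := hΦ.isCriticalPoint_iff hP g (S := energyPhiOmega pr Ω g B) (fun _ _ => rfl) A
  -- the three systems of Euler-Lagrange equations are linearly dependent
  have hsub := fun (x : M) (γ : Gauge (Euc n) EG G EP pr x) (hx : x ∈ γ.base) (j : Fin (2 * n)) =>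
    γ.eulerLagrange_sub g (QuadCoeff.curvature g) (QuadCoeff.phi hg) A j hx.2
  refine ⟨hF.isCriticalPoint_iff_codiff hP g (fun _ _ => rfl) A hαF,
    hp.isCriticalPoint_iff_codiff hP g (fun _ _ => rfl) A hαp,
    eΦ.trans (forall_gauge_iff hP fun p γ hpγ hγ =>
      forall_covDeriv_phi_iff_eulerLagrange hP hg A p γ hpγ hγ), ?_, ?_, ?_⟩
  all_goals
    rw [eF, ep, eΦ]
    intro h1 h2 x γ hx j
    have h3 := hsub x γ hx j
  · rw [h1 x γ hx j, h2 x γ hx j] at h3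
    simpa using h3
  · rw [h1 x γ hx j, h2 x γ hx j, sub_zero] at h3
    exact h3
  · rw [h1 x γ hx j, h2 x γ hx j, sub_zero] at h3
    exact h3.symm
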